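/- Let $K$ be a nonarchimedean local field (a finite extension of $\mathbb{Q}_p$ or $\mathbb{F}_p((t))$) with integer ring $\mathcal{O}_K$ and residue field $k$ of cardinality $q$ and characteristic $p$, let $\Gamma$ be a finite group with $p\nmid\#\Gamma$, and let $\tau:\Gamma\to \mathrm{GL}_d(\mathcal{O}_K)$ be a representation. Let $S_{K,\Gamma}$ be the set of continuous homomorphisms $\rho:\mathrm{Gal}(K^{\mathrm{sep}}/K)\to\Gamma$. *The functions $\mathbf v_\tau,\mathbf w_\tau$.* For $\rho\in S_{K,\Gamma}$ let $M$ be the étale $K$-algebra of the corresponding $\Gamma$-torsor $\mathrm{Spec}\,M\to\mathrm{Spec}\,K$, let $\mathcal{O}_M$ be its integer ring, and let $\Xi\subset \mathrm{Hom}_{\mathcal{O}_K}(\mathcal{O}_K^{d},\mathcal{O}_M)=\mathcal{O}_M^{d}$ be the $\mathcal{O}_K$-module of $\Gamma$-equivariant maps, where $\Gamma$ acts on $\mathcal{O}_K^d$ through $\tau$. Put $$\mathbf v_\tau(\rho)=\frac1{\#\Gamma}\,\mathrm{length}_{\mathcal{O}_K}\bigl(\mathcal{O}_M^{d}/\mathcal{O}_M\cdot\Xi\bigr).$$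 For an $\mathcal{O}_K$-basis $\phi_1,\dots,\phi_d$ of $\Xi$ let $u:\mathbb{A}^d_{\mathcal{O}_M}\to\mathbb{A}^d_{\mathcal{O}_K}$ be given by $u^*(x_i)=\sum_j\phi_j(x_i)y_j$, where $\phi_j(x_i)$ is the value of $\phi_j$ at the $i$-th standard basis vector of $\mathcal{O}_K^d$, let $o$ be the $k$-point of $\mathbb{A}^d_{\mathcal{O}_K}$ at the origin, and put $\mathbf w_\tau(\rho)=\dim u^{-1}(o)-\mathbf v_\tau(\rho)$. *Total masses and duals.* For $c:S_{K,\Gamma}\to\mathbb{R}$ put $M(K,\Gamma,c)=\frac1{\#\Gamma}\sum_{\rho\in S_{K,\Gamma}}q^{-c(\rho)}\in\mathbb{R}_{\ge0}\cup\{\infty\}$. A function $f:\{1,2,\dots\}\to\mathbb{C}$ is *admissible* if $f(r)=\bigl(\sum_{i}n_i\alpha_i^{r}\bigr)/(q^{cr}-1)$ for all $r$, with finitely many $n_i\in\mathbb{Z}$ and $\alpha_i\in\mathbb{C}^{\times}$ and with $0\neq c\in\mathbb{Q}$; its *dual* is $(\mathbb{D}f)(r)=\bigl(\sum_{i}n_i\alpha_i^{-r}\bigr)/(q^{-cr}-1)$,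 which does not depend on the expression chosen for $f$. Then the following hold. 1. $S_{K,\Gamma}$ is finite, and each of its elements factors through $\mathrm{Gal}(K^{\mathrm{tame}}/K)$, where $K^{\mathrm{tame}}$ is the maximal tamely ramified extension of $K$ in $K^{\mathrm{sep}}$. For each $\rho\in S_{K,\Gamma}$ the length in the definition of $\mathbf v_\tau(\rho)$ is finite, $\Xi$ is free of rank $d$ over $\mathcal{O}_K$, and $\mathbf w_\tau(\rho)$ does not depend on the choice of the basis of $\Xi$. 2. There are elements $a,b$ that topologically generate $\mathrm{Gal}(K^{\mathrm{tame}}/K)$, such that $a$ is a topological generator of the inertia subgroup and $bab^{-1}=a^{q}$. For all such $a,b$, the map $\rho\mapsto(\rho(a),\rho(b))$ is a bijection from $S_{K,\Gamma}$ to $\{(g,h)\in\Gamma^2\mid hgh^{-1}=g^{q}\}$, and the involution $\iota$ of $S_{K,\Gamma}$ that corresponds to $(g,h)\mapsto(g^{-1},h)$ satisfies $$\mathbf v_\tau(\iota(\rho))=\mathbf w_\tau(\rho)\qquad\text{for all }\rho\in S_{K,\Gamma}.$$ In particular duality holds termwise: for each $\rho\in S_{K,\Gamma}$ the function $r\mapsto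 q^{-r\,\mathbf v_\tau(\iota(\rho))}$ is admissible, with dual $r\mapsto q^{r\,\mathbf w_\tau(\rho)}$. 3. $M(K,\Gamma,-\mathbf w_\tau)=M(K,\Gamma,-\mathbf v_\tau)$. Moreover, for $r\ge1$ let $K_r$ be the unramified extension of $K$ of degree $r$, and write $\tau$ also for the representation $\Gamma\to\mathrm{GL}_d(\mathcal{O}_K)\to\mathrm{GL}_d(\mathcal{O}_{K_r})$. Then the functions $r\mapsto M(K_r,\Gamma,\mathbf v_\tau)$ and $r\mapsto M(K_r,\Gamma,-\mathbf w_\tau)$ are finite-valued and admissible, and the strong duality holds: $$M(K_r,\Gamma,-\mathbf w_\tau)=\mathbb{D}\bigl(M(K_r,\Gamma,\mathbf v_\tau)\bigr),\qquad \mathbb{D}\bigl(M(K_r,\Gamma,-\mathbf w_\tau)\bigr)=M(K_r,\Gamma,\mathbf v_\tau).$$ -/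

import Mathlib

open ValuativeRel
open scoped ENNReal

/-! ### Admissible functions and their duals -/

section Admissible

/-- A formal expression `(∑ i, n i * (α i) ^ r) / (q ^ (c * r) - 1)` in a positive integer `r`,
with `n i` integers, `α i` nonzero complex numbers and `c` a nonzero rational number.
(A summand with `α i = 0` vanishes for all `r ≥ 1`, so it is left out.) -/
structure AdmissibleExpr where
  m : ℕ
  n : Fin m → ℤ
  α : Fin m → ℂ
  α_ne_zero : ∀ i, α i ≠ 0
  c : ℚ
  c_ne_zero : c ≠ 0

/-- The function of `r = 1, 2, 3, …` given by the expression `e`. -/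
noncomputable def AdmissibleExpr.eval (q : ℕ) (e : AdmissibleExpr) (r : ℕ+) : ℂ :=
  (∑ i, (e.n i : ℂ) * e.α i ^ (r : ℕ)) / (((q : ℝ) ^ ((e.c : ℝ) * (r : ℝ)) - 1 : ℝ) : ℂ)

/-- The function of `r` given by the dual expression: `r` is replaced by `-r` in all powers. -/
noncomputable def AdmissibleExpr.dualEval (q : ℕ) (e : AdmissibleExpr) (r : ℕ+) : ℂ :=
  (∑ i, (e.n i : ℂ) * e.α i ^ (-(r : ℤ))) / (((q : ℝ) ^ (-((e.c : ℝ) * (r : ℝ))) - 1 : ℝ) : ℂ)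

/-- A function `f : {1, 2, 3, …} → ℂ` is admissible if it is given by such an expression. -/
def IsAdmissible (q : ℕ) (f : ℕ+ → ℂ) : Prop :=
  ∃ e : AdmissibleExpr, f = e.eval q

theorem sum_zpow_neg_eq_zero {ι : Type*} [Fintype ι] (c α : ι → ℂ) (hα : ∀ i, α i ≠ 0)
    (h : ∀ r : ℕ+, ∑ i, c i * α i ^ (r : ℕ) = 0) (r : ℕ+) :
    ∑ i, c i * α i ^ (-(r : ℤ)) = 0 := by
  have hli : LinearIndependent ℂ (fun (x : ℂ) (k : Multiplicative ℕ) => powersHom ℂ x k) :=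
    (linearIndependent_monoidHom (Multiplicative ℕ) ℂ).comp (fun x => powersHom ℂ x)
      (powersHom ℂ).injective
  have h0 : ∑ i, Finsupp.single (α i) (c i * α i) = 0 := by
    apply hli
    simp only [map_sum, Finsupp.linearCombination_single, map_zero]
    funext k
    have := h ⟨k.toAdd + 1, Nat.succ_pos _⟩
    simp only [Finset.sum_apply, Pi.smul_apply, powersHom_apply, smul_eq_mul, Pi.zero_apply]
    rw [← this]
    refine Finset.sum_congr rfl fun i _ => ?_
    simp only [PNat.mk_coe, pow_succ]
    ring
  have h1 := congrArg (Finsupp.linearCombination ℂ (fun x : ℂ => x ^ (-(r : ℤ) - 1))) h0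
  simp only [map_sum, Finsupp.linearCombination_single, map_zero, smul_eq_mul] at h1
  rw [← h1]
  refine Finset.sum_congr rfl fun i _ => ?_
  rw [zpow_sub_one₀ (hα i)]
  field_simp [hα i]

theorem AdmissibleExpr.dualEval_congr {q : ℕ} (hq : 1 < q) {e e' : AdmissibleExpr}
    (h : e.eval q = e'.eval q) : e.dualEval q = e'.dualEval q := by
  have hq0 : (0 : ℝ) < q := by positivity
  have hq1 : (1 : ℝ) < q := by exact_mod_cast hq
  have hne : ∀ x : ℝ, x ≠ 0 → (((q : ℝ) ^ x - 1 : ℝ) : ℂ) ≠ 0 := by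
    intro x hx h
    have h' : (q : ℝ) ^ x = 1 := by
      have : (q : ℝ) ^ x - 1 = 0 := by exact_mod_cast h
      linarith
    have h2 := congrArg Real.log h'
    rw [Real.log_rpow hq0, Real.log_one] at h2
    exact (mul_ne_zero hx (Real.log_pos hq1).ne') h2
  have hc : ∀ (e : AdmissibleExpr) (r : ℕ+), (e.c : ℝ) * (r : ℝ) ≠ 0 := fun e r =>
    mul_ne_zero (by exact_mod_cast e.c_ne_zero) (by exact_mod_cast r.ne_zero)
  let Q : AdmissibleExpr → ℂ := fun e => (((q : ℝ) ^ (e.c : ℝ) : ℝ) : ℂ)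
  have hQ0 : ∀ e, Q e ≠ 0 := fun e => by
    exact Complex.ofReal_ne_zero.mpr (Real.rpow_pos_of_pos hq0 _).ne'
  have hQ : ∀ (e : AdmissibleExpr) (r : ℕ+),
      (((q : ℝ) ^ ((e.c : ℝ) * (r : ℝ)) - 1 : ℝ) : ℂ) = Q e ^ (r : ℕ) - 1 := by
    intro e r
    simp only [Q]
    rw [Real.rpow_mul hq0.le, Real.rpow_natCast]
    push_cast
    rfl
  have hQn : ∀ (e : AdmissibleExpr) (r : ℕ+),
      (((q : ℝ) ^ (-((e.c : ℝ) * (r : ℝ))) - 1 : ℝ) : ℂ) = Q e ^ (-(r : ℤ)) - 1 := by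
    intro e r
    rw [Real.rpow_neg hq0.le, zpow_neg, zpow_natCast]
    have := hQ e r
    push_cast at this ⊢
    rw [sub_left_inj] at this
    rw [this]
  let ι := (Fin e.m ⊕ Fin e.m) ⊕ (Fin e'.m ⊕ Fin e'.m)
  let C : ι → ℂ := Sum.elim (Sum.elim (fun i => e.n i) (fun i => -e.n i))
    (Sum.elim (fun i => -e'.n i) (fun i => e'.n i))
  let A : ι → ℂ := Sum.elim (Sum.elim (fun i => Q e' * e.α i) e.α)
    (Sum.elim (fun i => Q e * e'.α i) e'.α)
  have hA : ∀ i, A i ≠ 0 := by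
    rintro ((i | i) | (i | i))
    · exact mul_ne_zero (hQ0 _) (e.α_ne_zero i)
    · exact e.α_ne_zero i
    · exact mul_ne_zero (hQ0 _) (e'.α_ne_zero i)
    · exact e'.α_ne_zero i
  have key : ∀ k : ℤ, ∑ i, C i * A i ^ k =
      (Q e' ^ k - 1) * (∑ i, (e.n i : ℂ) * e.α i ^ k) -
        (Q e ^ k - 1) * (∑ i, (e'.n i : ℂ) * e'.α i ^ k) := by
    intro k
    simp only [ι, C, A, Fintype.sum_sum_type, Sum.elim_inl, Sum.elim_inr, mul_zpow, sub_mul,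
      one_mul, Finset.mul_sum, neg_mul, Finset.sum_neg_distrib, Finset.sum_sub_distrib]
    have h1 : ∀ x y z : ℂ, x * (y * z) = y * (x * z) := fun x y z => by ring
    simp only [h1]
    ring
  funext r
  have h2 := sum_zpow_neg_eq_zero C A hA (fun r => by
    have h3 := congrFun h r
    have h4 := key (r : ℕ)
    simp only [zpow_natCast] at h4
    simp only [AdmissibleExpr.eval] at h3
    rw [div_eq_div_iff (hne _ (hc e r)) (hne _ (hc e' r)), hQ, hQ] at h3
    rw [h4, mul_comm, h3]
    ring) r
  rw [key] at h2
  simp only [AdmissibleExpr.dualEval]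
  rw [div_eq_div_iff (hne _ (neg_ne_zero.mpr (hc e r))) (hne _ (neg_ne_zero.mpr (hc e' r))),
    hQn, hQn]
  linear_combination h2

open Classical in
/-- The dual `𝔻 f` of an admissible function `f` (and `0` if `f` is not admissible). By
`dualFun_eval` below it does not depend on the expression chosen for `f`. -/
noncomputable def dualFun (q : ℕ) (f : ℕ+ → ℂ) : ℕ+ → ℂ :=
  if h : IsAdmissible q f then h.choose.dualEval q else 0

/-- The dual function does not depend on the expression. -/
theorem dualFun_eval {q : ℕ} (hq : 1 < q) (e : AdmissibleExpr) :
    dualFun q (e.eval q) = e.dualEval q := by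
  have h : IsAdmissible q (e.eval q) := ⟨e, rfl⟩
  rw [dualFun, dif_pos h]
  exact AdmissibleExpr.dualEval_congr hq h.choose_spec.symm

end Admissible

/-! ### Local fields, homomorphisms from the absolute Galois group -/

section LocalField

variable (K : Type*) [Field K] [ValuativeRel K] [TopologicalSpace K]
  [IsNonarchimedeanLocalField K]

/-- The number `q` of elements of the residue field. -/
noncomputable def residueCard : ℕ := Nat.card 𝓀[K]

/-- The characteristic `p` of the residue field. -/
noncomputable def residueChar : ℕ := ringChar 𝓀[K]

/-- `S_{K,Γ}`: continuous homomorphisms from `Gal(K^sep/K)` (Krull topology) to `Γ`. -/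
abbrev GalHom (Γ : Type*) [Group Γ] [TopologicalSpace Γ] : Type _ :=
  (SeparableClosure K ≃ₐ[K] SeparableClosure K) →ₜ* Γ

/-- The total mass `M(K, Γ, c) = (1 / #Γ) ∑_ρ q ^ (- c ρ)`, in `ℝ≥0 ∪ {∞}`. -/
noncomputable def totalMass (Γ : Type*) [Group Γ] [TopologicalSpace Γ]
    (c : GalHom K Γ → ℝ) : ℝ≥0∞ :=
  (Nat.card Γ : ℝ≥0∞)⁻¹ * ∑' ρ : GalHom K Γ, ENNReal.ofReal ((residueCard K : ℝ) ^ (-c ρ))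

end LocalField

/-! ### Tuning modules -/

section Tuning

variable {R : Type*} [CommRing R] {Γ : Type*} [Group Γ] {d : ℕ} (τ : Γ →* GL (Fin d) R)
  (B : Type*) [CommRing B] [Algebra R B] [MulSemiringAction Γ B] [SMulCommClass Γ R B]

/-- The tuning submodule `Ξ` of `B^d` (to be applied with `R = 𝒪_K`, `B = 𝒪_M`): the
`Γ`-equivariant elements `φ` of `Hom_R(R^d, B) = B^d`, where `Γ` acts on `R^d` through `τ` and
`φ` is given by the images `φ i` of the standard basis vectors `e_i`. Equivariance
`δ • φ(e_i) = φ(τ(δ) e_i)` reads `δ • φ i = ∑ j, τ(δ)_{j i} φ j`. -/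
def tuningModule : Submodule R (Fin d → B) where
  carrier := {φ | ∀ (δ : Γ) (i : Fin d),
    δ • φ i = ∑ j, (τ δ : Matrix (Fin d) (Fin d) R) j i • φ j}
  add_mem' := by
    intro a b ha hb δ i
    simp only [Pi.add_apply, smul_add, Finset.sum_add_distrib]
    rw [ha δ i, hb δ i]
  zero_mem' := by
    intro δ i
    simp
  smul_mem' := by
    intro c a ha δ i
    simp only [Pi.smul_apply]
    rw [smul_comm δ c (a i), ha δ i, Finset.smul_sum]
    exact Finset.sum_congr rfl fun j _ => smul_comm _ _ _

/-- The length of `B^d / B Ξ`, as an `R`-module. -/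
noncomputable def tuningColength : ℕ∞ :=
  Module.length R ((Fin d → B) ⧸
    Submodule.span B (tuningModule τ B : Set (Fin d → B)))

variable {B} in
/-- For `φ_1, …, φ_d` in `B^d = Hom_R(R^d, B)`, the homomorphism
`u^* : R[x_1, …, x_d] → B[y_1, …, y_d]`, `x_i ↦ ∑ j, φ_j(x_i) y_j`. -/
noncomputable def uStar (φ : Fin d → Fin d → B) :
    MvPolynomial (Fin d) R →ₐ[R] MvPolynomial (Fin d) B :=
  MvPolynomial.aeval fun i => ∑ j, MvPolynomial.C (φ j i) * MvPolynomial.X j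

variable (R d) in
/-- For `R` local, the maximal ideal of the origin `o` of the closed fibre of affine space over
`R`: the polynomials whose constant coefficient vanishes in the residue field. -/
noncomputable def originIdeal [IsLocalRing R] : Ideal (MvPolynomial (Fin d) R) :=
  RingHom.ker ((IsLocalRing.residue R).comp MvPolynomial.constantCoeff)

variable (R) {B} in
/-- The dimension of the fibre `u^{-1}(o)`, that is, of the spectrum of
`B[y_1, …, y_d] / u^*(𝔪_o) B[y_1, …, y_d]`. -/
noncomputable def fibreDim [IsLocalRing R] (φ : Fin d → Fin d → B) : WithBot ℕ∞ :=
  ringKrullDim (MvPolynomial (Fin d) B ⧸ (originIdeal R d).map (uStar (R := R) φ))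

end Tuning

/-! ### The functions `v` and `w` -/

section Weights

variable {K : Type*} [Field K] [ValuativeRel K] [TopologicalSpace K]
  [IsNonarchimedeanLocalField K] {Γ : Type*} [Group Γ] [TopologicalSpace Γ]

/-- The étale `K`-algebra `M` of the `Γ`-torsor `Spec M → Spec K` attached to `ρ`: functions
`f : Γ → K^sep` with `f (ρ(σ) γ) = σ (f γ)`, that is, the algebra of the finite `G_K`-set `Γ` on
which `σ` acts as left multiplication by `ρ(σ)`. -/
def torsorAlgebra (ρ : GalHom K Γ) : Subalgebra K (Γ → SeparableClosure K) where
  carrier := {f | ∀ (σ : SeparableClosure K ≃ₐ[K] SeparableClosure K) (γ : Γ),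
    f (ρ σ * γ) = σ (f γ)}
  mul_mem' := by
    intro a b ha hb σ γ
    simp [ha σ γ, hb σ γ]
  add_mem' := by
    intro a b ha hb σ γ
    simp [ha σ γ, hb σ γ]
  algebraMap_mem' := by
    intro x σ γ
    simp

/-- The left action of `Γ` on `M`: `(δ • f) γ = f (γ δ)`. -/
instance torsorAction (ρ : GalHom K Γ) : MulSemiringAction Γ (torsorAlgebra ρ) where
  smul δ f := ⟨fun γ => (f : Γ → SeparableClosure K) (γ * δ), fun σ γ => by
    have h := f.2 σ (γ * δ)
    rw [← mul_assoc] at h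
    exact h⟩
  one_smul f := Subtype.ext (funext fun γ =>
    congrArg (f : Γ → SeparableClosure K) (mul_one γ))
  mul_smul δ ε f := Subtype.ext (funext fun γ =>
    congrArg (f : Γ → SeparableClosure K) (mul_assoc γ δ ε).symm)
  smul_zero _ := rfl
  smul_add _ _ _ := rfl
  smul_one _ := rfl
  smul_mul _ _ _ := rfl

instance torsorAction_smulCommClass (ρ : GalHom K Γ) :
    SMulCommClass Γ 𝒪[K] (torsorAlgebra ρ) where
  smul_comm _ _ _ := rfl

/-- The integer ring `𝒪_M` of `M`. -/
def TorsorIntegers (ρ : GalHom K Γ) : Type _ := integralClosure 𝒪[K] (torsorAlgebra ρ)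

noncomputable instance (ρ : GalHom K Γ) : CommRing (TorsorIntegers ρ) :=
  inferInstanceAs (CommRing (integralClosure 𝒪[K] (torsorAlgebra ρ)))

noncomputable instance (ρ : GalHom K Γ) : Algebra 𝒪[K] (TorsorIntegers ρ) :=
  inferInstanceAs (Algebra 𝒪[K] (integralClosure 𝒪[K] (torsorAlgebra ρ)))

/-- The action of `Γ` on `𝒪_M` is the restriction of that on `M`. -/
noncomputable instance (ρ : GalHom K Γ) : MulSemiringAction Γ (TorsorIntegers ρ) :=
  inferInstanceAs (MulSemiringAction Γ (integralClosure 𝒪[K] (torsorAlgebra ρ)))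

instance (ρ : GalHom K Γ) : SMulCommClass Γ 𝒪[K] (TorsorIntegers ρ) :=
  inferInstanceAs (SMulCommClass Γ 𝒪[K] (integralClosure 𝒪[K] (torsorAlgebra ρ)))

/-- `v_τ(ρ) = (1 / #Γ) length_{𝒪_K} (𝒪_M^d / 𝒪_M Ξ)`. -/
noncomputable def vFun {d : ℕ} (τ : Γ →* GL (Fin d) 𝒪[K]) (ρ : GalHom K Γ) : ℝ :=
  ((tuningColength τ (TorsorIntegers ρ)).toNat : ℝ) / (Nat.card Γ : ℝ)

open Classical in
/-- `w_τ(ρ) = dim u^{-1}(o) - v_τ(ρ)`, for `u` defined by an `𝒪_K`-basis of `Ξ`. -/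
noncomputable def wFun {d : ℕ} (τ : Γ →* GL (Fin d) 𝒪[K]) (ρ : GalHom K Γ) : ℝ :=
  if h : Nonempty (Module.Basis (Fin d) 𝒪[K] (tuningModule τ (TorsorIntegers ρ))) then
    (((fibreDim 𝒪[K] fun j => (h.some j : Fin d → TorsorIntegers ρ)).unbotD 0).toNat : ℝ)
      - vFun τ ρ
  else 0

end Weights

/-! ### The tame Galois group and its parameters -/

section Tame

variable (K : Type*) [Field K] [ValuativeRel K] [TopologicalSpace K]
  [IsNonarchimedeanLocalField K]

/-- A finite extension `L/K` is tamely ramified if its ramification index is prime to `p`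
(the residue fields are finite, so residue extensions are separable). -/
def IsTamelyRamified (L : IntermediateField K (SeparableClosure K)) : Prop :=
  FiniteDimensional K L ∧
    ∀ P : Ideal (integralClosure 𝒪[K] L), P.IsMaximal →
      ¬ residueChar K ∣ Ideal.ramificationIdx P 𝒪[K]

/-- The maximal tamely ramified extension `K^tame` of `K` in `K^sep`: the compositum of all
finite tamely ramified extensions. -/
noncomputable def tameClosure : IntermediateField K (SeparableClosure K) :=
  sSup {L | IsTamelyRamified K L}

/-- The inertia subgroup of `Gal(E/K)`, for `E/K` algebraic: the elements acting trivially modulo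
the (unique) maximal ideal of the integer ring of `E`. -/
noncomputable def inertiaSubgroup (E : Type*) [Field E] [Algebra K E] : Subgroup (E ≃ₐ[K] E) :=
  ⨅ (P : Ideal (integralClosure 𝒪[K] E)) (_ : P.IsMaximal), P.inertia (E ≃ₐ[K] E)

/-- `a, b` topologically generate `Gal(K^tame/K)`, `a` is a topological generator of its inertia
subgroup, and `b a b⁻¹ = a ^ q`. -/
structure IsTamePair (a b : tameClosure K ≃ₐ[K] tameClosure K) : Prop where
  generates : (Subgroup.closure {a, b}).topologicalClosure = ⊤
  generates_inertia :
    (Subgroup.zpowers a).topologicalClosure = inertiaSubgroup K (tameClosure K)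
  rel : b * a * b⁻¹ = a ^ residueCard K

variable {K} in
/-- The tame parameters `(g, h)` of `ρ`: the values of `ρ` at extensions of `a` and `b` to
`K^sep`. For `ρ` factoring through `Gal(K^tame/K)` the choice of extensions is irrelevant. -/
noncomputable def tameParam {Γ : Type*} [Group Γ] [TopologicalSpace Γ]
    (a b : tameClosure K ≃ₐ[K] tameClosure K) (ρ : GalHom K Γ) : Γ × Γ :=
  (ρ (a.liftNormal (SeparableClosure K)), ρ (b.liftNormal (SeparableClosure K)))

end Tame

/-! ### Unramified extensions -/

section Unramified

variable (K L : Type*) [Field K] [ValuativeRel K] [Field L] [ValuativeRel L]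
  [Algebra K L] [ValuativeExtension K L]

/-- The inclusion of integer rings `𝒪_K → 𝒪_L` for an extension `L/K` of valued fields. -/
noncomputable def integerMap : 𝒪[K] →+* 𝒪[L] :=
  ((algebraMap K L).comp (𝒪[K]).subtype).codRestrict 𝒪[L] (by
    rintro ⟨x, hx⟩
    have h1 : x ≤ᵥ (1 : K) := by
      rw [Valuation.Compatible.vle_iff_le (v := valuation K), map_one]
      exact hx
    have h2 : algebraMap K L x ≤ᵥ algebraMap K L 1 :=
      (ValuativeExtension.vle_iff_vle x 1).mpr h1
    rw [map_one, Valuation.Compatible.vle_iff_le (v := valuation L), map_one] at h2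
    exact h2)

variable {K} in
/-- The representation over `𝒪_L` induced by a representation over `𝒪_K`. -/
noncomputable def baseChangeRep {Γ : Type*} [Group Γ] {d : ℕ} (τ : Γ →* GL (Fin d) 𝒪[K]) :
    Γ →* GL (Fin d) 𝒪[L] :=
  (Matrix.GeneralLinearGroup.map (integerMap K L)).comp τ

/-- `L/K` is an unramified extension of local fields of degree `r`: a uniformizer of `K` is a
uniformizer of `L` (the residue fields of local fields are finite, hence perfect). -/
def IsUnramifiedOfDegree (r : ℕ+) : Prop :=
  Module.finrank K L = r ∧ Ideal.map (integerMap K L) 𝓂[K] = 𝓂[L]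

end Unramified

set_option linter.unusedSectionVars false

/-! ### The valuation on the separable closure -/

section SepValuation

open scoped NNReal

variable (K : Type*) [Field K] [ValuativeRel K] [TopologicalSpace K]
  [IsNonarchimedeanLocalField K]

/-! Since `p` does not divide `#Γ`, every `ρ` is tame, hence given by a pair `g = ρ(a)`, `h = ρ(b)`
with `h g h⁻¹ = g ^ q`. Both weights depend only on the eigenvalues of the reduction of `τ(g)`. Let
`n` be the order of `g`; it is the ramification index of the fixed field of `ker ρ`. Let `ϖ` be a
uniformizer of that field and `η` the reduction of `a(ϖ)/ϖ`, a primitive `n`-th root of unity.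
Evaluated at `1 ∈ Γ`, the module `Ξ` becomes a lattice of vectors over `K^sep`, and this lattice has
a basis `ϖ ^ c_j • Y_j` with `0 ≤ c_j < n` and `Y` invertible over the integers
(`IsGoodPair.exists_isAdaptedBasis`). Equivariance under `a`, read modulo the maximal ideal,
conjugates `τ(g)` to `diag(η ^ c_j)` (`IsAdaptedBasis.charpoly_eq`). The elementary divisors give `v
= ∑ c_j / n`. Up to nilpotents the fibre over the origin is an affine space over a zero-dimensional
ring, with one coordinate for each `c_j ≠ 0`. So `w = ∑_{c_j ≠ 0} (1 - c_j / n)`. This is the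
formula for `v` at `g⁻¹`, whose exponents are `n - c_j` or `0`. As `(g⁻¹, h)` satisfies the same
relation, inverting `g` exchanges the two weights, and the masses for `-v` and `-w` agree.

For the strong duality, the sum over pairs collapses to a sum over conjugacy classes equal to their
own `q`-th power (`sum_pairs_eq`). The reduction of `τ` is defined over a field with `q` elements,
so the characteristic polynomials at `g` and `g ^ q` coincide, and the weight is constant on the
orbits of the `q`-power permutation `σ` of the classes (`classWeight_conjPow`). The mass over `K_r`
is therefore the sum of `t_x ^ r` over the fixed points `x` of `σ ^ r`, where `t_x = q ^ (-v(x))`.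
An orbit of length `l` with value `t` contributes the `r`-th power sum of the numbers `ω t` with `ω
^ l = 1` (`exists_powerSum_of_perm`). So the mass is a power sum `∑ α_i ^ r`, which is admissible
with dual `∑ α_i ^ (-r)`, and the same identity with exponent `-r` is the mass for `-v`, that is for
`-w`.

The ramification theory is carried out inside `K^sep` with its Galois-invariant valuation. Three
tools recur. Teichmüller representatives (`tameRoots_ext`, `exists_tameRoots_sepRed_eq`) lift
residues uniquely. Dedekind independence of the reduced Galois conjugates (`sum_inertia_eq_zero`)
shows that inertia is as large as it should be. Compactness of the Galois group passes from the
levels `n` prime to `p` to the limit. -/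

theorem exists_sepValuation : ∃ w : Valuation (SeparableClosure K) ℝ≥0,
    (∀ (σ : SeparableClosure K ≃ₐ[K] SeparableClosure K) x, w (σ x) = w x) ∧
    ∀ x, w x ≤ 1 ↔ IsIntegral 𝒪[K] x := by
  -- The valuation is the spectral norm, which needs `K` as a complete nontrivially normed
  -- ultrametric field; the norm comes from a rank one embedding of the value group.
  let := IsTopologicalAddGroup.rightUniformSpace K
  have := isUniformAddGroup_of_addCommGroup (G := K)
  let : (Valued.v (R := K) (Γ₀ := ValueGroupWithZero K)).RankOne :=
  { hom' := IsRankLeOne.nonempty.some.emb (R := K).comp MonoidWithZeroHom.ValueGroup₀.embedding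
    strictMono' := IsRankLeOne.nonempty.some.strictMono.comp
        MonoidWithZeroHom.ValueGroup₀.embedding_strictMono }
  let : NontriviallyNormedField K := Valued.toNontriviallyNormedField K (ValueGroupWithZero K)
  have : IsUltrametricDist K := inferInstanceAs (@IsUltrametricDist K (Valued.toNontriviallyNormedField K (ValueGroupWithZero K)).toDist)
  have : CompleteSpace K := inferInstance
  let f := spectralMulAlgNorm K (SeparableClosure K)
  let w : Valuation (SeparableClosure K) ℝ≥0 :=
    { toFun := fun x => ⟨f x, apply_nonneg f x⟩
      map_zero' := by ext; exact map_zero f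
      map_one' := by ext; exact map_one f
      map_mul' := fun x y => by ext; exact map_mul f x y
      map_add_le_max' := fun x y => by
        have := isNonarchimedean_spectralNorm (K := K) (L := SeparableClosure K) x y
        exact_mod_cast this }
  refine ⟨w, fun σ x => ?_, fun x => ?_⟩
  · ext
    exact (spectralNorm_eq_of_equiv σ x).symm
  · have hx : w x ≤ 1 ↔ spectralNorm K (SeparableClosure K) x ≤ 1 := by
      rw [← NNReal.coe_le_coe]; rfl
    rw [hx, spectralNorm, spectralValue_le_one_iff
      (minpoly.monic (Algebra.IsIntegral.isIntegral x))]
    have hn : ∀ y : K, ‖y‖ ≤ 1 ↔ y ∈ 𝒪[K] := fun y => Valued.toNormedField.norm_le_one_iff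
    constructor
    · intro h
      have : minpoly K x ∈ Polynomial.lifts (algebraMap 𝒪[K] K) := by
        rw [Polynomial.lifts_iff_coeff_lifts]
        intro n
        exact ⟨⟨_, (hn _).1 (h n)⟩, rfl⟩
      obtain ⟨P, hP, -, hm⟩ := Polynomial.lifts_and_degree_eq_and_monic this
        (minpoly.monic (Algebra.IsIntegral.isIntegral x))
      refine ⟨P, hm, ?_⟩
      have h2 := minpoly.aeval K x
      rw [← hP, Polynomial.aeval_map_algebraMap] at h2
      exact h2
    · intro h n
      rw [minpoly.isIntegrallyClosed_eq_field_fractions' K h, Polynomial.coeff_map, hn]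
      exact ((minpoly 𝒪[K] x).coeff n).2

/-- The valuation on the separable closure of a local field. -/
noncomputable def sepVal : Valuation (SeparableClosure K) ℝ≥0 := (exists_sepValuation K).choose

variable {K}

@[simp]
theorem sepVal_galois (σ : SeparableClosure K ≃ₐ[K] SeparableClosure K) (x) :
    sepVal K (σ x) = sepVal K x := (exists_sepValuation K).choose_spec.1 σ x

theorem sepVal_le_one_iff {x : SeparableClosure K} : sepVal K x ≤ 1 ↔ IsIntegral 𝒪[K] x :=
  (exists_sepValuation K).choose_spec.2 x

theorem sepVal_algebraMap_le_one_iff {x : K} :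
    sepVal K (algebraMap K _ x) ≤ 1 ↔ x ∈ 𝒪[K] := by
  rw [sepVal_le_one_iff, isIntegral_algebraMap_iff (algebraMap K (SeparableClosure K)).injective]
  constructor
  · intro h
    obtain ⟨y, rfl⟩ := IsIntegrallyClosed.isIntegral_iff.1 h
    exact y.2
  · intro h
    exact isIntegral_algebraMap (R := 𝒪[K]) (A := K) (x := ⟨x, h⟩)

theorem sepVal_integer (x : 𝒪[K]) : sepVal K (algebraMap 𝒪[K] _ x) ≤ 1 :=
  sepVal_le_one_iff.2 isIntegral_algebraMap

theorem sepVal_integer_lt_one_iff {x : 𝒪[K]} :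
    sepVal K (algebraMap 𝒪[K] _ x) < 1 ↔ x ∈ 𝓂[K] := by
  rw [IsLocalRing.mem_maximalIdeal, mem_nonunits_iff, iff_not_comm, not_lt]
  constructor
  · intro h
    have := h.map (algebraMap 𝒪[K] (SeparableClosure K))
    obtain ⟨u, rfl⟩ := h
    have h1 : sepVal K (algebraMap 𝒪[K] _ (u : 𝒪[K])) * sepVal K (algebraMap 𝒪[K] _ (↑u⁻¹ : 𝒪[K])) = 1 := by
      rw [← map_mul, ← map_mul]; simp
    by_contra! h2
    have := mul_lt_one_of_nonneg_of_lt_one_left zero_le h2 (sepVal_integer (↑u⁻¹ : 𝒪[K]))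
    exact this.ne h1
  · intro h
    have hx0 : x ≠ 0 := by rintro rfl; simp at h
    have hx0' : (x : K) ≠ 0 := by simpa using hx0
    have hi : (x : K)⁻¹ ∈ 𝒪[K] := by
      rw [← sepVal_algebraMap_le_one_iff, map_inv₀, map_inv₀]
      exact inv_le_one_of_one_le₀ h
    exact IsUnit.of_mul_eq_one ⟨_, hi⟩ (Subtype.ext (mul_inv_cancel₀ hx0'))

variable (K) in
/-- A uniformizer of the local field `K`. -/
noncomputable def unif : 𝒪[K] := (IsDiscreteValuationRing.exists_irreducible 𝒪[K]).choose

theorem unif_irreducible : Irreducible (unif K) :=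
  (IsDiscreteValuationRing.exists_irreducible 𝒪[K]).choose_spec

variable (K) in
/-- The uniformizer as an element of the separable closure. -/
noncomputable def sepUnif : SeparableClosure K := algebraMap 𝒪[K] _ (unif K)

theorem sepVal_unif_lt_one : sepVal K (sepUnif K) < 1 :=
  sepVal_integer_lt_one_iff.2 ((IsLocalRing.mem_maximalIdeal _).2 unif_irreducible.not_isUnit)

theorem algebraMap_integer_injective :
    Function.Injective (algebraMap 𝒪[K] (SeparableClosure K)) := by
  rw [IsScalarTower.algebraMap_eq 𝒪[K] K]
  exact (algebraMap K (SeparableClosure K)).injective.comp Subtype.val_injective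

theorem sepUnif_ne_zero : sepUnif K ≠ 0 := by
  rw [sepUnif, Ne, map_eq_zero_iff _ algebraMap_integer_injective]
  exact unif_irreducible.ne_zero

theorem sepVal_unif_pos : 0 < sepVal K (sepUnif K) :=
  (sepVal K).pos_iff.2 sepUnif_ne_zero

@[simp]
theorem galois_sepUnif (σ : SeparableClosure K ≃ₐ[K] SeparableClosure K) :
    σ (sepUnif K) = sepUnif K := by
  rw [sepUnif, IsScalarTower.algebraMap_apply 𝒪[K] K, σ.commutes]

theorem exists_sepVal_algebraMap_eq_zpow {x : K} (hx : x ≠ 0) :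
    ∃ k : ℤ, sepVal K (algebraMap K _ x) = sepVal K (sepUnif K) ^ k := by
  have key : ∀ y : 𝒪[K], y ≠ 0 → ∃ k : ℕ, sepVal K (algebraMap 𝒪[K] _ y) = sepVal K (sepUnif K) ^ k := by
    intro y hy
    obtain ⟨k, u, rfl⟩ := IsDiscreteValuationRing.eq_unit_mul_pow_irreducible hy unif_irreducible
    refine ⟨k, ?_⟩
    have hu : sepVal K (algebraMap 𝒪[K] _ (u : 𝒪[K])) = 1 := by
      refine le_antisymm (sepVal_integer _) (not_lt.1 fun h => ?_)
      rw [sepVal_integer_lt_one_iff, IsLocalRing.mem_maximalIdeal] at h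
      exact h u.isUnit
    rw [map_mul, map_mul, hu, one_mul, map_pow, map_pow]; rfl
  obtain ⟨a, b, hb, rfl⟩ := IsFractionRing.div_surjective (A := 𝒪[K]) x
  have hb0 := nonZeroDivisors.ne_zero hb
  have ha0 : a ≠ 0 := by rintro rfl; simp at hx
  obtain ⟨i, hi⟩ := key a ha0
  obtain ⟨j, hj⟩ := key b hb0
  refine ⟨i - j, ?_⟩
  rw [zpow_sub₀ sepVal_unif_pos.ne', zpow_natCast, zpow_natCast, ← hi, ← hj, map_div₀, map_div₀,
    ← IsScalarTower.algebraMap_apply, ← IsScalarTower.algebraMap_apply]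

theorem residueChar_prime : (residueChar K).Prime :=
  CharP.char_is_prime 𝓀[K] _

theorem sepVal_natCast {n : ℕ} (hn : ¬ residueChar K ∣ n) : sepVal K (n : SeparableClosure K) = 1 := by
  have h : ((n : 𝒪[K]) : 𝒪[K]) ∉ 𝓂[K] := by
    rw [← IsLocalRing.residue_eq_zero_iff, map_natCast, CharP.cast_eq_zero_iff 𝓀[K] (residueChar K)]
    exact hn
  rw [← sepVal_integer_lt_one_iff, map_natCast] at h
  refine le_antisymm ?_ (not_lt.1 h)
  have := sepVal_integer (n : 𝒪[K])
  rwa [map_natCast] at this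

theorem natCast_ne_zero_of_residueChar {n : ℕ} (hn : ¬ residueChar K ∣ n) :
    (n : SeparableClosure K) ≠ 0 := by
  intro h
  have := sepVal_natCast hn
  rw [h, map_zero] at this
  exact zero_ne_one this

end SepValuation

/-! ### Reduction to the residue field, roots of unity -/

section Reduction

open scoped NNReal

variable (K : Type*) [Field K] [ValuativeRel K] [TopologicalSpace K]
  [IsNonarchimedeanLocalField K]

/-- The residue field of the separable closure. -/
abbrev SepRes : Type _ := IsLocalRing.ResidueField (sepVal K).valuationSubring

variable {K}

open Classical in
/-- The reduction of an element of the separable closure, with value `0` on non-integers. -/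
noncomputable def sepRed (x : SeparableClosure K) : SepRes K :=
  if h : sepVal K x ≤ 1 then IsLocalRing.residue (sepVal K).valuationSubring ⟨x, h⟩ else 0

theorem sepRed_of_le {x : SeparableClosure K} (h : sepVal K x ≤ 1) :
    sepRed x = IsLocalRing.residue (sepVal K).valuationSubring ⟨x, h⟩ := dif_pos h

theorem sepVal_add_le_one {x y : SeparableClosure K} (hx : sepVal K x ≤ 1) (hy : sepVal K y ≤ 1) :
    sepVal K (x + y) ≤ 1 := (sepVal K).map_add_le hx hy

theorem sepVal_sub_le_one {x y : SeparableClosure K} (hx : sepVal K x ≤ 1) (hy : sepVal K y ≤ 1) :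
    sepVal K (x - y) ≤ 1 := (sepVal K).map_sub_le hx hy

theorem sepVal_mul_le_one {x y : SeparableClosure K} (hx : sepVal K x ≤ 1) (hy : sepVal K y ≤ 1) :
    sepVal K (x * y) ≤ 1 := by
  rw [map_mul]; exact mul_le_one' hx hy

theorem sepVal_sum_le_one {ι : Type*} (s : Finset ι) {f : ι → SeparableClosure K}
    (h : ∀ i ∈ s, sepVal K (f i) ≤ 1) : sepVal K (∑ i ∈ s, f i) ≤ 1 :=
  (sepVal K).map_sum_le h

theorem sepVal_pow_le_one {x : SeparableClosure K} (hx : sepVal K x ≤ 1) (n : ℕ) :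
    sepVal K (x ^ n) ≤ 1 := by
  rw [map_pow]; exact pow_le_one' hx n

theorem sepRed_add {x y : SeparableClosure K} (hx : sepVal K x ≤ 1) (hy : sepVal K y ≤ 1) :
    sepRed (x + y) = sepRed x + sepRed y := by
  rw [sepRed_of_le hx, sepRed_of_le hy, sepRed_of_le (sepVal_add_le_one hx hy), ← map_add]; rfl

theorem sepRed_sub {x y : SeparableClosure K} (hx : sepVal K x ≤ 1) (hy : sepVal K y ≤ 1) :
    sepRed (x - y) = sepRed x - sepRed y := by
  rw [sepRed_of_le hx, sepRed_of_le hy, sepRed_of_le (sepVal_sub_le_one hx hy), ← map_sub]; rfl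

theorem sepRed_mul {x y : SeparableClosure K} (hx : sepVal K x ≤ 1) (hy : sepVal K y ≤ 1) :
    sepRed (x * y) = sepRed x * sepRed y := by
  rw [sepRed_of_le hx, sepRed_of_le hy, sepRed_of_le (sepVal_mul_le_one hx hy), ← map_mul]; rfl

@[simp]
theorem sepRed_one : sepRed (1 : SeparableClosure K) = 1 := by
  rw [sepRed_of_le (by simp)]; exact map_one _

@[simp]
theorem sepRed_zero : sepRed (0 : SeparableClosure K) = 0 := by
  rw [sepRed_of_le (by simp)]; exact map_zero _

theorem sepRed_pow {x : SeparableClosure K} (hx : sepVal K x ≤ 1) (n : ℕ) :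
    sepRed (x ^ n) = sepRed x ^ n := by
  induction n with
  | zero => simp
  | succ n ih => rw [pow_succ, sepRed_mul (sepVal_pow_le_one hx n) hx, ih, pow_succ]

theorem sepRed_sum {ι : Type*} (s : Finset ι) {f : ι → SeparableClosure K}
    (h : ∀ i ∈ s, sepVal K (f i) ≤ 1) : sepRed (∑ i ∈ s, f i) = ∑ i ∈ s, sepRed (f i) := by
  classical
  induction s using Finset.induction_on with
  | empty => simp
  | insert a s ha ih =>
    rw [Finset.sum_insert ha, Finset.sum_insert ha, sepRed_add (h a (by simp))
      (sepVal_sum_le_one s fun i hi => h i (by simp [hi])), ih fun i hi => h i (by simp [hi])]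

theorem sepRed_eq_zero_iff {x : SeparableClosure K} (hx : sepVal K x ≤ 1) :
    sepRed x = 0 ↔ sepVal K x < 1 := by
  rw [sepRed_of_le hx, IsLocalRing.residue_eq_zero_iff,
    Valuation.mem_maximalIdeal_iff]

theorem sepRed_eq_iff {x y : SeparableClosure K} (hx : sepVal K x ≤ 1) (hy : sepVal K y ≤ 1) :
    sepRed x = sepRed y ↔ sepVal K (x - y) < 1 := by
  rw [← sub_eq_zero, ← sepRed_sub hx hy, sepRed_eq_zero_iff (sepVal_sub_le_one hx hy)]

theorem exists_sepRed_eq (y : SepRes K) : ∃ x : SeparableClosure K, sepVal K x ≤ 1 ∧ sepRed x = y := by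
  obtain ⟨⟨x, hx⟩, rfl⟩ := IsLocalRing.residue_surjective y
  exact ⟨x, hx, sepRed_of_le hx⟩

theorem sepRed_ne_zero {x : SeparableClosure K} (hx : sepVal K x = 1) : sepRed x ≠ 0 := by
  rw [Ne, sepRed_eq_zero_iff hx.le, hx]; exact lt_irrefl _

theorem sepRed_inv {x : SeparableClosure K} (hx : sepVal K x = 1) : sepRed x⁻¹ = (sepRed x)⁻¹ := by
  have hx0 : x ≠ 0 := by rintro rfl; simp at hx
  have h1 : sepVal K x⁻¹ = 1 := by rw [map_inv₀, hx, inv_one]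
  refine eq_inv_of_mul_eq_one_left ?_
  rw [← sepRed_mul h1.le hx.le, inv_mul_cancel₀ hx0, sepRed_one]

variable (K) in
/-- The reduction map on the integers of `K`. -/
noncomputable def integerRed : 𝒪[K] →+* SepRes K where
  toFun x := sepRed (algebraMap 𝒪[K] _ x)
  map_one' := by simp
  map_zero' := by simp
  map_add' x y := by rw [map_add, sepRed_add (sepVal_integer _) (sepVal_integer _)]
  map_mul' x y := by rw [map_mul, sepRed_mul (sepVal_integer _) (sepVal_integer _)]

theorem integerRed_apply (x : 𝒪[K]) : integerRed K x = sepRed (algebraMap 𝒪[K] _ x) := rfl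

theorem integerRed_eq_zero_iff {x : 𝒪[K]} : integerRed K x = 0 ↔ x ∈ 𝓂[K] := by
  rw [integerRed_apply, sepRed_eq_zero_iff (sepVal_integer _), sepVal_integer_lt_one_iff]

theorem sepRed_natCast (n : ℕ) : sepRed (n : SeparableClosure K) = n := by
  have := map_natCast (integerRed K) n
  rwa [integerRed_apply, map_natCast] at this

theorem sepRes_natCast_ne_zero {n : ℕ} (hn : ¬ residueChar K ∣ n) : (n : SepRes K) ≠ 0 := by
  rw [← sepRed_natCast]; exact sepRed_ne_zero (sepVal_natCast hn)

instance : IsLocalHom (integerRed K) where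
  map_nonunit x hx := by
    by_contra h
    rw [← mem_nonunits_iff, ← IsLocalRing.mem_maximalIdeal, ← integerRed_eq_zero_iff] at h
    exact hx.ne_zero h

/-- The residue field of `K` embeds into that of its separable closure. -/
noncomputable instance : Algebra 𝓀[K] (SepRes K) :=
  (IsLocalRing.ResidueField.lift (integerRed K)).toAlgebra

theorem algebraMap_residue (x : 𝒪[K]) :
    algebraMap 𝓀[K] (SepRes K) (IsLocalRing.residue 𝒪[K] x) = integerRed K x :=
  IsLocalRing.ResidueField.lift_residue_apply _ x

instance : Algebra.IsIntegral 𝓀[K] (SepRes K) where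
  isIntegral y := by
    obtain ⟨x, hx, rfl⟩ := exists_sepRed_eq y
    obtain ⟨P, hm, hP⟩ := sepVal_le_one_iff.1 hx
    refine ⟨P.map (IsLocalRing.residue 𝒪[K]), hm.map _, ?_⟩
    rw [Polynomial.eval₂_map]
    have hc : (algebraMap 𝓀[K] (SepRes K)).comp (IsLocalRing.residue 𝒪[K]) = integerRed K :=
      RingHom.ext algebraMap_residue
    rw [hc, Polynomial.eval₂_eq_sum_range]
    rw [Polynomial.eval₂_eq_sum_range] at hP
    have := congrArg sepRed hP
    rw [sepRed_zero, sepRed_sum] at this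
    · rw [← this]
      refine Finset.sum_congr rfl fun i _ => ?_
      rw [sepRed_mul (sepVal_integer _) (sepVal_pow_le_one hx i), sepRed_pow hx, integerRed_apply]
    · intro i _
      exact sepVal_mul_le_one (sepVal_integer _) (sepVal_pow_le_one hx i)

/-! Roots of unity of order prime to the residue characteristic. -/

theorem sepVal_eq_one_of_pow {x : SeparableClosure K} {n : ℕ} (hn : n ≠ 0) (hx : sepVal K (x ^ n) = 1) :
    sepVal K x = 1 := by
  rw [map_pow] at hx
  exact (pow_eq_one_iff_of_nonneg zero_le hn).1 hx

theorem ne_zero_of_residueChar {n : ℕ} (hn : ¬ residueChar K ∣ n) : n ≠ 0 := by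
  rintro rfl; simp at hn

theorem sepVal_eq_one_of_pow_eq_one {x : SeparableClosure K} {n : ℕ} (hn : n ≠ 0) (hx : x ^ n = 1) :
    sepVal K x = 1 := sepVal_eq_one_of_pow hn (by rw [hx, map_one])

/-- If `z ≠ 1`, then `1 + z + ⋯ + z ^ (n - 1) = 0`, but this sum reduces to `n`, which is nonzero in
the residue field. This is the uniqueness half of Hensel's lemma, in the only form needed. -/
theorem eq_one_of_pow_eq_one_of_sepRed {n : ℕ} (hn : ¬ residueChar K ∣ n) {z : SeparableClosure K}
    (hz : z ^ n = 1) (hr : sepRed z = 1) : z = 1 := by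
  by_contra h
  have hw := sepVal_eq_one_of_pow_eq_one (ne_zero_of_residueChar hn) hz
  have h1 : ∑ i ∈ Finset.range n, z ^ i = 0 := by
    have := geom_sum_mul z n
    rw [hz, sub_self] at this
    exact (mul_eq_zero.1 this).resolve_right (sub_ne_zero.2 h)
  have h2 := congrArg sepRed h1
  rw [sepRed_sum _ fun i _ => sepVal_pow_le_one hw.le i] at h2
  simp only [sepRed_pow hw.le, hr, one_pow, Finset.sum_const, Finset.card_range, sepRed_zero, nsmul_eq_mul, mul_one] at h2
  exact sepRes_natCast_ne_zero hn h2

theorem not_residueChar_dvd_mul {n m : ℕ} (hn : ¬ residueChar K ∣ n) (hm : ¬ residueChar K ∣ m) :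
    ¬ residueChar K ∣ n * m := by
  rw [residueChar_prime.dvd_mul]; tauto

theorem eq_of_pow_eq_pow_of_sepRed {n : ℕ} (hn : ¬ residueChar K ∣ n) {x y : SeparableClosure K}
    (hy : sepVal K y = 1) (hxy : x ^ n = y ^ n) (hr : sepRed x = sepRed y) : x = y := by
  have hy0 : y ≠ 0 := by rintro rfl; simp at hy
  have hx : sepVal K x = 1 := sepVal_eq_one_of_pow (ne_zero_of_residueChar hn) (by rw [hxy, map_pow, hy, one_pow])
  have : x / y = 1 := by
    refine eq_one_of_pow_eq_one_of_sepRed hn ?_ ?_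
    · rw [div_pow, hxy, div_self (pow_ne_zero _ hy0)]
    · rw [div_eq_mul_inv, sepRed_mul hx.le (by rw [map_inv₀, hy, inv_one]), sepRed_inv hy, hr,
        mul_inv_cancel₀ (sepRed_ne_zero hy)]
  exact (div_eq_one_iff_eq hy0).1 this

variable (K) in
/-- The roots of unity of order prime to the residue characteristic. -/
def tameRoots : Set (SeparableClosure K) := {x | ∃ n : ℕ, ¬ residueChar K ∣ n ∧ x ^ n = 1}

theorem sepVal_tameRoots {x : SeparableClosure K} (hx : x ∈ tameRoots K) : sepVal K x = 1 := by
  obtain ⟨n, hn, h⟩ := hx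
  exact sepVal_eq_one_of_pow_eq_one (ne_zero_of_residueChar hn) h

/-- Uniqueness of Teichmüller representatives: raise both elements to the product of their orders.
Equalities between roots of unity are proved below by comparing residues. -/
theorem tameRoots_ext {x y : SeparableClosure K} (hx : x ∈ tameRoots K) (hy : y ∈ tameRoots K)
    (h : sepRed x = sepRed y) : x = y := by
  have h1 := sepVal_tameRoots hy
  obtain ⟨n, hn, hx⟩ := hx
  obtain ⟨m, hm, hy⟩ := hy
  refine eq_of_pow_eq_pow_of_sepRed (not_residueChar_dvd_mul hn hm) h1 ?_ h
  rw [pow_mul, hx, one_pow, mul_comm, pow_mul, hy, one_pow]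

theorem galois_tameRoots (σ : SeparableClosure K ≃ₐ[K] SeparableClosure K) {x : SeparableClosure K}
    (hx : x ∈ tameRoots K) : σ x ∈ tameRoots K := by
  obtain ⟨n, hn, h⟩ := hx
  exact ⟨n, hn, by rw [← map_pow, h, map_one]⟩

theorem pow_tameRoots (k : ℕ) {x : SeparableClosure K}
    (hx : x ∈ tameRoots K) : x ^ k ∈ tameRoots K := by
  obtain ⟨n, hn, h⟩ := hx
  exact ⟨n, hn, by rw [pow_right_comm, h, one_pow]⟩

theorem neZero_of_residueChar {n : ℕ} (hn : ¬ residueChar K ∣ n) : NeZero (n : SeparableClosure K) :=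
  ⟨natCast_ne_zero_of_residueChar hn⟩

theorem exists_primitiveRoot {n : ℕ} (hn : ¬ residueChar K ∣ n) :
    ∃ ζ : SeparableClosure K, IsPrimitiveRoot ζ n := by
  have := neZero_of_residueChar hn
  have : NeZero n := ⟨ne_zero_of_residueChar hn⟩
  exact HasEnoughRootsOfUnity.exists_primitiveRoot _ _

theorem exists_pow_eq_sep {n : ℕ} (hn : ¬ residueChar K ∣ n) (y : SeparableClosure K) :
    ∃ x : SeparableClosure K, x ^ n = y := by
  have := neZero_of_residueChar hn
  exact IsSepClosed.exists_pow_nat_eq y n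

theorem isPrimitiveRoot_sepRed {n : ℕ} (hn : ¬ residueChar K ∣ n) {ζ : SeparableClosure K}
    (h : IsPrimitiveRoot ζ n) : IsPrimitiveRoot (sepRed ζ) n := by
  have hw := sepVal_eq_one_of_pow_eq_one (ne_zero_of_residueChar hn) h.pow_eq_one
  refine ⟨by rw [← sepRed_pow hw.le, h.pow_eq_one, sepRed_one], fun l hl => h.dvd_of_pow_eq_one l ?_⟩
  refine eq_one_of_pow_eq_one_of_sepRed hn ?_ (by rw [sepRed_pow hw.le, hl])
  rw [pow_right_comm, h.pow_eq_one, one_pow]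

theorem residueCard_two_le : 2 ≤ residueCard K := Finite.one_lt_card

theorem residueChar_dvd_residueCard : residueChar K ∣ residueCard K := by
  have := Fintype.ofFinite 𝓀[K]
  rw [residueCard, Nat.card_eq_fintype_card, ← CharP.cast_eq_zero_iff 𝓀[K] (residueChar K)]
  exact Nat.cast_card_eq_zero _

theorem not_residueChar_dvd_sub_one {m : ℕ} (hm : m ≠ 0) : ¬ residueChar K ∣ residueCard K ^ m - 1 := by
  intro h
  have h2 : residueChar K ∣ residueCard K ^ m := residueChar_dvd_residueCard.trans (dvd_pow_self _ hm)
  have h3 := (Nat.dvd_sub_iff_right (Nat.one_le_pow _ _ (by have := residueCard_two_le (K := K); omega)) h2).1 h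
  exact residueChar_prime.one_lt.ne' (Nat.dvd_one.1 h3)

theorem coprime_residueCard {n : ℕ} (hn : ¬ residueChar K ∣ n) : n.Coprime (residueCard K) := by
  have : IsPrimePow (residueCard K) := by
    have := Fintype.ofFinite 𝓀[K]
    rw [residueCard, Nat.card_eq_fintype_card]
    exact FiniteField.isPrimePow_card _
  obtain ⟨p, k, hp, hk, h⟩ := this
  have hpp := Nat.prime_iff.2 hp
  have : residueChar K = p := by
    have h2 : residueChar K ∣ p ^ k := h ▸ residueChar_dvd_residueCard
    exact (Nat.prime_dvd_prime_iff_eq residueChar_prime hpp).1 (residueChar_prime.dvd_of_dvd_pow h2)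
  rw [← h]
  refine Nat.Coprime.pow_right _ ?_
  rw [Nat.coprime_comm, hpp.coprime_iff_not_dvd, ← this]
  exact hn

/-- The residue field of `K^sep` is algebraic over a finite field, so `y` lies in a field with `q ^
f` elements, and `q ^ f - 1` is prime to `p`. -/
theorem exists_pow_eq_one_sepRes {y : SepRes K} (hy : y ≠ 0) :
    ∃ n : ℕ, ¬ residueChar K ∣ n ∧ y ^ n = 1 := by
  have hint : IsIntegral 𝓀[K] y := Algebra.IsIntegral.isIntegral y
  let F := IntermediateField.adjoin 𝓀[K] {y}
  have : FiniteDimensional 𝓀[K] F := IntermediateField.adjoin.finiteDimensional hint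
  have : Finite F := Module.finite_of_finite 𝓀[K]
  have := Fintype.ofFinite F
  let z : F := ⟨y, IntermediateField.mem_adjoin_simple_self _ y⟩
  have hz : z ≠ 0 := fun h => hy (congrArg Subtype.val h)
  have hcard : Fintype.card F = residueCard K ^ Module.finrank 𝓀[K] F := by
    rw [residueCard, ← Nat.card_eq_fintype_card, ← Module.natCard_eq_pow_finrank]
  refine ⟨Fintype.card F - 1, ?_, congrArg Subtype.val (FiniteField.pow_card_sub_one_eq_one z hz)⟩
  rw [hcard]
  exact not_residueChar_dvd_sub_one Module.finrank_pos.ne'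

/-- Existence of Teichmüller representatives: a primitive `n`-th root of unity stays primitive after
reduction, so its powers reduce onto all `n`-th roots of unity. -/
theorem exists_tameRoots_sepRed_eq {y : SepRes K} (hy : y ≠ 0) :
    ∃ ζ ∈ tameRoots K, sepRed ζ = y := by
  obtain ⟨n, hn, h⟩ := exists_pow_eq_one_sepRes hy
  obtain ⟨ζ, hζ⟩ := exists_primitiveRoot (K := K) hn
  have hζ' := isPrimitiveRoot_sepRed hn hζ
  have : NeZero n := ⟨ne_zero_of_residueChar hn⟩
  obtain ⟨i, -, hi⟩ := hζ'.eq_pow_of_pow_eq_one h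
  have hw := sepVal_eq_one_of_pow_eq_one (ne_zero_of_residueChar hn) hζ.pow_eq_one
  exact ⟨ζ ^ i, pow_tameRoots i ⟨n, hn, hζ.pow_eq_one⟩, by rw [sepRed_pow hw.le, hi]⟩

/-- Elements of the residue field fixed by the `q`-power map come from the residue field of `K`. -/
theorem exists_integerRed_eq {y : SepRes K} (hy : y ^ residueCard K = y) :
    ∃ x : 𝒪[K], integerRed K x = y := by
  have := Fintype.ofFinite 𝓀[K]
  -- The polynomial `X ^ q - X` already splits over the residue field of `K`, so it has no further
  -- roots in an extension.
  have h1 : (Polynomial.X ^ Fintype.card 𝓀[K] - Polynomial.X : Polynomial 𝓀[K]).Splits := by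
    rw [Polynomial.splits_iff_card_roots, FiniteField.roots_X_pow_card_sub_X,
      FiniteField.X_pow_card_sub_X_natDegree_eq _ Fintype.one_lt_card]
    rfl
  have h2 := h1.roots_map (algebraMap 𝓀[K] (SepRes K))
  have hy' : y ∈ ((Polynomial.X ^ Fintype.card 𝓀[K] - Polynomial.X : Polynomial 𝓀[K]).map (algebraMap 𝓀[K] (SepRes K))).roots := by
    rw [Polynomial.mem_roots']
    refine ⟨Polynomial.map_ne_zero (FiniteField.X_pow_card_sub_X_ne_zero _ Fintype.one_lt_card), ?_⟩
    rw [residueCard, Nat.card_eq_fintype_card] at hy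
    simp [hy]
  rw [h2, Multiset.mem_map] at hy'
  obtain ⟨z, -, rfl⟩ := hy'
  obtain ⟨x, rfl⟩ := IsLocalRing.residue_surjective z
  exact ⟨x, (algebraMap_residue x).symm⟩

theorem integerRed_pow_card (x : 𝒪[K]) : integerRed K x ^ residueCard K = integerRed K x := by
  have := Fintype.ofFinite 𝓀[K]
  rw [← algebraMap_residue, ← map_pow, residueCard, Nat.card_eq_fintype_card, FiniteField.pow_card]

end Reduction

/-! ### The Galois action on the residue field -/

section GaloisResidue

open scoped NNReal

variable (K : Type*) [Field K] [ValuativeRel K] [TopologicalSpace K]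
  [IsNonarchimedeanLocalField K]

/-- The absolute Galois group. -/
abbrev SepGal (K : Type*) [Field K] : Type _ := SeparableClosure K ≃ₐ[K] SeparableClosure K

variable {K}

/-- The condition depends only on the restriction to the finite extension `K(x)`. Hence any
condition on one value `τ x` is both open and closed, which feeds the compactness arguments. -/
theorem isOpen_setOf_apply_mem (x : SeparableClosure K) (S : Set (SeparableClosure K)) :
    IsOpen {τ : SepGal K | τ x ∈ S} := by
  rw [isOpen_iff_mem_nhds]
  intro τ hτ
  have : FiniteDimensional K (IntermediateField.adjoin K {x}) :=
    IntermediateField.adjoin.finiteDimensional (Algebra.IsIntegral.isIntegral x)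
  have h := ((IntermediateField.fixingSubgroup_isOpen (IntermediateField.adjoin K {x})).leftCoset τ)
  refine Filter.mem_of_superset (h.mem_nhds ⟨1, one_mem _, mul_one τ⟩) ?_
  rintro _ ⟨σ, hσ, rfl⟩
  have hσx : σ x = x := hσ ⟨x, IntermediateField.mem_adjoin_simple_self K x⟩
  change (τ • σ) x ∈ S
  rw [smul_eq_mul, AlgEquiv.mul_apply, hσx]
  exact hτ

theorem isClosed_setOf_apply_mem (x : SeparableClosure K) (S : Set (SeparableClosure K)) :
    IsClosed {τ : SepGal K | τ x ∈ S} :=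
  ⟨isOpen_setOf_apply_mem x Sᶜ⟩

theorem sepRed_galois_congr (σ : SepGal K) {x y : SeparableClosure K} (hx : sepVal K x ≤ 1)
    (hy : sepVal K y ≤ 1) (h : sepRed x = sepRed y) : sepRed (σ x) = sepRed (σ y) := by
  rw [sepRed_eq_iff hx hy] at h
  rw [sepRed_eq_iff (by simpa using hx) (by simpa using hy), ← map_sub, sepVal_galois]
  exact h

/-- The reduction of the action of a Galois automorphism on integers. -/
noncomputable def sepIntegerMap (σ : SepGal K) : (sepVal K).valuationSubring →+* SepRes K where
  toFun x := sepRed (σ x)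
  map_one' := by simp
  map_zero' := by simp
  map_add' x y := by
    rw [← sepRed_add ((sepVal_galois σ _).trans_le x.2) ((sepVal_galois σ _).trans_le y.2), ← map_add]
    rfl
  map_mul' x y := by
    rw [← sepRed_mul ((sepVal_galois σ _).trans_le x.2) ((sepVal_galois σ _).trans_le y.2), ← map_mul]
    rfl

instance (σ : SepGal K) : IsLocalHom (sepIntegerMap σ) where
  map_nonunit x hx := by
    by_contra h
    rw [← mem_nonunits_iff, ← IsLocalRing.mem_maximalIdeal, Valuation.mem_maximalIdeal_iff] at h
    refine hx.ne_zero ((sepRed_eq_zero_iff (x := σ x) ((sepVal_galois σ _).trans_le x.2)).2 ?_)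
    rw [sepVal_galois]; exact h

/-- The action of a Galois automorphism on the residue field. -/
noncomputable def sepResMap (σ : SepGal K) : SepRes K →+* SepRes K :=
  IsLocalRing.ResidueField.lift (sepIntegerMap σ)

theorem sepResMap_sepRed (σ : SepGal K) {x : SeparableClosure K} (hx : sepVal K x ≤ 1) :
    sepResMap σ (sepRed x) = sepRed (σ x) := by
  rw [sepRed_of_le hx]
  exact IsLocalRing.ResidueField.lift_residue_apply (sepIntegerMap σ) _

/-- The product of `X - y` over the `N`-orbit of a primitive root `ζ` has coefficients fixed by `N`.
Their residues are fixed by `s`, so `s` maps the residue of `ζ` to another root of the reduced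
polynomial, which is the residue of some `τ ζ` with `τ ∈ N`. -/
theorem exists_galois_lift_level (N : Subgroup (SepGal K)) (s : SepRes K →+* SepRes K)
    (hs : ∀ x, sepVal K x ≤ 1 → (∀ σ ∈ N, σ x = x) → s (sepRed x) = sepRed x)
    {n : ℕ} (hn : ¬ residueChar K ∣ n) :
    ∃ τ ∈ N, ∀ x : SeparableClosure K, x ^ n = 1 → sepRed (τ x) = s (sepRed x) := by
  classical
  obtain ⟨ζ, hζ⟩ := exists_primitiveRoot (K := K) hn
  have hn0 := ne_zero_of_residueChar hn
  let Y : Finset (SeparableClosure K) :=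
    (Polynomial.nthRoots n 1).toFinset.filter fun y => ∃ τ ∈ N, τ ζ = y
  have hY : ∀ y, y ∈ Y ↔ ∃ τ ∈ N, τ ζ = y := by
    intro y
    simp only [Y, Finset.mem_filter, Multiset.mem_toFinset, and_iff_right_iff_imp]
    rintro ⟨τ, -, rfl⟩
    rw [Polynomial.mem_nthRoots (Nat.pos_of_ne_zero hn0), ← map_pow, hζ.pow_eq_one, map_one]
  have hwζ : sepVal K ζ = 1 := sepVal_eq_one_of_pow_eq_one hn0 hζ.pow_eq_one
  have hYw : ∀ y ∈ Y, sepVal K y ≤ 1 := by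
    intro y hy
    obtain ⟨τ, -, rfl⟩ := (hY y).1 hy
    rw [sepVal_galois, hwζ]
  let A := (sepVal K).valuationSubring
  let F : Polynomial A := ∏ y ∈ Y.attach, (Polynomial.X - Polynomial.C ⟨y.1, hYw y.1 y.2⟩)
  have hFΩ : F.map A.subtype = ∏ y ∈ Y, (Polynomial.X - Polynomial.C y) := by
    rw [Polynomial.map_prod, ← Finset.prod_attach Y]
    simp [A]
  have hfix : ∀ σ ∈ N, (F.map A.subtype).map (σ : SeparableClosure K →+* SeparableClosure K) =
      F.map A.subtype := by
    intro σ hσ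
    rw [hFΩ, Polynomial.map_prod]
    have him : Y.image σ = Y := by
      refine Finset.eq_of_subset_of_card_le ?_ ?_
      · intro z hz
        obtain ⟨y, hy, rfl⟩ := Finset.mem_image.1 hz
        obtain ⟨τ, hτ, rfl⟩ := (hY y).1 hy
        exact (hY _).2 ⟨σ * τ, N.mul_mem hσ hτ, rfl⟩
      · rw [Finset.card_image_of_injective _ σ.injective]
    conv_rhs => rw [← him, Finset.prod_image σ.injective.injOn]
    simp
  let f := F.map (IsLocalRing.residue A)
  have hfs : f.map s = f := by
    ext i
    simp only [f, Polynomial.coeff_map]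
    have h1 : IsLocalRing.residue A (F.coeff i) = sepRed (F.coeff i : SeparableClosure K) :=
      (sepRed_of_le (F.coeff i).2).symm
    rw [h1]
    refine hs _ (F.coeff i).2 fun σ hσ => ?_
    have := congrArg (fun P => Polynomial.coeff P i) (hfix σ hσ)
    simpa using this
  have hfe : ∀ z, f.eval z = ∏ y ∈ Y, (z - sepRed y) := by
    intro z
    simp only [f, F, Polynomial.map_prod, Polynomial.eval_prod]
    rw [← Finset.prod_attach Y]
    refine Finset.prod_congr rfl fun y _ => ?_
    simp [sepRed_of_le (hYw y.1 y.2), A]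
  have h0 : f.eval (sepRed ζ) = 0 := by
    rw [hfe]
    exact Finset.prod_eq_zero ((hY ζ).2 ⟨1, N.one_mem, rfl⟩) (sub_self _)
  have h1 : f.eval (s (sepRed ζ)) = 0 := by
    rw [← hfs, Polynomial.eval_map_apply, h0, map_zero]
  rw [hfe, Finset.prod_eq_zero_iff] at h1
  obtain ⟨y, hy, hy'⟩ := h1
  obtain ⟨τ, hτ, rfl⟩ := (hY y).1 hy
  refine ⟨τ, hτ, fun x hx => ?_⟩
  have : NeZero n := ⟨hn0⟩
  obtain ⟨i, -, rfl⟩ := hζ.eq_pow_of_pow_eq_one hx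
  rw [map_pow, sepRed_pow (by rw [sepVal_galois, hwζ]), sepRed_pow hwζ.le, map_pow,
    ← sub_eq_zero.1 hy']

instance : Nonempty {n : ℕ // ¬ residueChar K ∣ n} :=
  ⟨⟨1, by rw [Nat.dvd_one]; exact residueChar_prime.one_lt.ne'⟩⟩

/-- Directed families of closed subsets of the Galois group, indexed by the integers prime to the
residue characteristic. -/
theorem nonempty_iInter_of_dvd (C : ℕ → Set (SepGal K))
    (hC : ∀ n, ¬ residueChar K ∣ n → (C n).Nonempty ∧ IsClosed (C n))
    (hd : ∀ n m, ¬ residueChar K ∣ n → ¬ residueChar K ∣ m → C (n * m) ⊆ C n) :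
    ∃ τ, ∀ n, ¬ residueChar K ∣ n → τ ∈ C n := by
  obtain ⟨τ, hτ⟩ := IsCompact.nonempty_iInter_of_directed_nonempty_isCompact_isClosed
    (fun n : {n : ℕ // ¬ residueChar K ∣ n} => C n.1) (fun n m =>
      ⟨⟨n.1 * m.1, not_residueChar_dvd_mul n.2 m.2⟩, hd _ _ n.2 m.2, by
        dsimp only; rw [mul_comm]; exact hd _ _ m.2 n.2⟩)
    (fun n => (hC n n.2).1) (fun n => (hC n n.2).2.isCompact) (fun n => (hC n n.2).2)
  exact ⟨τ, fun n hn => Set.mem_iInter.1 hτ ⟨n, hn⟩⟩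

theorem exists_galois_lift (N : Subgroup (SepGal K)) (hN : IsClosed (N : Set (SepGal K)))
    (s : SepRes K →+* SepRes K)
    (hs : ∀ x, sepVal K x ≤ 1 → (∀ σ ∈ N, σ x = x) → s (sepRed x) = sepRed x) :
    ∃ τ ∈ N, ∀ ζ ∈ tameRoots K, sepRed (τ ζ) = s (sepRed ζ) := by
  obtain ⟨τ, hτ⟩ := nonempty_iInter_of_dvd
    (fun n => {τ : SepGal K | τ ∈ N ∧ ∀ x, x ^ n = 1 → sepRed (τ x) = s (sepRed x)})
    (fun n hn => ⟨exists_galois_lift_level N s hs hn, by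
      simp only [Set.ofPred_and, Set.ofPred_forall]
      refine hN.inter (isClosed_iInter fun x => isClosed_iInter fun _ => ?_)
      exact isClosed_setOf_apply_mem x {y | sepRed y = s (sepRed x)}⟩)
    (fun n m _ _ τ h => ⟨h.1, fun x hx => h.2 x (by rw [pow_mul, hx, one_pow])⟩)
  refine ⟨τ, (hτ 1 (by rw [Nat.dvd_one]; exact residueChar_prime.one_lt.ne')).1, ?_⟩
  rintro ζ ⟨n, hn, h⟩
  exact (hτ n hn).2 ζ h

/-- Lift the `q`-power map with `N` the whole group: the fixed elements lie in `K`, where residues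
satisfy `y ^ q = y`. On roots of unity of order prime to `p` the congruence becomes an equality. -/
theorem exists_frobenius_lift :
    ∃ b : SepGal K, ∀ ζ ∈ tameRoots K, b ζ = ζ ^ residueCard K := by
  have := Fintype.ofFinite 𝓀[K]
  obtain ⟨b, -, hb⟩ := exists_galois_lift (⊤ : Subgroup (SepGal K)) isClosed_univ
    (FiniteField.frobeniusAlgHom 𝓀[K] (SepRes K)).toRingHom (by
      intro x hx h
      obtain ⟨y, rfl⟩ := (InfiniteGalois.mem_range_algebraMap_iff_fixed x).2 fun σ => h σ trivial
      rw [sepVal_algebraMap_le_one_iff] at hx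
      have := integerRed_pow_card (⟨y, hx⟩ : 𝒪[K])
      rw [residueCard, Nat.card_eq_fintype_card] at this
      exact this)
  refine ⟨b, fun ζ hζ => tameRoots_ext (galois_tameRoots _ hζ) (pow_tameRoots _ hζ) ?_⟩
  rw [hb ζ hζ, sepRed_pow (sepVal_tameRoots hζ).le, residueCard, Nat.card_eq_fintype_card]
  rfl

variable (K) in
/-- The inertia subgroup of the absolute Galois group. -/
def sepInertia : Subgroup (SepGal K) where
  carrier := {σ | ∀ ζ ∈ tameRoots K, σ ζ = ζ}
  mul_mem' := by
    intro a b ha hb ζ hζ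
    rw [AlgEquiv.mul_apply, hb ζ hζ, ha ζ hζ]
  one_mem' := fun _ _ => rfl
  inv_mem' := by
    intro a ha ζ hζ
    rw [AlgEquiv.aut_inv, AlgEquiv.symm_apply_eq, ha ζ hζ]

theorem mem_sepInertia {σ : SepGal K} : σ ∈ sepInertia K ↔ ∀ ζ ∈ tameRoots K, σ ζ = ζ := Iff.rfl

/-- Every nonzero residue has a Teichmüller representative, so acting trivially on residues and
fixing those representatives are the same condition. -/
theorem mem_sepInertia_iff {σ : SepGal K} :
    σ ∈ sepInertia K ↔ ∀ x, sepVal K x ≤ 1 → sepRed (σ x) = sepRed x := by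
  constructor
  · intro h x hx
    by_cases h0 : sepRed x = 0
    · rw [h0, sepRed_eq_zero_iff (by simpa using hx), sepVal_galois]
      exact (sepRed_eq_zero_iff hx).1 h0
    · obtain ⟨ζ, hζ, hr⟩ := exists_tameRoots_sepRed_eq h0
      rw [sepRed_galois_congr σ hx (sepVal_tameRoots hζ).le hr.symm, h ζ hζ, hr]
  · intro h ζ hζ
    exact tameRoots_ext (galois_tameRoots σ hζ) hζ (h ζ (sepVal_tameRoots hζ).le)

/-- Automorphisms acting trivially on the residue field of the fixed field of `N`. -/
def inertiaOver (N : Subgroup (SepGal K)) : Set (SepGal K) :=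
  {σ | ∀ x, sepVal K x ≤ 1 → (∀ ν ∈ N, ν x = x) → sepRed (σ x) = sepRed x}

/-- The action of `σ` on residues lifts to some `ν ∈ N`, and `σ ν⁻¹` then acts trivially on all
residues. Thus the inertia group of a finite layer is the image of the absolute one. -/
theorem exists_mul_of_mem_inertiaOver {N : Subgroup (SepGal K)} (hN : IsClosed (N : Set (SepGal K)))
    {σ : SepGal K} (hσ : σ ∈ inertiaOver N) : ∃ ι ∈ sepInertia K, ∃ ν ∈ N, σ = ι * ν := by
  obtain ⟨ν, hν, h⟩ := exists_galois_lift N hN (sepResMap σ) fun x hx hf => by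
    rw [sepResMap_sepRed σ hx]; exact hσ x hx hf
  refine ⟨σ * ν⁻¹, fun ζ hζ => ?_, ν, hν, by simp⟩
  have h1 := galois_tameRoots ν⁻¹ hζ
  refine tameRoots_ext (galois_tameRoots _ hζ) hζ ?_
  rw [AlgEquiv.mul_apply, ← sepResMap_sepRed σ (sepVal_tameRoots h1).le, ← h _ h1,
    ← AlgEquiv.mul_apply, mul_inv_cancel, AlgEquiv.one_apply]

end GaloisResidue

/-! ### Discreteness and descent for finite extensions -/

section Descent

open scoped NNReal

theorem apply_mul_out {G M : Type*} [Group G] {N : Subgroup G} (F : G → M)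
    (hF : ∀ σ, ∀ ν ∈ N, F (σ * ν) = F σ) (τ : G) (s : G ⧸ N) :
    F (τ * s.out) = F (τ • s).out := by
  have h : ((τ • s).out)⁻¹ * (τ * s.out) ∈ N := by
    rw [← QuotientGroup.eq, QuotientGroup.out_eq', ← smul_eq_mul, ← MulAction.Quotient.smul_mk,
      QuotientGroup.out_eq']
  have := hF (τ • s).out _ h
  rwa [mul_inv_cancel_left] at this

/-- Left translation permutes the cosets, so such sums, and the products in `prod_mul_out`, are
Galois-invariant. Traces and norms built this way descend to `K`. -/
theorem sum_mul_out {G M : Type*} [Group G] {N : Subgroup G} [Fintype (G ⧸ N)] [AddCommMonoid M]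
    (F : G → M) (hF : ∀ σ, ∀ ν ∈ N, F (σ * ν) = F σ) (τ : G) :
    ∑ s : G ⧸ N, F (τ * s.out) = ∑ s : G ⧸ N, F s.out := by
  simp only [apply_mul_out F hF]
  exact Equiv.sum_comp (MulAction.toPerm τ) fun s : G ⧸ N => F s.out

theorem prod_mul_out {G M : Type*} [Group G] {N : Subgroup G} [Fintype (G ⧸ N)] [CommMonoid M]
    (F : G → M) (hF : ∀ σ, ∀ ν ∈ N, F (σ * ν) = F σ) (τ : G) :
    ∏ s : G ⧸ N, F (τ * s.out) = ∏ s : G ⧸ N, F s.out := by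
  simp only [apply_mul_out F hF]
  exact Equiv.prod_comp (MulAction.toPerm τ) fun s : G ⧸ N => F s.out

variable {K : Type*} [Field K] [ValuativeRel K] [TopologicalSpace K]
  [IsNonarchimedeanLocalField K]

/-- `Π` is a uniformizer of the fixed field of `N`, which has ramification index `e`. -/
structure SubfieldUnif (N : Subgroup (SepGal K)) (ϖ : SeparableClosure K) (e : ℕ) : Prop where
  fixed : ∀ ν ∈ N, ν ϖ = ϖ
  pos : 0 < e
  pow_eq : sepVal K ϖ ^ e = sepVal K (sepUnif K)
  exists_zpow : ∀ x, x ≠ 0 → (∀ ν ∈ N, ν x = x) → ∃ i : ℤ, sepVal K x = sepVal K ϖ ^ i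

namespace SubfieldUnif

variable {N : Subgroup (SepGal K)} {ϖ : SeparableClosure K} {e : ℕ} (h : SubfieldUnif N ϖ e)

include h

theorem lt_one : sepVal K ϖ < 1 := by
  by_contra! h1
  have := one_le_pow₀ h1 (n := e)
  rw [h.pow_eq] at this
  exact this.not_gt sepVal_unif_lt_one

theorem val_pos : 0 < sepVal K ϖ := by
  rw [zero_lt_iff]
  intro h0
  have := h.pow_eq
  rw [h0, zero_pow h.pos.ne'] at this
  exact sepVal_unif_pos.ne this

theorem ne_zero : ϖ ≠ 0 := (sepVal K).ne_zero_iff.1 h.val_pos.ne'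

theorem le_of_lt {x : SeparableClosure K} (hx : ∀ ν ∈ N, ν x = x) {i : ℤ}
    (hi : sepVal K x < sepVal K ϖ ^ i) : sepVal K x ≤ sepVal K ϖ ^ (i + 1) := by
  by_cases h0 : x = 0
  · rw [h0, map_zero]; exact zero_le
  · obtain ⟨j, hj⟩ := h.exists_zpow x h0 hx
    rw [hj] at hi ⊢
    rw [zpow_lt_zpow_iff_right_of_lt_one₀ h.val_pos h.lt_one] at hi
    rw [zpow_le_zpow_iff_right_of_lt_one₀ h.val_pos h.lt_one]
    omega

theorem dvd_of_val_eq {x : K} (hx : x ≠ 0) {m : ℕ}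
    (hm : sepVal K (algebraMap K _ x) = sepVal K ϖ ^ m) : e ∣ m := by
  obtain ⟨k, hk⟩ := exists_sepVal_algebraMap_eq_zpow hx
  rw [hk, ← h.pow_eq, ← zpow_natCast, ← zpow_natCast, ← zpow_mul] at hm
  have := zpow_right_injective₀ h.val_pos h.lt_one.ne hm
  exact Int.natCast_dvd_natCast.1 ⟨k, this.symm⟩

end SubfieldUnif

theorem mem_range_of_fixed {x : SeparableClosure K} (h : ∀ σ : SepGal K, σ x = x) :
    ∃ y : K, algebraMap K _ y = x :=
  (InfiniteGalois.mem_range_algebraMap_iff_fixed x).2 h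

/-- The norm of an element of the fixed field lies in `K`, so the `m`-th power of its value is an
integral power of the value of the uniformizer of `K`. The integers that occur form a subgroup of
`ℤ`, and an element realizing its generator is a uniformizer. -/
theorem exists_subfieldUnif (N : Subgroup (SepGal K)) (hN : IsOpen (N : Set (SepGal K))) :
    ∃ ϖ e, SubfieldUnif N ϖ e := by
  -- The norm is taken over the cosets of an open normal subgroup inside `N`. It is then a power of
  -- the true norm of the fixed field, which does no harm.
  obtain ⟨U, hU⟩ := ProfiniteGrp.exist_openNormalSubgroup_sub_open_nhds_of_one hN (one_mem N)
  have hUo : IsOpen (U.toSubgroup : Set (SepGal K)) := U.isOpen'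
  have : Finite (SepGal K ⧸ U.toSubgroup) := Subgroup.quotient_finite_of_isOpen _ hUo
  have := Fintype.ofFinite (SepGal K ⧸ U.toSubgroup)
  set m := Fintype.card (SepGal K ⧸ U.toSubgroup) with hm
  have hm0 : m ≠ 0 := Fintype.card_ne_zero
  have key : ∀ x, x ≠ 0 → (∀ ν ∈ N, ν x = x) → ∃ k : ℤ, sepVal K x ^ m = sepVal K (sepUnif K) ^ k := by
    intro x hx0 hx
    have hfix : ∀ σ : SepGal K, σ (∏ s : SepGal K ⧸ U.toSubgroup, s.out x) =
        ∏ s : SepGal K ⧸ U.toSubgroup, s.out x := by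
      intro σ
      rw [map_prod]
      refine prod_mul_out (fun τ : SepGal K => τ x) (fun τ ν hν => ?_) σ
      rw [AlgEquiv.mul_apply, hx ν (hU hν)]
    obtain ⟨y, hy⟩ := mem_range_of_fixed hfix
    have hv : sepVal K (algebraMap K _ y) = sepVal K x ^ m := by
      rw [hy, map_prod]; simp [hm]
    have hy0 : y ≠ 0 := by
      rintro rfl
      rw [map_zero, map_zero] at hv
      exact (pow_ne_zero m ((sepVal K).ne_zero_iff.2 hx0)) hv.symm
    obtain ⟨k, hk⟩ := exists_sepVal_algebraMap_eq_zpow hy0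
    exact ⟨k, by rw [← hv, hk]⟩
  let Z : AddSubgroup ℤ :=
    { carrier := {k | ∃ x, x ≠ 0 ∧ (∀ ν ∈ N, ν x = x) ∧ sepVal K x ^ m = sepVal K (sepUnif K) ^ k}
      zero_mem' := ⟨1, one_ne_zero, by simp, by simp⟩
      add_mem' := by
        rintro a b ⟨x, hx, hx1, hx2⟩ ⟨y, hy, hy1, hy2⟩
        refine ⟨x * y, mul_ne_zero hx hy, fun ν hν => by rw [map_mul, hx1 ν hν, hy1 ν hν], ?_⟩
        rw [map_mul, mul_pow, hx2, hy2, zpow_add₀ sepVal_unif_pos.ne']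
      neg_mem' := by
        rintro a ⟨x, hx, hx1, hx2⟩
        refine ⟨x⁻¹, inv_ne_zero hx, fun ν hν => by rw [map_inv₀, hx1 ν hν], ?_⟩
        rw [map_inv₀, inv_pow, hx2, zpow_neg] }
  obtain ⟨d, hd⟩ := Int.subgroup_cyclic Z
  rw [← AddSubgroup.zmultiples_eq_closure] at hd
  have hmem : ∀ k, k ∈ Z ↔ ((d.natAbs : ℕ) : ℤ) ∣ k := by
    intro k
    rw [hd, Int.mem_zmultiples_iff, Int.natAbs_dvd]
  -- The uniformizer of `K` itself gives the integer `m`, so the generator divides `m`; the quotient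
  -- is the ramification index.
  have hmZ : (m : ℤ) ∈ Z := ⟨sepUnif K, sepUnif_ne_zero, by simp, by simp⟩
  rw [hmem, Int.natCast_dvd_natCast] at hmZ
  obtain ⟨e, he⟩ := hmZ
  obtain ⟨ϖ, h1, h2, h3⟩ := (hmem (d.natAbs : ℕ)).2 dvd_rfl
  refine ⟨ϖ, e, h2, Nat.pos_of_ne_zero fun h => hm0 (by rw [he, h, mul_zero]), ?_, ?_⟩
  · rw [zpow_natCast] at h3
    have : (sepVal K ϖ ^ e) ^ m = sepVal K (sepUnif K) ^ m := by
      rw [pow_right_comm, h3, ← pow_mul, ← he]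
    exact (pow_left_inj₀ zero_le zero_le hm0).1 this
  · intro x hx0 hx
    obtain ⟨k, hk⟩ := key x hx0 hx
    obtain ⟨i, rfl⟩ := (hmem k).1 ⟨x, hx0, hx, hk⟩
    refine ⟨i, (pow_left_inj₀ zero_le zero_le hm0).1 ?_⟩
    rw [hk, zpow_mul, ← h3, ← zpow_natCast (sepVal K ϖ) m, ← zpow_natCast (sepVal K ϖ ^ i) m, ← zpow_mul, ← zpow_mul, mul_comm]

variable (K) in
/-- The image of the inertia subgroup in a finite quotient of the Galois group. -/
noncomputable def inertiaImage (N : Subgroup (SepGal K)) [N.Normal] : Subgroup (SepGal K ⧸ N) :=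
  (sepInertia K).map (QuotientGroup.mk' N)

theorem out_mem_inertiaOver_iff {N : Subgroup (SepGal K)} [N.Normal]
    (hN : IsClosed (N : Set (SepGal K))) (s : SepGal K ⧸ N) :
    s.out ∈ inertiaOver N ↔ s ∈ inertiaImage K N := by
  constructor
  · intro h
    obtain ⟨ι, hι, ν, hν, he⟩ := exists_mul_of_mem_inertiaOver hN h
    refine ⟨ι, hι, ?_⟩
    rw [← QuotientGroup.out_eq' s, he]
    exact (QuotientGroup.eq.2 (by simpa using hν))
  · rintro ⟨ι, hι, rfl⟩ x hx hf
    have h : ι⁻¹ * (QuotientGroup.mk' N ι).out ∈ N := by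
      rw [← QuotientGroup.eq, QuotientGroup.out_eq']; rfl
    have h2 : (QuotientGroup.mk' N ι).out x = ι x := by
      have := congrArg ι (hf _ h)
      rwa [← AlgEquiv.mul_apply, mul_inv_cancel_left] at this
    rw [h2]
    exact mem_sepInertia_iff.1 hι x hx

open Classical in
-- The maps `c ↦ sepRed (s c)` are multiplicative on the integers of the fixed field, so distinct
-- ones are linearly independent. The cosets that induce the plain reduction are exactly those in
-- the image of inertia; their coefficients must sum to zero on their own.
theorem sum_inertia_eq_zero {N : Subgroup (SepGal K)} [N.Normal]
    (hN : IsClosed (N : Set (SepGal K))) [Fintype (SepGal K ⧸ N)] (t : SepGal K ⧸ N → SepRes K)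
    (ht : ∀ c, sepVal K c ≤ 1 → (∀ ν ∈ N, ν c = c) → ∑ s, t s * sepRed (s.out c) = 0) :
    ∑ s with s ∈ inertiaImage K N, t s = 0 := by
  let R : Submonoid (SeparableClosure K) :=
    { carrier := {c | sepVal K c ≤ 1 ∧ ∀ ν ∈ N, ν c = c}
      one_mem' := ⟨by simp, by simp⟩
      mul_mem' := fun {a b} ha hb => ⟨sepVal_mul_le_one ha.1 hb.1, fun ν hν => by
        rw [map_mul, ha.2 ν hν, hb.2 ν hν]⟩ }
  let χ : SepGal K → (R →* SepRes K) := fun σ =>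
    { toFun := fun c => sepRed (σ c)
      map_one' := by simp
      map_mul' := fun a b => by
        rw [Submonoid.coe_mul, map_mul, sepRed_mul (by simpa using a.2.1) (by simpa using b.2.1)] }
  have hli := linearIndependent_monoidHom R (SepRes K)
  have h0 : ∑ s : SepGal K ⧸ N, Finsupp.single (χ s.out) (t s) = 0 := by
    apply hli
    simp only [map_sum, Finsupp.linearCombination_single, map_zero]
    funext c
    simp only [Finset.sum_apply, Pi.smul_apply, smul_eq_mul, Pi.zero_apply]
    exact ht c c.2.1 c.2.2
  have h1 := DFunLike.congr_fun h0 (χ 1)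
  rw [Finsupp.finsetSum_apply] at h1
  simp only [Finsupp.single_apply, Finsupp.coe_zero, Pi.zero_apply] at h1
  rw [← Finset.sum_filter] at h1
  rw [← h1]
  refine Finset.sum_congr (Finset.filter_congr fun s _ => ?_) fun _ _ => rfl
  rw [← out_mem_inertiaOver_iff hN]
  constructor
  · intro h
    ext c
    exact h c c.2.1 c.2.2
  · intro h x hx hf
    exact DFunLike.congr_fun h (⟨x, hx, hf⟩ : R)

/-- If `K` had no element of the value of `y`, the traces of all `c y` with `c` integral would be
strictly smaller than `y`. That is a linear relation between the reduced conjugates of `c`. Its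
inertia part is the order of the inertia image, nonzero in the residue field because `p` does not
divide it. -/
theorem exists_val_eq_of_inertia {N : Subgroup (SepGal K)} [N.Normal]
    (hN : IsOpen (N : Set (SepGal K))) (hp : ¬ residueChar K ∣ Nat.card (inertiaImage K N))
    {y : SeparableClosure K} (hy0 : y ≠ 0) (hy : ∀ ν ∈ N, ν y = y)
    (hI : ∀ σ ∈ sepInertia K, sepRed (σ y / y) = 1) :
    ∃ z : K, z ≠ 0 ∧ sepVal K (algebraMap K _ z) = sepVal K y := by
  classical
  have : Finite (SepGal K ⧸ N) := Subgroup.quotient_finite_of_isOpen _ hN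
  have := Fintype.ofFinite (SepGal K ⧸ N)
  have hNc : IsClosed (N : Set (SepGal K)) := Subgroup.isClosed_of_isOpen _ hN
  have hyv : sepVal K y ≠ 0 := (sepVal K).ne_zero_iff.2 hy0
  have hw : ∀ σ : SepGal K, sepVal K (σ y / y) = 1 := fun σ => by
    rw [map_div₀, sepVal_galois, div_self hyv]
  by_contra! hcon
  have h := sum_inertia_eq_zero hNc (fun s => sepRed (s.out y / y)) (fun c hc hcf => by
    have hfix : ∀ σ : SepGal K, σ (∑ s : SepGal K ⧸ N, s.out (c * y)) =
        ∑ s : SepGal K ⧸ N, s.out (c * y) := by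
      intro σ
      rw [map_sum]
      refine sum_mul_out (fun τ : SepGal K => τ (c * y)) (fun τ ν hν => ?_) σ
      rw [AlgEquiv.mul_apply, map_mul ν, hcf ν hν, hy ν hν]
    obtain ⟨z, hz⟩ := mem_range_of_fixed hfix
    have hsum : ∑ s : SepGal K ⧸ N, s.out y / y * s.out c = algebraMap K _ z / y := by
      rw [hz, Finset.sum_div]
      refine Finset.sum_congr rfl fun s _ => ?_
      rw [map_mul]; ring
    have hle : ∀ s : SepGal K ⧸ N, sepVal K (s.out y / y * s.out c) ≤ 1 := fun s =>
      sepVal_mul_le_one (hw _).le (by simpa using hc)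
    have h1 : ∑ s : SepGal K ⧸ N, sepRed (s.out y / y) * sepRed (s.out c) =
        sepRed (algebraMap K _ z / y) := by
      rw [← hsum, sepRed_sum _ fun s _ => hle s]
      exact Finset.sum_congr rfl fun s _ => (sepRed_mul (hw _).le (by simpa using hc)).symm
    rw [h1]
    have hle' : sepVal K (algebraMap K _ z / y) ≤ 1 := by
      rw [← hsum]; exact sepVal_sum_le_one _ fun s _ => hle s
    rw [sepRed_eq_zero_iff hle']
    refine lt_of_le_of_ne hle' fun he => ?_
    rw [map_div₀, div_eq_one_iff_eq hyv] at he
    exact hcon z (fun h => hyv (by rw [← he, h, map_zero, map_zero])) he)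
  have h2 : ∀ s : SepGal K ⧸ N, s ∈ inertiaImage K N → sepRed (s.out y / y) = 1 := by
    rintro _ ⟨ι, hι, rfl⟩
    have h3 : ι⁻¹ * (QuotientGroup.mk' N ι).out ∈ N := by
      rw [← QuotientGroup.eq, QuotientGroup.out_eq']; rfl
    have h4 : (QuotientGroup.mk' N ι).out y = ι y := by
      have := congrArg ι (hy _ h3)
      rwa [← AlgEquiv.mul_apply, mul_inv_cancel_left] at this
    rw [h4]
    exact hI ι hι
  rw [Finset.sum_congr rfl fun s hs => h2 s (Finset.mem_filter.1 hs).2, Finset.sum_const,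
    nsmul_eq_mul, mul_one] at h
  refine sepRes_natCast_ne_zero hp ?_
  rw [← h, Nat.card_eq_fintype_card, Fintype.card_subtype]

/-- An automorphism fixing the roots of unity of order prime to `p` and an `e`-th root of a
uniformizer fixes every extension of ramification index `e` prime to `p`. -/
theorem SubfieldUnif.fixes_of_tame {N : Subgroup (SepGal K)} {ϖ : SeparableClosure K} {e : ℕ}
    (h : SubfieldUnif N ϖ e) (he : ¬ residueChar K ∣ e) {r : SeparableClosure K}
    (hr : r ^ e = sepUnif K) {σ : SepGal K} (hσ : σ ∈ sepInertia K) (hσr : σ r = r)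
    {x : SeparableClosure K} (hx : ∀ ν ∈ N, ν x = x) : σ x = x := by
  have hr0 : r ≠ 0 := by
    rintro rfl
    rw [zero_pow h.pos.ne'] at hr
    exact sepUnif_ne_zero hr.symm
  have hrv : sepVal K r = sepVal K ϖ := by
    refine (pow_left_inj₀ zero_le zero_le h.pos.ne').1 ?_
    rw [← map_pow, hr, h.pow_eq]
  -- the normalized uniformizer
  obtain ⟨ϖ', h', hσ'⟩ : ∃ ϖ', SubfieldUnif N ϖ' e ∧ σ ϖ' = ϖ' := by
    have hy1 : sepVal K (ϖ / r) = 1 := by rw [map_div₀, hrv, div_self h.val_pos.ne']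
    -- Here `ξ` is the Teichmüller representative of `ϖ / r`. The aim is that `r ξ`, which `σ`
    -- fixes, is again a uniformizer of the fixed field of `N`.
    obtain ⟨ξ, hξ, hξr⟩ := exists_tameRoots_sepRed_eq (sepRed_ne_zero hy1)
    have hξ1 := sepVal_tameRoots hξ
    have hξ0 : ξ ≠ 0 := by rintro rfl; simp at hξ1
    have hζ : ∀ ν ∈ N, ν (ξ ^ e) = ξ ^ e := by
      intro ν hν
      refine tameRoots_ext (galois_tameRoots ν (pow_tameRoots e hξ)) (pow_tameRoots e hξ) ?_
      have h1 : sepRed (ξ ^ e) = sepRed (ϖ ^ e / sepUnif K) := by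
        rw [sepRed_pow hξ1.le, hξr, ← sepRed_pow hy1.le, div_pow, hr]
      rw [sepRed_galois_congr ν (by simp [hξ1]) (by
        rw [← hr, ← div_pow, map_pow, hy1, one_pow]) h1, map_div₀, map_pow, h.fixed ν hν, galois_sepUnif, h1]
    have hy1' : sepVal K (ϖ / (r * ξ)) = 1 := by
      rw [map_div₀, map_mul, hξ1, mul_one, hrv, div_self h.val_pos.ne']
    have hyr : sepRed (ϖ / (r * ξ)) = 1 := by
      rw [← div_div, div_eq_mul_inv, sepRed_mul hy1.le (by simp [hξ1]), sepRed_inv hξ1, hξr,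
        mul_inv_cancel₀ (sepRed_ne_zero hy1)]
    -- The unit `ϖ / (r ξ)` reduces to `1` and its `e`-th power is fixed by `N`. Since `p ∤ e`, an
    -- `e`-th root with given residue is unique, so the unit itself is fixed by `N`.
    have hyN : ∀ ν ∈ N, ν (ϖ / (r * ξ)) = ϖ / (r * ξ) := by
      intro ν hν
      refine eq_of_pow_eq_pow_of_sepRed he hy1' ?_ ?_
      · rw [← map_pow, div_pow, mul_pow, hr, map_div₀, map_mul, hζ ν hν, map_pow, h.fixed ν hν, galois_sepUnif]
      · rw [sepRed_galois_congr ν (y := 1) hy1'.le (by simp) (by simp [hyr]), map_one, hyr, sepRed_one]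
    have hval : sepVal K (r * ξ) = sepVal K ϖ := by rw [map_mul, hξ1, mul_one, hrv]
    refine ⟨r * ξ, ⟨?_, h.pos, ?_, ?_⟩, ?_⟩
    · intro ν hν
      have h1 : r * ξ = ϖ / (ϖ / (r * ξ)) := by
        rw [div_div_cancel₀ h.ne_zero]
      rw [h1, map_div₀, hyN ν hν, h.fixed ν hν]
    · rw [hval, h.pow_eq]
    · rw [hval]; exact h.exists_zpow
    · rw [map_mul, hσr, hσ ξ hξ]
  -- approximation
  have happ : ∀ x, sepVal K x ≤ 1 → (∀ ν ∈ N, ν x = x) → ∀ n : ℕ, ∃ z, (∀ ν ∈ N, ν z = z) ∧ σ z = z ∧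
      sepVal K (x - z) ≤ sepVal K ϖ' ^ (n : ℤ) := by
    intro x hx1 hxN n
    induction n with
    | zero => exact ⟨0, by simp, by simp, by simpa using hx1⟩
    | succ n ih =>
      obtain ⟨z, hz, hσz, hxz⟩ := ih
      have hpos : 0 < sepVal K ϖ' ^ (n : ℤ) := zpow_pos h'.val_pos _
      have hp0 : ϖ' ^ n ≠ 0 := pow_ne_zero _ h'.ne_zero
      have hvp : sepVal K (ϖ' ^ n) = sepVal K ϖ' ^ (n : ℤ) := by rw [map_pow, zpow_natCast]
      have hu : sepVal K ((x - z) / ϖ' ^ n) ≤ 1 := by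
        rw [map_div₀, hvp]; exact div_le_one_of_le₀ hxz hpos.le
      have hxzN : ∀ ν ∈ N, ν (x - z) = x - z := fun ν hν => by rw [map_sub, hxN ν hν, hz ν hν]
      by_cases h0 : sepRed ((x - z) / ϖ' ^ n) = 0
      · refine ⟨z, hz, hσz, ?_⟩
        rw [sepRed_eq_zero_iff hu, map_div₀, hvp, div_lt_one₀ hpos] at h0
        exact_mod_cast h'.le_of_lt hxzN h0
      -- The next digit of the expansion of `x` in powers of `ϖ'` is the Teichmüller representative
      -- `ζ`. It is fixed by `N` because its residue comes from the fixed field, and by `σ` because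
      -- `σ` is in inertia.
      · obtain ⟨ζ, hζ, hζr⟩ := exists_tameRoots_sepRed_eq h0
        have hζN : ∀ ν ∈ N, ν ζ = ζ := by
          intro ν hν
          refine tameRoots_ext (galois_tameRoots ν hζ) hζ ?_
          rw [sepRed_galois_congr ν (sepVal_tameRoots hζ).le hu hζr, map_div₀, hxzN ν hν, map_pow,
            h'.fixed ν hν, hζr]
        have hN' : ∀ ν ∈ N, ν (z + ζ * ϖ' ^ n) = z + ζ * ϖ' ^ n := fun ν hν => by
          rw [map_add, hz ν hν, map_mul, hζN ν hν, map_pow, h'.fixed ν hν]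
        refine ⟨z + ζ * ϖ' ^ n, hN', by rw [map_add, hσz, map_mul, hσ ζ hζ, map_pow, hσ'], ?_⟩
        have h1 := (sepRed_eq_iff hu (sepVal_tameRoots hζ).le).1 hζr.symm
        have h2 : x - (z + ζ * ϖ' ^ n) = ((x - z) / ϖ' ^ n - ζ) * ϖ' ^ n := by
          rw [sub_mul, div_mul_cancel₀ _ hp0]; ring
        have h3 : sepVal K (x - (z + ζ * ϖ' ^ n)) < sepVal K ϖ' ^ (n : ℤ) := by
          rw [h2, map_mul, hvp]
          exact mul_lt_of_lt_one_left hpos h1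
        exact_mod_cast h'.le_of_lt (fun ν hν => by rw [map_sub, hxN ν hν, hN' ν hν]) h3
  have hint : ∀ x, sepVal K x ≤ 1 → (∀ ν ∈ N, ν x = x) → σ x = x := by
    intro x hx1 hxN
    -- The approximations are fixed by `σ`, so `σ x - x` is smaller than every power of `ϖ'`.
    have hle : ∀ n : ℕ, sepVal K (σ x - x) ≤ sepVal K ϖ' ^ n := by
      intro n
      obtain ⟨z, -, hz, hxz⟩ := happ x hx1 hxN n
      rw [zpow_natCast] at hxz
      have h1 : σ x - x = σ (x - z) - (x - z) := by rw [map_sub, hz]; ring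
      rw [h1]
      exact (sepVal K).map_sub_le (by rwa [sepVal_galois]) hxz
    by_contra hne
    have hv : 0 < sepVal K (σ x - x) := (sepVal K).pos_iff.2 (sub_ne_zero.2 hne)
    obtain ⟨n, hn⟩ := exists_pow_lt_of_lt_one hv h'.lt_one
    exact (hle n).not_gt hn
  by_cases h1 : sepVal K x ≤ 1
  · exact hint x h1 hx
  · have hx' := hint x⁻¹ (by rw [map_inv₀]; exact inv_le_one_of_one_le₀ (not_le.1 h1).le)
      (fun ν hν => by rw [map_inv₀, hx ν hν])
    rwa [map_inv₀, inv_inj] at hx'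

end Descent

/-! ### Tame levels and generators of the tame quotient -/

section TameLevels

open scoped NNReal

variable (K : Type*) [Field K] [ValuativeRel K] [TopologicalSpace K]
  [IsNonarchimedeanLocalField K]

/-- The `n`-th roots of `1` and of the uniformizer. -/
def levelSet (n : ℕ) : Set (SeparableClosure K) := {x | x ^ n = 1 ∨ x ^ n = sepUnif K}

/-- The automorphisms fixing all `n`-th roots of `1` and of the uniformizer. -/
def levelGroup (n : ℕ) : Subgroup (SepGal K) where
  carrier := {σ | ∀ x ∈ levelSet K n, σ x = x}
  mul_mem' := by
    intro a b ha hb x hx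
    rw [AlgEquiv.mul_apply, hb x hx, ha x hx]
  one_mem' := fun _ _ => rfl
  inv_mem' := by
    intro a ha x hx
    rw [AlgEquiv.aut_inv, AlgEquiv.symm_apply_eq, ha x hx]

variable {K}

theorem galois_mem_levelSet {n : ℕ} (σ : SepGal K) {x : SeparableClosure K} (hx : x ∈ levelSet K n) :
    σ x ∈ levelSet K n := by
  rcases hx with hx | hx
  · left; rw [← map_pow, hx, map_one]
  · right; rw [← map_pow, hx, galois_sepUnif]

instance levelGroup_normal (n : ℕ) : (levelGroup K n).Normal where
  conj_mem ν hν σ x hx := by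
    rw [AlgEquiv.mul_apply, AlgEquiv.mul_apply, hν _ (galois_mem_levelSet σ⁻¹ hx),
      ← AlgEquiv.mul_apply, mul_inv_cancel, AlgEquiv.one_apply]

theorem ne_zero_of_pow_eq_sepUnif {n : ℕ} (hn : n ≠ 0) {r : SeparableClosure K}
    (hr : r ^ n = sepUnif K) : r ≠ 0 := by
  rintro rfl
  rw [zero_pow hn] at hr
  exact sepUnif_ne_zero hr.symm

theorem galois_div_pow_eq_one {n : ℕ} {r : SeparableClosure K}
    (hr : r ^ n = sepUnif K) (σ : SepGal K) : (σ r / r) ^ n = 1 := by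
  rw [div_pow, ← map_pow, hr, galois_sepUnif, div_self sepUnif_ne_zero]

/-- Two Galois automorphisms with the same effect on a primitive root of unity and on one root of
the uniformizer agree on the level set. -/
theorem eqOn_levelSet {n : ℕ} (hn : n ≠ 0) {ζ r : SeparableClosure K} (hζ : IsPrimitiveRoot ζ n)
    (hr : r ^ n = sepUnif K) {σ τ : SepGal K} (h1 : σ ζ = τ ζ) (h2 : σ r = τ r) :
    ∀ x ∈ levelSet K n, σ x = τ x := by
  have : NeZero n := ⟨hn⟩
  have hu : ∀ x, x ^ n = 1 → σ x = τ x := by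
    intro x hx
    obtain ⟨i, -, rfl⟩ := hζ.eq_pow_of_pow_eq_one hx
    rw [map_pow, map_pow, h1]
  rintro x (hx | hx)
  · exact hu x hx
  · have hr0 := ne_zero_of_pow_eq_sepUnif hn hr
    have h3 := hu (x / r) (by rw [div_pow, hx, hr, div_self sepUnif_ne_zero])
    rw [← div_mul_cancel₀ x hr0, map_mul, map_mul, h3, h2]

theorem levelGroup_isOpen {n : ℕ} (hn : ¬ residueChar K ∣ n) :
    IsOpen (levelGroup K n : Set (SepGal K)) := by
  obtain ⟨ζ, hζ⟩ := exists_primitiveRoot (K := K) hn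
  obtain ⟨r, hr⟩ := exists_pow_eq_sep hn (sepUnif K)
  have : (levelGroup K n : Set (SepGal K)) = {σ | σ ζ ∈ ({ζ} : Set _)} ∩ {σ | σ r ∈ ({r} : Set _)} := by
    ext σ
    constructor
    · intro h
      exact ⟨h ζ (Or.inl hζ.pow_eq_one), h r (Or.inr hr)⟩
    · rintro ⟨h1, h2⟩
      exact eqOn_levelSet (τ := 1) (ne_zero_of_residueChar hn) hζ hr h1 h2
  rw [this]
  exact (isOpen_setOf_apply_mem _ _).inter (isOpen_setOf_apply_mem _ _)

theorem levelGroup_mul_le {n m : ℕ} (hn : ¬ residueChar K ∣ n) (hm : ¬ residueChar K ∣ m) :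
    levelGroup K (n * m) ≤ levelGroup K n := by
  intro σ hσ
  obtain ⟨ζ, hζ⟩ := exists_primitiveRoot (K := K) hn
  obtain ⟨r, hr⟩ := exists_pow_eq_sep (not_residueChar_dvd_mul hn hm) (sepUnif K)
  have hr' : (r ^ m) ^ n = sepUnif K := by rw [← pow_mul, mul_comm, hr]
  refine eqOn_levelSet (τ := 1) (ne_zero_of_residueChar hn) hζ hr' ?_ ?_
  · exact hσ _ (Or.inl (by rw [pow_mul, hζ.pow_eq_one, one_pow]))
  · rw [map_pow, hσ r (Or.inr hr)]; rfl

theorem sepRed_div_pow_of_mem_sepInertia {σ : SepGal K} (hσ : σ ∈ sepInertia K) {y : SeparableClosure K}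
    (hy : y ≠ 0) (k : ℕ) : sepRed ((σ ^ k) y / y) = sepRed (σ y / y) ^ k := by
  have hw : ∀ τ : SepGal K, sepVal K (τ y / y) = 1 := fun τ => by
    rw [map_div₀, sepVal_galois, div_self ((sepVal K).ne_zero_iff.2 hy)]
  induction k with
  | zero => simp [hy]
  | succ k ih =>
    have hsy : σ y ≠ 0 := by simpa using hy
    have h1 : (σ ^ (k + 1)) y / y = σ ((σ ^ k) y / y) * (σ y / y) := by
      rw [pow_succ', AlgEquiv.mul_apply, map_div₀]
      field_simp
    rw [h1, sepRed_mul (by rw [sepVal_galois, hw]) (hw σ).le, mem_sepInertia_iff.1 hσ _ (hw _).le, ih,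
      pow_succ]

/-- By Cauchy's theorem a divisor `p` would give an element of order `p`, but all orders divide `m`.
-/
theorem not_dvd_card_inertiaImage {N : Subgroup (SepGal K)} [N.Normal]
    (hN : IsOpen (N : Set (SepGal K))) {m : ℕ} (hm : ¬ residueChar K ∣ m)
    (h : ∀ σ ∈ sepInertia K, σ ^ m ∈ N) : ¬ residueChar K ∣ Nat.card (inertiaImage K N) := by
  intro hd
  have : Finite (SepGal K ⧸ N) := Subgroup.quotient_finite_of_isOpen _ hN
  have := Fact.mk (residueChar_prime (K := K))
  obtain ⟨⟨_, σ, hσ, rfl⟩, hg⟩ := exists_prime_orderOf_dvd_card' (residueChar K) hd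
  refine hm (hg ▸ orderOf_dvd_of_pow_eq_one (Subtype.ext ?_))
  change (QuotientGroup.mk' N σ) ^ m = 1
  rw [← map_pow]
  exact (QuotientGroup.eq_one_iff _).2 (h σ hσ)

/-- On inertia, `σ ↦ sepRed (σ ϖ / ϖ)` is multiplicative on powers and `σ ^ m` fixes `ϖ`, so inertia
acts trivially on the leading coefficient of `ϖ ^ m`. The value of `ϖ ^ m` therefore occurs in `K`.
-/
theorem SubfieldUnif.dvd_of_inertia {N : Subgroup (SepGal K)} [N.Normal]
    (hN : IsOpen (N : Set (SepGal K))) {m : ℕ} (hm : ¬ residueChar K ∣ m)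
    (h : ∀ σ ∈ sepInertia K, σ ^ m ∈ N) {ϖ : SeparableClosure K} {e : ℕ} (hu : SubfieldUnif N ϖ e) :
    e ∣ m := by
  obtain ⟨z, hz, hzv⟩ := exists_val_eq_of_inertia hN (not_dvd_card_inertiaImage hN hm h)
    (y := ϖ ^ m) (pow_ne_zero _ hu.ne_zero) (fun ν hν => by rw [map_pow, hu.fixed ν hν]) (by
      intro σ hσ
      have hw : sepVal K (σ ϖ / ϖ) = 1 := by
        rw [map_div₀, sepVal_galois, div_self hu.val_pos.ne']
      rw [map_pow, ← div_pow, sepRed_pow hw.le, ← sepRed_div_pow_of_mem_sepInertia hσ hu.ne_zero,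
        hu.fixed _ (h σ hσ), div_self hu.ne_zero, sepRed_one])
  rw [map_pow] at hzv
  exact hu.dvd_of_val_eq hz hzv

theorem pow_mem_levelGroup {n : ℕ} (hn : ¬ residueChar K ∣ n) {σ : SepGal K} (hσ : σ ∈ sepInertia K) :
    σ ^ n ∈ levelGroup K n := by
  obtain ⟨ζ, hζ⟩ := exists_primitiveRoot (K := K) hn
  obtain ⟨r, hr⟩ := exists_pow_eq_sep hn (sepUnif K)
  have hn0 := ne_zero_of_residueChar hn
  have hr0 := ne_zero_of_pow_eq_sepUnif hn0 hr
  refine eqOn_levelSet (τ := 1) hn0 hζ hr ((sepInertia K).pow_mem hσ n ζ ⟨n, hn, hζ.pow_eq_one⟩) ?_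
  have hη := galois_div_pow_eq_one hr σ
  have hk : ∀ k, (σ ^ k) r = (σ r / r) ^ k * r := by
    intro k
    induction k with
    | zero => simp
    | succ k ih =>
      rw [pow_succ', AlgEquiv.mul_apply, ih, map_mul, map_pow, hσ _ ⟨n, hn, hη⟩, pow_succ]
      field_simp
  rw [hk, hη, one_mul]; rfl

/-- The exponents `i` with `σ r = ζ ^ i r` for some `σ` in inertia form a subgroup of `ℤ` containing
`n`, say generated by `d` with `n = d m`. Inertia fixes `r ^ m`, so its value occurs in `K`. But the
value of `r` is an `n`-th root of that of the uniformizer, so `n ∣ m` and `d = 1`. -/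
theorem exists_inertia_primitive {n : ℕ} (hn : ¬ residueChar K ∣ n) {r : SeparableClosure K}
    (hr : r ^ n = sepUnif K) : ∃ σ ∈ sepInertia K, IsPrimitiveRoot (σ r / r) n := by
  have hn0 := ne_zero_of_residueChar hn
  have : NeZero n := ⟨hn0⟩
  have hr0 := ne_zero_of_pow_eq_sepUnif hn0 hr
  obtain ⟨ζ, hζ⟩ := exists_primitiveRoot (K := K) hn
  have hζ0 : ζ ≠ 0 := hζ.ne_zero hn0
  have hζI : ∀ σ ∈ sepInertia K, σ ζ = ζ := fun σ hσ => hσ ζ ⟨n, hn, hζ.pow_eq_one⟩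
  let Z : AddSubgroup ℤ :=
    { carrier := {i | ∃ σ ∈ sepInertia K, σ r = ζ ^ i * r}
      zero_mem' := ⟨1, one_mem _, by simp⟩
      add_mem' := by
        rintro i j ⟨σ, hσ, h1⟩ ⟨τ, hτ, h2⟩
        refine ⟨σ * τ, mul_mem hσ hτ, ?_⟩
        rw [AlgEquiv.mul_apply, h2, map_mul, map_zpow₀, hζI σ hσ, h1, zpow_add₀ hζ0]; ring
      neg_mem' := by
        rintro i ⟨σ, hσ, h1⟩
        refine ⟨σ⁻¹, inv_mem hσ, ?_⟩
        rw [AlgEquiv.aut_inv, AlgEquiv.symm_apply_eq, map_mul, map_zpow₀, hζI σ hσ, h1, ← mul_assoc,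
          ← zpow_add₀ hζ0]
        simp }
  obtain ⟨d, hd⟩ := Int.subgroup_cyclic Z
  rw [← AddSubgroup.zmultiples_eq_closure] at hd
  have hmem : ∀ k, k ∈ Z ↔ ((d.natAbs : ℕ) : ℤ) ∣ k := by
    intro k
    rw [hd, Int.mem_zmultiples_iff, Int.natAbs_dvd]
  have hnZ : (n : ℤ) ∈ Z := ⟨1, one_mem _, by simp [hζ.pow_eq_one]⟩
  rw [hmem, Int.natCast_dvd_natCast] at hnZ
  obtain ⟨m, hm⟩ := hnZ
  have hm0 : 0 < m := Nat.pos_of_ne_zero fun h => hn0 (by rw [hm, h, mul_zero])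
  obtain ⟨z, hz, hzv⟩ := exists_val_eq_of_inertia (N := levelGroup K n) (levelGroup_isOpen hn)
    (not_dvd_card_inertiaImage (levelGroup_isOpen hn) hn fun σ hσ => pow_mem_levelGroup hn hσ)
    (y := r ^ m) (pow_ne_zero _ hr0) (fun ν hν => by rw [map_pow, hν r (Or.inr hr)]) (by
      intro σ hσ
      obtain ⟨i, -, hi⟩ := hζ.eq_pow_of_pow_eq_one (galois_div_pow_eq_one hr σ)
      have hiZ : (i : ℤ) ∈ Z := ⟨σ, hσ, by rw [zpow_natCast, hi, div_mul_cancel₀ _ hr0]⟩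
      rw [hmem, Int.natCast_dvd_natCast] at hiZ
      obtain ⟨l, hl⟩ := hiZ
      rw [map_pow, ← div_pow, ← hi, ← pow_mul, hl, mul_right_comm, ← hm, pow_mul, hζ.pow_eq_one,
        one_pow, sepRed_one])
  have hrv : 0 < sepVal K r := (sepVal K).pos_iff.2 hr0
  have hr1 : sepVal K r < 1 := by
    by_contra! h
    have := one_le_pow₀ h (n := n)
    rw [← map_pow, hr] at this
    exact this.not_gt sepVal_unif_lt_one
  obtain ⟨k, hk⟩ := exists_sepVal_algebraMap_eq_zpow hz
  rw [hk, ← hr, map_pow, map_pow, ← zpow_natCast, ← zpow_natCast, ← zpow_mul] at hzv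
  have h1 := zpow_right_injective₀ hrv hr1.ne hzv
  have h2 : n ∣ m := Int.natCast_dvd_natCast.1 ⟨k, h1.symm⟩
  have h3 : d.natAbs = 1 := by
    have := Nat.le_of_dvd hm0 h2
    have h4 : d.natAbs * m ≤ 1 * m := by omega
    have h5 := Nat.le_of_mul_le_mul_right h4 hm0
    have h6 : d.natAbs ≠ 0 := fun h => hn0 (by rw [hm, h, zero_mul])
    omega
  obtain ⟨σ, hσ, h⟩ := (hmem 1).2 (by rw [h3]; rfl)
  refine ⟨σ, hσ, ?_⟩
  rw [h, zpow_one, mul_div_cancel_right₀ _ hr0]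
  exact hζ

/-- Lifts to the absolute Galois group of generators of the tame Galois group. -/
structure IsGoodPair (a b : SepGal K) : Prop where
  inertia : a ∈ sepInertia K
  primitive : ∀ n, ¬ residueChar K ∣ n → ∀ r, r ^ n = sepUnif K → IsPrimitiveRoot (a r / r) n
  frob : ∀ ζ ∈ tameRoots K, b ζ = ζ ^ residueCard K

/-- The quotient `r / s` is a root of unity of order prime to `p`, hence fixed by inertia. So the
Kummer character does not depend on the chosen root. -/
theorem div_eq_of_mem_sepInertia {a : SepGal K} (ha : a ∈ sepInertia K) {n : ℕ} (hn : ¬ residueChar K ∣ n)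
    {r s : SeparableClosure K} (hr : r ^ n = sepUnif K) (hs : s ^ n = sepUnif K) :
    a r / r = a s / s := by
  have hn0 := ne_zero_of_residueChar hn
  have hr0 := ne_zero_of_pow_eq_sepUnif hn0 hr
  have hs0 := ne_zero_of_pow_eq_sepUnif hn0 hs
  have h1 := ha (r / s) ⟨n, hn, by rw [div_pow, hr, hs, div_self sepUnif_ne_zero]⟩
  have hs0' : a s ≠ 0 := by simpa using hs0
  rw [map_div₀, div_eq_div_iff hs0' hs0] at h1
  rw [div_eq_div_iff hr0 hs0, h1, mul_comm]

theorem isClosed_sepInertia : IsClosed (sepInertia K : Set (SepGal K)) := by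
  have : (sepInertia K : Set (SepGal K)) = ⋂ ζ ∈ tameRoots K, {σ | σ ζ ∈ ({ζ} : Set _)} := by
    ext σ; simp [mem_sepInertia]
  rw [this]
  exact isClosed_biInter fun ζ _ => isClosed_setOf_apply_mem _ _

variable (K) in
-- Each level provides an inertia element acting by a primitive root of unity. These are closed
-- conditions, and the one at `n m` implies the one at `n`, so compactness gives a single `a`.
theorem exists_isGoodPair : ∃ a b : SepGal K, IsGoodPair a b := by
  obtain ⟨b, hb⟩ := exists_frobenius_lift (K := K)
  obtain ⟨a, ha⟩ := nonempty_iInter_of_dvd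
    (fun n => {τ : SepGal K | τ ∈ sepInertia K ∧ ∀ r, r ^ n = sepUnif K → IsPrimitiveRoot (τ r / r) n})
    (fun n hn => ⟨by
      obtain ⟨r, hr⟩ := exists_pow_eq_sep hn (sepUnif K)
      obtain ⟨σ, hσ, h⟩ := exists_inertia_primitive hn hr
      exact ⟨σ, hσ, fun s hs => by rwa [div_eq_of_mem_sepInertia hσ hn hs hr]⟩, by
      simp only [Set.ofPred_and, Set.ofPred_forall]
      refine isClosed_sepInertia.inter (isClosed_iInter fun r => isClosed_iInter fun _ => ?_)
      exact isClosed_setOf_apply_mem r {y | IsPrimitiveRoot (y / r) n}⟩)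
    (fun n m hn hm τ h => ⟨h.1, fun r hr => by
      obtain ⟨s, hs⟩ := exists_pow_eq_sep (not_residueChar_dvd_mul hn hm) (sepUnif K)
      rw [div_eq_of_mem_sepInertia h.1 hn hr (s := s ^ m) (by rw [← pow_mul, mul_comm, hs]),
        map_pow, ← div_pow]
      exact (h.2 s hs).pow (Nat.pos_of_ne_zero (ne_zero_of_residueChar (not_residueChar_dvd_mul hn hm)))
        (mul_comm n m)⟩)
  exact ⟨a, b, (ha 1 (by rw [Nat.dvd_one]; exact residueChar_prime.one_lt.ne')).1,
    fun n hn => (ha n hn).2, hb⟩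

/-- Every Galois automorphism acts on a root of unity of order prime to `p` by a power of Frobenius. -/
theorem exists_galois_eq_pow (σ : SepGal K) {ζ : SeparableClosure K} (hζ : ζ ∈ tameRoots K) :
    ∃ j : ℕ, σ ζ = ζ ^ residueCard K ^ j := by
  have hFt := Fintype.ofFinite 𝓀[K]
  have hw := sepVal_tameRoots hζ
  obtain ⟨n, hn, hζn⟩ := id hζ
  set y := sepRed ζ with hy
  set q := residueCard K with hq
  have hyn : y ^ n = 1 := by rw [hy, ← sepRed_pow hw.le, hζn, sepRed_one]
  obtain ⟨f, hf0, hf⟩ : ∃ f : ℕ, 0 < f ∧ y ^ q ^ f = y := by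
    have hn0 := ne_zero_of_residueChar hn
    refine ⟨n.totient, Nat.totient_pos.2 (Nat.pos_of_ne_zero hn0), ?_⟩
    have h1 := Nat.ModEq.pow_totient (coprime_residueCard (K := K) hn).symm
    have h2 : y ^ q ^ n.totient = y ^ 1 := pow_eq_pow_of_modEq h1 hyn
    rw [h2, pow_one]
  let φ : SepRes K →+* SepRes K := (FiniteField.frobeniusAlgHom 𝓀[K] (SepRes K)).toRingHom
  have hφ : ∀ z, φ z = z ^ q := fun z => by
    rw [hq, residueCard, Nat.card_eq_fintype_card]; rfl
  -- The product runs over the Frobenius conjugates of `y`, repetitions being harmless. It is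
  -- invariant under the `q`-power map, so its coefficients come from `K`, and `σ` must send `y` to
  -- one of its roots.
  let P : Polynomial (SepRes K) := ∏ j ∈ Finset.range f, (Polynomial.X - Polynomial.C (y ^ q ^ j))
  have hP : P.map φ = P := by
    simp only [P, Polynomial.map_prod, Polynomial.map_sub, Polynomial.map_X, Polynomial.map_C, hφ,
      ← pow_mul, ← pow_succ]
    obtain ⟨g, rfl⟩ := Nat.exists_eq_add_of_le' hf0
    rw [Finset.prod_range_succ, hf, Finset.prod_range_succ', pow_zero, pow_one]
  have hPs : P.map (sepResMap σ) = P := by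
    ext i
    rw [Polynomial.coeff_map]
    obtain ⟨x, hx⟩ := exists_integerRed_eq (y := P.coeff i) (by
      rw [← hφ, ← Polynomial.coeff_map, hP])
    rw [← hx, integerRed_apply, sepResMap_sepRed σ (sepVal_integer _),
      IsScalarTower.algebraMap_apply 𝒪[K] K, σ.commutes]
  have he : ∀ z, P.eval z = ∏ j ∈ Finset.range f, (z - y ^ q ^ j) := by
    intro z; simp [P, Polynomial.eval_prod]
  have h0 : P.eval y = 0 := by
    rw [he]
    exact Finset.prod_eq_zero (Finset.mem_range.2 hf0) (by simp)
  have h1 : P.eval (sepResMap σ y) = 0 := by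
    rw [← hPs, Polynomial.eval_map_apply, h0, map_zero]
  rw [he, Finset.prod_eq_zero_iff] at h1
  obtain ⟨j, -, hj⟩ := h1
  refine ⟨j, tameRoots_ext (galois_tameRoots σ hζ) (pow_tameRoots _ hζ) ?_⟩
  rw [← sepResMap_sepRed σ hw.le, sepRed_pow hw.le, ← hy, sub_eq_zero.1 hj]

namespace IsGoodPair

variable {a b : SepGal K} (h : IsGoodPair a b)

include h

theorem frob_pow (j : ℕ) {ζ : SeparableClosure K} (hζ : ζ ∈ tameRoots K) :
    (b ^ j) ζ = ζ ^ residueCard K ^ j := by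
  induction j with
  | zero => simp
  | succ j ih => rw [pow_succ', AlgEquiv.mul_apply, ih, map_pow, h.frob ζ hζ, ← pow_mul, ← pow_succ']

theorem pow_apply_root {n : ℕ} (hn : ¬ residueChar K ∣ n) {r : SeparableClosure K}
    (hr : r ^ n = sepUnif K) (i : ℕ) : (a ^ i) r = (a r / r) ^ i * r := by
  have hn0 := ne_zero_of_residueChar hn
  have hr0 := ne_zero_of_pow_eq_sepUnif hn0 hr
  induction i with
  | zero => simp
  | succ i ih =>
    rw [pow_succ', AlgEquiv.mul_apply, ih, map_mul, map_pow,
      h.inertia _ ⟨n, hn, galois_div_pow_eq_one hr a⟩, pow_succ]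
    field_simp

/-- At level `n` an automorphism is known from its effect on `ζ` and on `r`. A power of `b` matches
the first, and a power of `a`, which fixes roots of unity, then corrects the second. -/
theorem exists_eqOn_level {n : ℕ} (hn : ¬ residueChar K ∣ n) (σ : SepGal K) :
    ∃ i j : ℕ, (a ^ i * b ^ j)⁻¹ * σ ∈ levelGroup K n ∧ (σ ∈ sepInertia K → (a ^ i)⁻¹ * σ ∈ levelGroup K n) := by
  have hn0 := ne_zero_of_residueChar hn
  have : NeZero n := ⟨hn0⟩
  obtain ⟨ζ, hζ⟩ := exists_primitiveRoot (K := K) hn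
  obtain ⟨r, hr⟩ := exists_pow_eq_sep hn (sepUnif K)
  have hr0 := ne_zero_of_pow_eq_sepUnif hn0 hr
  have hζt : ζ ∈ tameRoots K := ⟨n, hn, hζ.pow_eq_one⟩
  have main : ∀ j : ℕ, σ ζ = (b ^ j) ζ → ∃ i, (a ^ i * b ^ j)⁻¹ * σ ∈ levelGroup K n := by
    intro j hj
    have hb0 : (b ^ j) r ≠ 0 := fun h0 => hr0 ((b ^ j).injective (by rw [h0, map_zero]))
    have hpow : (σ r / (b ^ j) r) ^ n = 1 := by
      rw [div_pow, ← map_pow, ← map_pow, hr, galois_sepUnif, galois_sepUnif, div_self sepUnif_ne_zero]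
    obtain ⟨i, -, hi⟩ := (h.primitive n hn r hr).eq_pow_of_pow_eq_one hpow
    refine ⟨i, ?_⟩
    have hb1 : ((b ^ j) r) ^ n = sepUnif K := by rw [← map_pow, hr, galois_sepUnif]
    have key := eqOn_levelSet (σ := σ) (τ := a ^ i * b ^ j) hn0 hζ hr ?_ ?_
    · intro x hx
      rw [AlgEquiv.mul_apply, key x hx, ← AlgEquiv.mul_apply, inv_mul_cancel, AlgEquiv.one_apply]
    · rw [AlgEquiv.mul_apply, hj, (sepInertia K).pow_mem h.inertia i _ (galois_tameRoots _ hζt)]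
    · rw [AlgEquiv.mul_apply, h.pow_apply_root hn hb1,
        div_eq_of_mem_sepInertia h.inertia hn hb1 hr, hi, div_mul_cancel₀ _ hb0]
  -- For inertia elements `j = 0` is chosen, so that one `i` serves both assertions.
  by_cases hσ : σ ∈ sepInertia K
  · obtain ⟨i, hi⟩ := main 0 (by rw [hσ ζ hζt]; simp)
    exact ⟨i, 0, hi, fun _ => by simpa using hi⟩
  · obtain ⟨j, hj⟩ := exists_galois_eq_pow σ hζt
    obtain ⟨i, hi⟩ := main j (by rw [hj, h.frob_pow j hζt])
    exact ⟨i, j, hi, fun h => absurd h hσ⟩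

theorem conj_mem_level {n : ℕ} (hn : ¬ residueChar K ∣ n) :
    (a ^ residueCard K)⁻¹ * (b * a * b⁻¹) ∈ levelGroup K n := by
  have hn0 := ne_zero_of_residueChar hn
  obtain ⟨ζ, hζ⟩ := exists_primitiveRoot (K := K) hn
  obtain ⟨r, hr⟩ := exists_pow_eq_sep hn (sepUnif K)
  have hr0 := ne_zero_of_pow_eq_sepUnif hn0 hr
  have hζt : ζ ∈ tameRoots K := ⟨n, hn, hζ.pow_eq_one⟩
  have key := eqOn_levelSet (σ := b * a * b⁻¹) (τ := a ^ residueCard K) hn0 hζ hr ?_ ?_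
  · intro x hx
    rw [AlgEquiv.mul_apply, key x hx, ← AlgEquiv.mul_apply, inv_mul_cancel, AlgEquiv.one_apply]
  · rw [AlgEquiv.mul_apply, AlgEquiv.mul_apply, h.inertia _ (galois_tameRoots b⁻¹ hζt),
      ← AlgEquiv.mul_apply, mul_inv_cancel, (sepInertia K).pow_mem h.inertia _ _ hζt]; rfl
  · have hb1 : (b⁻¹ r) ^ n = sepUnif K := by rw [← map_pow, hr, galois_sepUnif]
    have hb0 := ne_zero_of_pow_eq_sepUnif hn0 hb1
    have hη := galois_div_pow_eq_one hr a
    have h1 : a (b⁻¹ r) = (a r / r) * b⁻¹ r := by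
      rw [← div_eq_of_mem_sepInertia h.inertia hn hb1 hr, div_mul_cancel₀ _ hb0]
    rw [AlgEquiv.mul_apply, AlgEquiv.mul_apply, h1, map_mul, h.frob _ ⟨n, hn, hη⟩,
      ← AlgEquiv.mul_apply, mul_inv_cancel, h.pow_apply_root hn hr]; rfl

end IsGoodPair

/-- Otherwise the closed sets `levelGroup n ∩ Vᶜ` would all be nonempty, and by compactness so would
their intersection. -/
theorem exists_levelGroup_subset {V : Set (SepGal K)} (hV : IsOpen V)
    (h : ∀ σ, (∀ n, ¬ residueChar K ∣ n → σ ∈ levelGroup K n) → σ ∈ V) :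
    ∃ n, ¬ residueChar K ∣ n ∧ (levelGroup K n : Set (SepGal K)) ⊆ V := by
  by_contra! hcon
  obtain ⟨τ, hτ⟩ := nonempty_iInter_of_dvd (fun n => (levelGroup K n : Set (SepGal K)) ∩ Vᶜ)
    (fun n hn => ⟨by
      obtain ⟨σ, h1, h2⟩ := Set.not_subset.1 (hcon n hn)
      exact ⟨σ, h1, h2⟩,
      (Subgroup.isClosed_of_isOpen _ (levelGroup_isOpen hn)).inter hV.isClosed_compl⟩)
    (fun n m hn hm => Set.inter_subset_inter_left _ (levelGroup_mul_le hn hm))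
  exact (hτ 1 (by rw [Nat.dvd_one]; exact residueChar_prime.one_lt.ne')).2 (h τ fun n hn => (hτ n hn).1)

theorem mem_sepInertia_of_levels {σ : SepGal K} (h : ∀ n, ¬ residueChar K ∣ n → σ ∈ levelGroup K n) :
    σ ∈ sepInertia K := by
  rintro ζ ⟨n, hn, hζ⟩
  exact h n hn ζ (Or.inl hζ)

theorem mem_of_fixes {N : Subgroup (SepGal K)} (hN : IsClosed (N : Set (SepGal K))) {σ : SepGal K}
    (h : ∀ x, (∀ ν ∈ N, ν x = x) → σ x = x) : σ ∈ N := by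
  have := InfiniteGalois.fixingSubgroup_fixedField (⟨N, hN⟩ : ClosedSubgroup (SepGal K))
  change (IntermediateField.fixedField N).fixingSubgroup = N at this
  rw [← this]
  intro x
  exact h x.1 fun ν hν => x.2 ⟨ν, hν⟩

theorem SubfieldUnif.fixes_of_levels {N : Subgroup (SepGal K)} {ϖ : SeparableClosure K} {e : ℕ}
    (hu : SubfieldUnif N ϖ e) (he : ¬ residueChar K ∣ e) {σ : SepGal K}
    (h : ∀ n, ¬ residueChar K ∣ n → σ ∈ levelGroup K n) {x : SeparableClosure K}
    (hx : ∀ ν ∈ N, ν x = x) : σ x = x := by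
  obtain ⟨r, hr⟩ := exists_pow_eq_sep he (sepUnif K)
  exact hu.fixes_of_tame he hr (mem_sepInertia_of_levels h) (h e he r (Or.inr hr)) hx

end TameLevels

/-! ### Homomorphisms to groups of order prime to `p` and pairs of generators -/

section Pairs

/-- The subgroup of `Q × Γ` generated by `(A, g)` and `(B, h)` is the graph of the homomorphism. By
the relation all its elements are of the form `x ^ i * y ^ j`. So `hc` makes the first projection
injective, and `hQ` makes it surjective. -/
theorem exists_hom_of_pair {Q Γ : Type*} [Group Q] [Finite Q] [Group Γ] [Finite Γ] {q : ℕ} {A B : Q}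
    {g h : Γ} (hQ : Subgroup.closure {A, B} = ⊤) (r1 : B * A * B⁻¹ = A ^ q)
    (r2 : h * g * h⁻¹ = g ^ q) (hc : ∀ i j : ℕ, A ^ i * B ^ j = 1 → g ^ i * h ^ j = 1) :
    ∃ f : Q →* Γ, f A = g ∧ f B = h := by
  let x : Q × Γ := (A, g)
  let y : Q × Γ := (B, h)
  have hr : y * x * y⁻¹ = x ^ q := Prod.ext r1 r2
  have hr1 : ∀ k, y * x ^ k = x ^ (k * q) * y := by
    intro k
    rw [← mul_inv_eq_iff_eq_mul, ← conj_pow, hr, ← pow_mul, mul_comm]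
  have hr2 : ∀ j k, y ^ j * x ^ k = x ^ (k * q ^ j) * y ^ j := by
    intro j
    induction j with
    | zero => simp
    | succ j ih =>
      intro k
      rw [pow_succ, mul_assoc, hr1, ← mul_assoc, ih, mul_assoc, ← pow_succ, mul_assoc k, ← pow_succ']
  let S : Submonoid (Q × Γ) :=
    { carrier := {z | ∃ i j : ℕ, z = x ^ i * y ^ j}
      one_mem' := ⟨0, 0, by simp⟩
      mul_mem' := by
        rintro _ _ ⟨i, j, rfl⟩ ⟨k, l, rfl⟩
        refine ⟨i + k * q ^ j, j + l, ?_⟩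
        rw [pow_add, pow_add, mul_assoc, ← mul_assoc (y ^ j), hr2]
        simp only [mul_assoc] }
  let Z : Subgroup (Q × Γ) :=
    { S with
      inv_mem' := by
        intro z hz
        have h1 : z⁻¹ = z ^ (orderOf z - 1) := by
          rw [inv_eq_iff_mul_eq_one, ← pow_succ', Nat.sub_add_cancel (orderOf_pos z), pow_orderOf_eq_one]
        rw [h1]
        exact S.pow_mem hz _ }
  have hx : x ∈ Z := ⟨1, 0, by simp⟩
  have hy : y ∈ Z := ⟨0, 1, by simp⟩
  let π₁ : Z →* Q := (MonoidHom.fst Q Γ).comp Z.subtype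
  have hinj : Function.Injective π₁ := by
    rw [injective_iff_map_eq_one]
    rintro ⟨z, i, j, rfl⟩ hz
    have h1 : A ^ i * B ^ j = 1 := hz
    exact Subtype.ext (Prod.ext h1 (hc i j h1))
  have hsurj : Function.Surjective π₁ := by
    rw [← MonoidHom.range_eq_top, eq_top_iff, ← hQ, Subgroup.closure_le]
    rintro _ (rfl | rfl)
    · exact ⟨⟨x, hx⟩, rfl⟩
    · exact ⟨⟨y, hy⟩, rfl⟩
  let e := MulEquiv.ofBijective π₁ ⟨hinj, hsurj⟩
  have he : ∀ z : Z, ((MonoidHom.snd Q Γ).comp (Z.subtype.comp e.symm.toMonoidHom)) (π₁ z) = z.1.2 := by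
    intro z
    have : e.symm (π₁ z) = z := e.symm_apply_apply z
    change (e.symm (π₁ z)).1.2 = _
    rw [this]
  exact ⟨(MonoidHom.snd Q Γ).comp (Z.subtype.comp e.symm.toMonoidHom), he ⟨x, hx⟩, he ⟨y, hy⟩⟩

variable {K : Type*} [Field K] [ValuativeRel K] [TopologicalSpace K]
  [IsNonarchimedeanLocalField K] {Γ : Type*} [Group Γ] [TopologicalSpace Γ] [DiscreteTopology Γ]

/-- The kernel of a homomorphism from the absolute Galois group. -/
noncomputable def galKer (ρ : GalHom K Γ) : Subgroup (SepGal K) := ρ.toMonoidHom.ker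

theorem mem_galKer {ρ : GalHom K Γ} {σ : SepGal K} : σ ∈ galKer ρ ↔ ρ σ = 1 := Iff.rfl

instance (ρ : GalHom K Γ) : (galKer ρ).Normal := inferInstanceAs ρ.toMonoidHom.ker.Normal

theorem galKer_isOpen (ρ : GalHom K Γ) : IsOpen (galKer ρ : Set (SepGal K)) :=
  (isOpen_discrete {(1 : Γ)}).preimage ρ.continuous_toFun

theorem not_residueChar_dvd_of_dvd {n m : ℕ} (h : n ∣ m) (hm : ¬ residueChar K ∣ m) :
    ¬ residueChar K ∣ n := fun hn => hm (hn.trans h)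

variable [Finite Γ] (hp : ¬ residueChar K ∣ Nat.card Γ)

include hp

theorem not_residueChar_dvd_ramification (ρ : GalHom K Γ) {ϖ : SeparableClosure K} {e : ℕ}
    (hu : SubfieldUnif (galKer ρ) ϖ e) : ¬ residueChar K ∣ e := by
  refine not_residueChar_dvd_of_dvd (hu.dvd_of_inertia (galKer_isOpen ρ) hp fun σ _ => ?_) hp
  rw [mem_galKer, map_pow, pow_card_eq_one']

/-- All `#Γ`-th powers of inertia elements lie in `ker ρ`, so the fixed field of `ker ρ` has
ramification index prime to `p`. An automorphism trivial at every level fixes this field. -/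
theorem galHom_eq_one_of_levels (ρ : GalHom K Γ) {σ : SepGal K}
    (h : ∀ n, ¬ residueChar K ∣ n → σ ∈ levelGroup K n) : ρ σ = 1 := by
  obtain ⟨ϖ, e, hu⟩ := exists_subfieldUnif _ (galKer_isOpen ρ)
  exact mem_of_fixes (Subgroup.isClosed_of_isOpen _ (galKer_isOpen ρ)) fun x hx =>
    hu.fixes_of_levels (not_residueChar_dvd_ramification hp ρ hu) h hx

theorem exists_levelGroup_le_galKer (ρ : GalHom K Γ) :
    ∃ n, ¬ residueChar K ∣ n ∧ levelGroup K n ≤ galKer ρ :=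
  exists_levelGroup_subset (galKer_isOpen ρ) fun _ h => galHom_eq_one_of_levels hp ρ h

namespace IsGoodPair

variable {a b : SepGal K} (h : IsGoodPair a b)

include h

theorem exists_galHom_eq (ρ : GalHom K Γ) (σ : SepGal K) : ∃ i j : ℕ, ρ σ = ρ a ^ i * ρ b ^ j ∧
    (σ ∈ sepInertia K → ρ σ = ρ a ^ i) := by
  obtain ⟨n, hn, hl⟩ := exists_levelGroup_le_galKer hp ρ
  obtain ⟨i, j, h1, h2⟩ := h.exists_eqOn_level hn σ
  refine ⟨i, j, ?_, fun hσ => ?_⟩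
  · have := mem_galKer.1 (hl h1)
    rw [map_mul, map_inv, inv_mul_eq_one] at this
    rw [← this, map_mul, map_pow, map_pow]
  · have := mem_galKer.1 (hl (h2 hσ))
    rw [map_mul, map_inv, inv_mul_eq_one] at this
    rw [← this, map_pow]

theorem galHom_ext {ρ ρ' : GalHom K Γ} (h1 : ρ a = ρ' a) (h2 : ρ b = ρ' b) : ρ = ρ' := by
  ext σ
  obtain ⟨n, hn, hl⟩ := exists_levelGroup_le_galKer hp ρ
  obtain ⟨m, hm, hl'⟩ := exists_levelGroup_le_galKer hp ρ'
  have hl1 := (levelGroup_mul_le hn hm).trans hl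
  have hl2 := (levelGroup_mul_le hm hn).trans hl'
  rw [mul_comm] at hl2
  obtain ⟨i, j, h3, -⟩ := h.exists_eqOn_level (not_residueChar_dvd_mul hn hm) σ
  have e1 := mem_galKer.1 (hl1 h3)
  have e2 := mem_galKer.1 (hl2 h3)
  rw [map_mul, map_inv, inv_mul_eq_one] at e1 e2
  rw [← e1, ← e2, map_mul, map_pow, map_pow, map_mul, map_pow, map_pow, h1, h2]

theorem galHom_rel (ρ : GalHom K Γ) : ρ b * ρ a * (ρ b)⁻¹ = ρ a ^ residueCard K := by
  obtain ⟨n, hn, hl⟩ := exists_levelGroup_le_galKer hp ρ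
  have := mem_galKer.1 (hl (h.conj_mem_level hn))
  rw [map_mul, map_inv, inv_mul_eq_one] at this
  rw [← map_pow, this, map_mul, map_mul, map_inv]

theorem exists_galHom {g k : Γ} (hgk : k * g * k⁻¹ = g ^ residueCard K) :
    ∃ ρ : GalHom K Γ, ρ a = g ∧ ρ b = k := by
  set q := residueCard K with hq
  have hq2 : 2 ≤ q := residueCard_two_le
  set n := orderOf g with hn
  have hnp : ¬ residueChar K ∣ n := not_residueChar_dvd_of_dvd (orderOf_dvd_natCard g) hp
  have hn0 : 0 < n := orderOf_pos g
  set m := n.totient with hm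
  have hm0 : 0 < m := Nat.totient_pos.2 hn0
  have hnm : n ∣ q ^ m - 1 :=
    (Nat.modEq_iff_dvd' (Nat.one_le_pow _ _ (by omega))).1
      (Nat.ModEq.pow_totient (coprime_residueCard hnp).symm).symm
  set M := n * orderOf k with hM
  have hM0 : 0 < M := Nat.mul_pos hn0 (orderOf_pos k)
  set D := m * M with hD
  have hD0 : D ≠ 0 := (Nat.mul_pos hm0 hM0).ne'
  have hLp := not_residueChar_dvd_sub_one (K := K) hD0
  -- With `l = q ^ D - 1`, the element `b` acts on the `l`-th roots of unity with order exactly `D`.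
  -- The factors of `D` are the order of `k` and `m n`, where `b ^ (m n)` fixes the chosen `n`-th
  -- root of the uniformizer.
  set l := q ^ D - 1 with hl
  have hnl : n ∣ l := hnm.trans (by
    rw [hl, hD, pow_mul]; simpa using Nat.sub_dvd_pow_sub_pow (q ^ m) 1 M)
  obtain ⟨c, hc⟩ := hnl
  have hcp : ¬ residueChar K ∣ c := not_residueChar_dvd_of_dvd ⟨n, by rw [hc, mul_comm]⟩ hLp
  have hle : levelGroup K l ≤ levelGroup K n := by rw [hc]; exact levelGroup_mul_le hnp hcp
  obtain ⟨ζ, hζ⟩ := exists_primitiveRoot (K := K) hLp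
  obtain ⟨r, hr⟩ := exists_pow_eq_sep hnp (sepUnif K)
  have hr0 := ne_zero_of_pow_eq_sepUnif hn0.ne' hr
  have hopen := levelGroup_isOpen (K := K) hLp
  have : Finite (SepGal K ⧸ levelGroup K l) := Subgroup.quotient_finite_of_isOpen _ hopen
  -- Since `q ^ m ≡ 1` modulo `n`, the power `b ^ m` fixes the `n`-th roots of unity, so its effect
  -- on `r` is multiplicative in `t`.
  have hbm : ∀ t, ((b ^ m) ^ t) r = ((b ^ m) r / r) ^ t * r := by
    intro t
    have hη := galois_div_pow_eq_one hr (b ^ m)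
    have hfix : (b ^ m) ((b ^ m) r / r) = (b ^ m) r / r := by
      rw [h.frob_pow m ⟨n, hnp, hη⟩]
      have h1 := Nat.ModEq.pow_totient (coprime_residueCard (K := K) hnp).symm
      have := pow_eq_pow_of_modEq h1 hη
      rw [pow_one] at this
      exact this
    induction t with
    | zero => simp
    | succ t ih =>
      rw [pow_succ', AlgEquiv.mul_apply, ih, map_mul, map_pow, hfix, pow_succ, mul_assoc,
        div_mul_cancel₀ _ hr0]
  let mk := QuotientGroup.mk' (levelGroup K l)
  obtain ⟨f, hfa, hfb⟩ := exists_hom_of_pair (A := mk a) (B := mk b) (g := g) (h := k) (q := q)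
    (by
      rw [eq_top_iff]
      intro s _
      obtain ⟨σ, rfl⟩ := QuotientGroup.mk'_surjective _ s
      obtain ⟨i, j, h1, -⟩ := h.exists_eqOn_level hLp σ
      have h2 : mk σ = mk a ^ i * mk b ^ j := by
        rw [← map_pow, ← map_pow, ← map_mul]
        exact (QuotientGroup.eq.2 h1).symm
      rw [h2]
      exact mul_mem (pow_mem (Subgroup.subset_closure (by simp)) _)
        (pow_mem (Subgroup.subset_closure (by simp)) _))
    (by
      rw [← map_inv, ← map_mul, ← map_mul, ← map_pow]
      exact (QuotientGroup.eq.2 (h.conj_mem_level hLp)).symm)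
    hgk
    (by
      intro i j hij
      rw [← map_pow, ← map_pow, ← map_mul] at hij
      have hmem : a ^ i * b ^ j ∈ levelGroup K l := (QuotientGroup.eq_one_iff _).1 hij
      have hζt : ζ ∈ tameRoots K := ⟨l, hLp, hζ.pow_eq_one⟩
      have h1 := hmem ζ (Or.inl hζ.pow_eq_one)
      rw [AlgEquiv.mul_apply, (sepInertia K).pow_mem h.inertia i _ (galois_tameRoots _ hζt),
        h.frob_pow j hζt] at h1
      have h2 : l ∣ q ^ j - 1 := by
        refine hζ.dvd_of_pow_eq_one _ ?_
        refine mul_left_cancel₀ (hζ.ne_zero (ne_zero_of_residueChar hLp)) ?_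
        rw [← pow_succ', Nat.sub_add_cancel (Nat.one_le_pow _ _ (by omega)), h1, mul_one]
      have h3 : D ∣ j := by
        have h4 := Nat.pow_sub_one_gcd_pow_sub_one q D j
        rw [← hl, Nat.gcd_eq_left h2, hl] at h4
        have h5 : q ^ D = q ^ D.gcd j := by
          have := Nat.one_le_pow D q (by omega)
          have := Nat.one_le_pow (D.gcd j) q (by omega)
          omega
        have h6 := Nat.pow_right_injective hq2 h5
        exact h6 ▸ Nat.gcd_dvd_right D j
      obtain ⟨t, rfl⟩ := h3
      have hk : k ^ (D * t) = 1 := by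
        rw [hD, hM, show m * (n * orderOf k) * t = orderOf k * (m * n * t) by ring, pow_mul,
          pow_orderOf_eq_one, one_pow]
      have hbr : (b ^ (D * t)) r = r := by
        rw [hD, hM, show m * (n * orderOf k) * t = m * (n * (orderOf k * t)) by ring, pow_mul, hbm,
          pow_mul, galois_div_pow_eq_one hr, one_pow, one_mul]
      have har := hle hmem r (Or.inr hr)
      rw [AlgEquiv.mul_apply, hbr, h.pow_apply_root hnp hr] at har
      have h7 : (a r / r) ^ i = 1 := mul_right_cancel₀ hr0 (by rw [har, one_mul])
      have h8 := (h.primitive n hnp r hr).dvd_of_pow_eq_one i h7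
      rw [hk, mul_one]
      exact orderOf_dvd_iff_pow_eq_one.1 h8)
  have : DiscreteTopology (SepGal K ⧸ levelGroup K l) := QuotientGroup.discreteTopology hopen
  refine ⟨⟨f.comp mk, ?_⟩, hfa, hfb⟩
  exact (continuous_of_discreteTopology (f := f)).comp QuotientGroup.continuous_mk

end IsGoodPair

theorem finite_galHom : Finite (GalHom K Γ) := by
  obtain ⟨a, b, h⟩ := exists_isGoodPair K
  exact Finite.of_injective (fun ρ : GalHom K Γ => (ρ a, ρ b)) fun ρ ρ' he =>
    h.galHom_ext hp (congrArg Prod.fst he) (congrArg Prod.snd he)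

end Pairs

/-! ### Lengths of quotients by principal ideals -/

section PrincipalLength

variable (A : Type*) {S : Type*} [CommRing A] [CommRing S] [Algebra A S]

/-- Lengths are added along `0 → S/(y) → S/(x y) → S/(x) → 0`, the first map being multiplication by
the regular element `x`. -/
theorem length_quotient_span_mul {x : S} (hx : x ∈ nonZeroDivisors S) (y : S) :
    Module.length A (S ⧸ Ideal.span {x * y}) =
      Module.length A (S ⧸ Ideal.span {y}) + Module.length A (S ⧸ Ideal.span {x}) := by
  have h1 : Ideal.span {y} ≤ Submodule.comap (LinearMap.mulLeft S x) (Ideal.span {x * y}) := by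
    rw [Ideal.span_le, Set.singleton_subset_iff]
    exact Ideal.subset_span rfl
  let f : (S ⧸ Ideal.span {y}) →ₗ[S] (S ⧸ Ideal.span {x * y}) :=
    Submodule.mapQ _ _ (LinearMap.mulLeft S x) h1
  have h2 : Ideal.span {x * y} ≤ Ideal.span {x} := by
    rw [Ideal.span_le, Set.singleton_subset_iff]
    exact Ideal.mul_mem_right _ _ (Ideal.subset_span rfl)
  let g : (S ⧸ Ideal.span {x * y}) →ₗ[S] (S ⧸ Ideal.span {x}) := Submodule.factor h2
  refine Module.length_eq_add_of_exact (f.restrictScalars A) (g.restrictScalars A) ?_ ?_ ?_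
  · rw [LinearMap.coe_restrictScalars, ← LinearMap.ker_eq_bot, LinearMap.ker_eq_bot']
    intro m hm
    obtain ⟨s, rfl⟩ := Submodule.Quotient.mk_surjective _ m
    have h3 : x * s ∈ Ideal.span {x * y} := (Submodule.Quotient.mk_eq_zero _).1 hm
    obtain ⟨c, hc⟩ := Ideal.mem_span_singleton'.1 h3
    refine (Submodule.Quotient.mk_eq_zero _).2 (Ideal.mem_span_singleton'.2 ⟨c, ?_⟩)
    have : x * (c * y) = x * s := by rw [← hc]; ring
    exact (mul_cancel_left_mem_nonZeroDivisors hx).1 this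
  · exact Submodule.factor_surjective h2
  · intro m
    obtain ⟨s, rfl⟩ := Submodule.Quotient.mk_surjective _ m
    constructor
    · intro h
      have h3 : s ∈ Ideal.span {x} := (Submodule.Quotient.mk_eq_zero _).1 h
      obtain ⟨c, hc⟩ := Ideal.mem_span_singleton'.1 h3
      refine ⟨Submodule.Quotient.mk c, ?_⟩
      rw [← hc, mul_comm c x]
      rfl
    · rintro ⟨m', h⟩
      obtain ⟨c, rfl⟩ := Submodule.Quotient.mk_surjective _ m'
      rw [← h]
      exact (Submodule.Quotient.mk_eq_zero _).2 (Ideal.mul_mem_right _ _ (Ideal.subset_span rfl))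

theorem length_quotient_span_pow {x : S} (hx : x ∈ nonZeroDivisors S) (n : ℕ) :
    Module.length A (S ⧸ Ideal.span {x ^ n}) = n * Module.length A (S ⧸ Ideal.span {x}) := by
  induction n with
  | zero =>
    rw [pow_zero, Ideal.span_singleton_one, Nat.cast_zero, zero_mul, Module.length_eq_zero_iff]
    exact Ideal.Quotient.subsingleton_iff.2 rfl
  | succ n ih => rw [pow_succ', length_quotient_span_mul A hx, ih]; push_cast; ring

/-- The ramification index is the length of the local ring at `P` modulo the extended ideal. That
ideal is generated by `t ^ e`, and `t` generates the maximal ideal. -/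
theorem ramificationIdx_eq_of_principal {R B : Type*} [CommRing R] [CommRing B] [IsDomain B]
    [Algebra R B] {P : Ideal B} [P.IsMaximal] {t : B} (hP : P = Ideal.span {t}) (ht : t ≠ 0) {x : R}
    (hx : P.under R = Ideal.span {x}) {u : Bˣ} {e : ℕ} (h : algebraMap R B x = t ^ e * u) :
    P.ramificationIdx R = e := by
  rw [Ideal.ramificationIdx_def]
  set Sq := Localization.AtPrime P
  have h1 : (P.under R).map (algebraMap R Sq) = Ideal.span {algebraMap B Sq t ^ e} := by
    rw [hx, Ideal.map_span, Set.image_singleton, IsScalarTower.algebraMap_apply R B Sq,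
      h, map_mul, map_pow]
    exact Ideal.span_singleton_mul_right_unit (u.isUnit.map _) _
  have ht0 : algebraMap B Sq t ≠ 0 := by
    rw [Ne, IsLocalization.to_map_eq_zero_iff Sq (Ideal.primeCompl_le_nonZeroDivisors P)]
    exact ht
  have h2 : Ideal.span {algebraMap B Sq t} = IsLocalRing.maximalIdeal Sq := by
    rw [← Localization.AtPrime.map_eq_maximalIdeal (I := P)]
    have h3 := congrArg (Ideal.map (algebraMap B Sq)) hP
    rw [Ideal.map_span, Set.image_singleton] at h3
    exact h3.symm
  have h3 : Module.length Sq (Sq ⧸ Ideal.span {algebraMap B Sq t}) = 1 := by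
    rw [Module.length_eq_one_iff, isSimpleModule_iff_isCoatom, h2, ← Ideal.isMaximal_def]
    infer_instance
  rw [h1, length_quotient_span_pow Sq (mem_nonZeroDivisors_of_ne_zero ht0), h3, mul_one]
  rfl

end PrincipalLength

/-! ### The maximal tamely ramified extension -/

section TameClosure

variable {K : Type*} [Field K] [ValuativeRel K] [TopologicalSpace K]
  [IsNonarchimedeanLocalField K]

theorem isIntegral_coe_iff {L : IntermediateField K (SeparableClosure K)} {x : L} :
    IsIntegral 𝒪[K] x ↔ sepVal K (x : SeparableClosure K) ≤ 1 := by
  rw [sepVal_le_one_iff]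
  exact (isIntegral_algHom_iff (L.val.restrictScalars 𝒪[K]) Subtype.val_injective).symm

/-- An integer of value `1` has an integral inverse, so the integer ring of `L` is local and its
maximal ideal is cut out by the valuation. -/
theorem mem_maximal_iff {L : IntermediateField K (SeparableClosure K)}
    {P : Ideal (integralClosure 𝒪[K] L)} (hP : P.IsMaximal) (x : integralClosure 𝒪[K] L) :
    x ∈ P ↔ sepVal K ((x : L) : SeparableClosure K) < 1 := by
  have hunit : ∀ y : integralClosure 𝒪[K] L, sepVal K ((y : L) : SeparableClosure K) = 1 → y ∉ P := by
    intro y hy hyP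
    have hy0 : (y : L) ≠ 0 := by
      intro h
      rw [h] at hy; simp at hy
    have hi : IsIntegral 𝒪[K] (y : L)⁻¹ := by
      rw [isIntegral_coe_iff]
      simp [hy]
    refine hP.ne_top (P.eq_top_of_isUnit_mem hyP (IsUnit.of_mul_eq_one ⟨_, hi⟩ (Subtype.ext ?_)))
    exact mul_inv_cancel₀ hy0
  have hle : ∀ y : integralClosure 𝒪[K] L, sepVal K ((y : L) : SeparableClosure K) ≤ 1 := fun y =>
    isIntegral_coe_iff.1 y.2
  constructor
  · intro hx
    exact lt_of_le_of_ne (hle x) fun h => hunit x h hx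
  · intro hx
    by_contra hxP
    obtain ⟨y, hy⟩ := Ideal.IsMaximal.exists_inv hP hxP
    obtain ⟨z, hz, hyz⟩ := hy
    refine hunit z ?_ hz
    have h1 : ((z : L) : SeparableClosure K) = 1 - ((y : L) : SeparableClosure K) * ((x : L) : SeparableClosure K) := by
      rw [eq_sub_iff_add_eq, add_comm]
      exact congrArg (fun t : integralClosure 𝒪[K] L => ((t : L) : SeparableClosure K)) hyz
    rw [h1]
    have h2 : sepVal K (((y : L) : SeparableClosure K) * ((x : L) : SeparableClosure K)) < 1 := by
      rw [map_mul]
      exact mul_lt_one_of_nonneg_of_lt_one_right (hle y) zero_le hx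
    rw [Valuation.map_sub_eq_of_lt_left _ (by rwa [map_one]), map_one]

theorem ramificationIdx_eq {L : IntermediateField K (SeparableClosure K)}
    {P : Ideal (integralClosure 𝒪[K] L)} (hP : P.IsMaximal) {ϖ : SeparableClosure K} {e : ℕ}
    (hu : SubfieldUnif L.fixingSubgroup ϖ e) : Ideal.ramificationIdx P 𝒪[K] = e := by
  have hprime := hP.isPrime
  have hfix : ∀ x : L, ∀ ν ∈ L.fixingSubgroup, ν (x : SeparableClosure K) = x := fun x ν hν => hν x
  have hϖL : ϖ ∈ L := by
    rw [← InfiniteGalois.fixedField_fixingSubgroup L]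
    exact fun ν => hu.fixed ν.1 ν.2
  let w : integralClosure 𝒪[K] L → SeparableClosure K := fun x => ((x : L) : SeparableClosure K)
  have mkI : ∀ x : L, sepVal K (x : SeparableClosure K) ≤ 1 → IsIntegral 𝒪[K] x := fun x hx =>
    isIntegral_coe_iff.2 hx
  let t : integralClosure 𝒪[K] L := ⟨⟨ϖ, hϖL⟩, mkI _ hu.lt_one.le⟩
  have hPt : P = Ideal.span {t} := by
    ext x
    rw [mem_maximal_iff hP, Ideal.mem_span_singleton']
    constructor
    · intro hx
      have h1 := hu.le_of_lt (i := 0) (hfix x) (by simpa using hx)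
      rw [zero_add, zpow_one] at h1
      refine ⟨⟨(x : L) / ⟨ϖ, hϖL⟩, mkI _ ?_⟩, Subtype.ext (div_mul_cancel₀ _ fun h => hu.ne_zero (congrArg Subtype.val h))⟩
      change sepVal K (((x : L) : SeparableClosure K) / ϖ) ≤ 1
      rw [map_div₀]
      exact div_le_one_of_le₀ h1 zero_le
    · rintro ⟨c, rfl⟩
      change sepVal K (((c : L) : SeparableClosure K) * ϖ) < 1
      rw [map_mul]
      exact mul_lt_one_of_nonneg_of_lt_one_right (isIntegral_coe_iff.1 c.2) zero_le hu.lt_one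
  have hunder : P.under 𝒪[K] = Ideal.span {unif K} := by
    rw [← unif_irreducible.maximalIdeal_eq]
    ext x
    rw [Ideal.mem_comap, mem_maximal_iff hP, ← sepVal_integer_lt_one_iff]
    rfl
  have hπ : ∃ u : (integralClosure 𝒪[K] L)ˣ, algebraMap 𝒪[K] _ (unif K) = t ^ e * u := by
    have hv : sepVal K (sepUnif K / ϖ ^ e) = 1 := by
      rw [map_div₀, map_pow, hu.pow_eq, div_self sepVal_unif_pos.ne']
    let r : L := algebraMap K L (unif K : K) / ⟨ϖ, hϖL⟩ ^ e
    have hr : (r : SeparableClosure K) = sepUnif K / ϖ ^ e := rfl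
    have hr0 : r ≠ 0 := by
      intro h
      rw [← hr, h] at hv; simp at hv
    refine ⟨⟨⟨r, mkI _ (by rw [hr, hv])⟩, ⟨r⁻¹, mkI _ (by
      change sepVal K (r : SeparableClosure K)⁻¹ ≤ 1
      rw [hr, map_inv₀, hv, inv_one])⟩, Subtype.ext (mul_inv_cancel₀ hr0),
      Subtype.ext (inv_mul_cancel₀ hr0)⟩, ?_⟩
    apply Subtype.ext
    change algebraMap K L (unif K : K) = ⟨ϖ, hϖL⟩ ^ e * r
    rw [mul_div_cancel₀ _ (pow_ne_zero _ fun h => hu.ne_zero (congrArg Subtype.val h))]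
  obtain ⟨u, hu'⟩ := hπ
  exact ramificationIdx_eq_of_principal hPt (fun h => hu.ne_zero (congrArg w h)) hunder hu'

/-- The fixed field of the level group contains `x`, and its ramification index divides `n`, because
`n`-th powers of inertia elements lie in the level group. -/
theorem mem_tameClosure_of_mem_levelSet {n : ℕ} (hn : ¬ residueChar K ∣ n) {x : SeparableClosure K}
    (hx : x ∈ levelSet K n) : x ∈ tameClosure K := by
  have hopen := levelGroup_isOpen (K := K) hn
  have hcl := Subgroup.isClosed_of_isOpen _ hopen
  set T := IntermediateField.fixedField (levelGroup K n) with hT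
  have hfix : T.fixingSubgroup = levelGroup K n :=
    InfiniteGalois.fixingSubgroup_fixedField (⟨levelGroup K n, hcl⟩ : ClosedSubgroup (SepGal K))
  have hfin : FiniteDimensional K T :=
    (InfiniteGalois.isOpen_iff_finite T).1 (by rw [hfix]; exact hopen)
  have hxT : x ∈ T := fun ν => ν.2 x hx
  refine (le_sSup (a := T) ⟨hfin, fun P hP => ?_⟩ : T ≤ tameClosure K) hxT
  obtain ⟨ϖ, e, hu⟩ := exists_subfieldUnif (levelGroup K n) hopen
  have he := hu.dvd_of_inertia hopen hn fun σ hσ => pow_mem_levelGroup hn hσ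
  rw [← hfix] at hu
  rw [ramificationIdx_eq hP hu]
  exact not_residueChar_dvd_of_dvd he hn

theorem mem_tameClosure_of_mem_tameRoots {x : SeparableClosure K} (hx : x ∈ tameRoots K) :
    x ∈ tameClosure K := by
  obtain ⟨n, hn, h⟩ := hx
  exact mem_tameClosure_of_mem_levelSet hn (Or.inl h)

theorem fixes_tameClosure_iff {σ : SepGal K} :
    σ ∈ (tameClosure K).fixingSubgroup ↔ ∀ n, ¬ residueChar K ∣ n → σ ∈ levelGroup K n := by
  constructor
  · intro h n hn x hx
    exact h ⟨x, mem_tameClosure_of_mem_levelSet hn hx⟩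
  · intro h
    -- It suffices to treat each finite tame `L`. Its ramification index is prime to `p`, so an
    -- automorphism trivial at every level fixes it.
    have : tameClosure K ≤ IntermediateField.fixedField (Subgroup.zpowers σ) := by
      refine sSup_le ?_
      rintro L ⟨hfin, hL⟩ x hx
      have hopen : IsOpen (L.fixingSubgroup : Set (SepGal K)) := IntermediateField.fixingSubgroup_isOpen L
      obtain ⟨ϖ, e, hu⟩ := exists_subfieldUnif _ hopen
      obtain ⟨P, hP⟩ := Ideal.exists_maximal (integralClosure 𝒪[K] L)
      have he := hL P hP
      rw [ramificationIdx_eq hP hu] at he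
      have hσx : σ x = x := hu.fixes_of_levels he h fun ν hν => hν ⟨x, hx⟩
      have hle : Subgroup.zpowers σ ≤ MulAction.stabilizer (SepGal K) x := by
        rw [Subgroup.zpowers_le]; exact hσx
      exact fun ν => hle ν.2
    intro x
    exact this x.2 ⟨σ, Subgroup.mem_zpowers σ⟩

instance : IsGalois K (tameClosure K) := by
  rw [← InfiniteGalois.normal_iff_isGalois]
  constructor
  intro ν hν σ
  rw [fixes_tameClosure_iff] at hν ⊢
  exact fun n hn => (levelGroup_normal n).conj_mem ν (hν n hn) σ

theorem isOpen_setOf_tame_apply_mem (x : tameClosure K) (S : Set (tameClosure K)) :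
    IsOpen {τ : tameClosure K ≃ₐ[K] tameClosure K | τ x ∈ S} := by
  rw [isOpen_iff_mem_nhds]
  intro τ hτ
  have : FiniteDimensional K (IntermediateField.adjoin K {x}) :=
    IntermediateField.adjoin.finiteDimensional (Algebra.IsIntegral.isIntegral x)
  have h := ((IntermediateField.fixingSubgroup_isOpen (IntermediateField.adjoin K {x})).leftCoset τ)
  refine Filter.mem_of_superset (h.mem_nhds ⟨1, one_mem _, mul_one τ⟩) ?_
  rintro _ ⟨σ, hσ, rfl⟩
  have hσx : σ x = x := hσ ⟨x, IntermediateField.mem_adjoin_simple_self K x⟩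
  change (τ • σ) x ∈ S
  rw [smul_eq_mul, AlgEquiv.mul_apply, hσx]
  exact hτ

variable (K) in
/-- Restriction of automorphisms to the tame closure. -/
noncomputable def tameRes : SepGal K →* (tameClosure K ≃ₐ[K] tameClosure K) :=
  AlgEquiv.restrictNormalHom (tameClosure K)

theorem tameRes_apply (σ : SepGal K) (x : tameClosure K) :
    (tameRes K σ x : SeparableClosure K) = σ x :=
  AlgEquiv.restrictNormal_commutes σ (tameClosure K) x

theorem tameRes_surjective : Function.Surjective (tameRes K) :=
  AlgEquiv.restrictNormalHom_surjective _

theorem continuous_tameRes : Continuous (tameRes K) :=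
  InfiniteGalois.restrictNormalHom_continuous _

theorem tameRes_liftNormal (a : tameClosure K ≃ₐ[K] tameClosure K) :
    tameRes K (a.liftNormal (SeparableClosure K)) = a := by
  refine AlgEquiv.ext fun x => Subtype.ext ?_
  rw [tameRes_apply]
  exact a.liftNormal_commutes (SeparableClosure K) x

theorem tameRes_eq_iff {σ τ : SepGal K} :
    tameRes K σ = tameRes K τ ↔ ∀ n, ¬ residueChar K ∣ n → τ⁻¹ * σ ∈ levelGroup K n := by
  rw [← fixes_tameClosure_iff]
  constructor
  · intro h x
    have h1 := congrArg (fun f : tameClosure K ≃ₐ[K] tameClosure K => (f x : SeparableClosure K)) h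
    simp only [tameRes_apply] at h1
    change τ⁻¹ (σ x) = x
    rw [h1, ← AlgEquiv.mul_apply, inv_mul_cancel]; rfl
  · intro h
    refine AlgEquiv.ext fun x => Subtype.ext ?_
    rw [tameRes_apply, tameRes_apply]
    have h1 : τ⁻¹ (σ (x : SeparableClosure K)) = x := h x
    rw [AlgEquiv.aut_inv, AlgEquiv.symm_apply_eq] at h1
    exact h1

theorem tameRes_mem_inertiaSubgroup {σ : SepGal K} :
    tameRes K σ ∈ inertiaSubgroup K (tameClosure K) ↔ σ ∈ sepInertia K := by
  have hcoe : ∀ x : integralClosure 𝒪[K] (tameClosure K),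
      (((tameRes K σ • x - x : integralClosure 𝒪[K] (tameClosure K)) : tameClosure K) : SeparableClosure K) =
        σ ((x : tameClosure K) : SeparableClosure K) - ((x : tameClosure K) : SeparableClosure K) := by
    intro x
    rw [← tameRes_apply]; rfl
  rw [inertiaSubgroup]
  simp only [Subgroup.mem_iInf]
  constructor
  · intro h ζ hζ
    obtain ⟨P, hP⟩ := Ideal.exists_maximal (integralClosure 𝒪[K] (tameClosure K))
    have h1 := h P hP ⟨⟨ζ, mem_tameClosure_of_mem_tameRoots hζ⟩,
      isIntegral_coe_iff.2 (sepVal_tameRoots hζ).le⟩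
    have h2 := (mem_maximal_iff hP _).1 h1
    refine tameRoots_ext (galois_tameRoots σ hζ) hζ ?_
    rw [sepRed_eq_iff (sepVal_tameRoots (galois_tameRoots σ hζ)).le (sepVal_tameRoots hζ).le]
    exact (congrArg (sepVal K) (hcoe _)).symm.trans_lt h2
  · intro h P hP x
    have hx := isIntegral_coe_iff.1 x.2
    refine (mem_maximal_iff hP _).2 ((congrArg (sepVal K) (hcoe x)).trans_lt ?_)
    rw [← sepRed_eq_iff (by rwa [sepVal_galois]) hx]
    exact mem_sepInertia_iff.1 h _ hx

/-- A subgroup generated by elements that, at each tame level, agree with `σ`, contains the restriction of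
`σ` in its closure. -/
theorem tameRes_mem_topologicalClosure {H : Subgroup (tameClosure K ≃ₐ[K] tameClosure K)} {σ : SepGal K}
    (h : ∀ n, ¬ residueChar K ∣ n → ∃ τ, tameRes K τ ∈ H ∧ τ⁻¹ * σ ∈ levelGroup K n) :
    tameRes K σ ∈ H.topologicalClosure := by
  rw [← SetLike.mem_coe, Subgroup.topologicalClosure_coe, mem_closure_iff]
  intro U hU hσ
  have hV : IsOpen {τ : SepGal K | tameRes K (σ * τ) ∈ U} :=
    hU.preimage (continuous_tameRes.comp (continuous_const_mul σ))
  obtain ⟨n, hn, hsub⟩ := exists_levelGroup_subset hV fun τ hτ => by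
    have h1 : tameRes K τ = 1 := by
      rw [← map_one (tameRes K), tameRes_eq_iff]
      simpa using hτ
    change tameRes K (σ * τ) ∈ U
    rw [map_mul, h1, mul_one]
    exact hσ
  obtain ⟨τ, hτ, hl⟩ := h n hn
  have := hsub (inv_mem hl)
  rw [mul_inv_rev, inv_inv] at this
  change tameRes K (σ * (σ⁻¹ * τ)) ∈ U at this
  rw [mul_inv_cancel_left] at this
  exact ⟨_, this, hτ⟩

theorem isClosed_inertiaSubgroup :
    IsClosed (inertiaSubgroup K (tameClosure K) : Set (tameClosure K ≃ₐ[K] tameClosure K)) := by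
  have : (inertiaSubgroup K (tameClosure K) : Set (tameClosure K ≃ₐ[K] tameClosure K)) =
      ⋂ ζ : tameClosure K, ⋂ _ : (ζ : SeparableClosure K) ∈ tameRoots K, {σ | σ ζ ∈ ({ζ} : Set _)ᶜ}ᶜ := by
    ext σ
    obtain ⟨σ, rfl⟩ := tameRes_surjective σ
    rw [SetLike.mem_coe, tameRes_mem_inertiaSubgroup]
    simp only [Set.mem_iInter, Set.mem_compl_iff, Set.mem_ofPred_eq, Set.mem_singleton_iff, not_not]
    constructor
    · intro h ζ hζ
      exact Subtype.ext ((tameRes_apply σ ζ).trans (h _ hζ))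
    · intro h ζ hζ
      exact (tameRes_apply σ ⟨ζ, mem_tameClosure_of_mem_tameRoots hζ⟩).symm.trans
        (congrArg Subtype.val (h ⟨ζ, mem_tameClosure_of_mem_tameRoots hζ⟩ hζ))
  rw [this]
  exact isClosed_iInter fun ζ => isClosed_iInter fun _ => (isOpen_setOf_tame_apply_mem _ _).isClosed_compl

theorem IsGoodPair.isTamePair {a b : SepGal K} (h : IsGoodPair a b) :
    IsTamePair K (tameRes K a) (tameRes K b) where
  generates := by
    rw [eq_top_iff]
    intro s _
    obtain ⟨σ, rfl⟩ := tameRes_surjective s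
    refine tameRes_mem_topologicalClosure fun n hn => ?_
    obtain ⟨i, j, hl, -⟩ := h.exists_eqOn_level hn σ
    refine ⟨a ^ i * b ^ j, ?_, hl⟩
    rw [map_mul, map_pow, map_pow]
    exact mul_mem (pow_mem (Subgroup.subset_closure (by simp)) _)
      (pow_mem (Subgroup.subset_closure (by simp)) _)
  generates_inertia := by
    refine le_antisymm (Subgroup.topologicalClosure_minimal _ ?_ isClosed_inertiaSubgroup) ?_
    · rw [Subgroup.zpowers_le, tameRes_mem_inertiaSubgroup]
      exact h.inertia
    · intro s hs
      obtain ⟨σ, rfl⟩ := tameRes_surjective s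
      rw [tameRes_mem_inertiaSubgroup] at hs
      refine tameRes_mem_topologicalClosure fun n hn => ?_
      obtain ⟨i, j, -, hl⟩ := h.exists_eqOn_level hn σ
      refine ⟨a ^ i, ?_, hl hs⟩
      rw [map_pow]
      exact pow_mem (Subgroup.mem_zpowers _) _
  rel := by
    rw [← map_inv, ← map_mul, ← map_mul, ← map_pow, tameRes_eq_iff]
    exact fun n hn => h.conj_mem_level hn

/-- Any tame pair, not just a constructed one, has the required Kummer behaviour. Primitivity comes
from density of the powers of `a` in inertia, and the action of `b` on roots of unity is forced by
`b a b⁻¹ = a ^ q`. -/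
theorem IsTamePair.isGoodPair {a b : tameClosure K ≃ₐ[K] tameClosure K} (h : IsTamePair K a b) :
    IsGoodPair (a.liftNormal (SeparableClosure K)) (b.liftNormal (SeparableClosure K)) := by
  set a' := a.liftNormal (SeparableClosure K) with ha'
  set b' := b.liftNormal (SeparableClosure K) with hb'
  have ha : tameRes K a' = a := tameRes_liftNormal a
  have hb : tameRes K b' = b := tameRes_liftNormal b
  have hI : a' ∈ sepInertia K := by
    rw [← tameRes_mem_inertiaSubgroup, ha, ← h.generates_inertia]
    exact Subgroup.le_topologicalClosure _ (Subgroup.mem_zpowers a)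
  have hpow : ∀ n, ¬ residueChar K ∣ n → ∀ r, r ^ n = sepUnif K → ∀ i : ℤ,
      (a' ^ i) r = (a' r / r) ^ i * r := by
    intro n hn r hr i
    have hr0 := ne_zero_of_pow_eq_sepUnif (ne_zero_of_residueChar hn) hr
    have hη : a' (a' r / r) = a' r / r := hI _ ⟨n, hn, galois_div_pow_eq_one hr a'⟩
    have hη0 : a' r / r ≠ 0 := div_ne_zero (by simpa using hr0) hr0
    have h1 : a' r = (a' r / r) * r := (div_mul_cancel₀ _ hr0).symm
    induction i with
    | zero => simp
    | succ i ih =>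
      rw [add_comm, zpow_add, zpow_one, AlgEquiv.mul_apply, ih, map_mul, map_zpow₀, hη]
      rw [zpow_add₀ hη0, zpow_one, mul_comm (a' r / r), mul_assoc, ← h1]
    | pred i ih =>
      have h2 : (a' ^ (-(i : ℤ) - 1)) r = a'⁻¹ ((a' ^ (-(i : ℤ))) r) := by
        rw [← AlgEquiv.mul_apply, ← zpow_neg_one, ← zpow_add]; congr 2; ring
      rw [h2, AlgEquiv.aut_inv, AlgEquiv.symm_apply_eq, ih, map_mul, map_zpow₀, hη]
      have h3 : (a' r / r) ^ (-(i : ℤ)) = (a' r / r) ^ (-(i : ℤ) - 1) * (a' r / r) := by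
        rw [← zpow_add_one₀ hη0]; congr 1; ring
      rw [h3, mul_assoc, ← h1]
  have hprim : ∀ n, ¬ residueChar K ∣ n → ∀ r, r ^ n = sepUnif K → IsPrimitiveRoot (a' r / r) n := by
    intro n hn r hr
    have hr0 := ne_zero_of_pow_eq_sepUnif (ne_zero_of_residueChar hn) hr
    obtain ⟨σ, hσ, hσp⟩ := exists_inertia_primitive hn hr
    have hrt := mem_tameClosure_of_mem_levelSet hn (Or.inr hr)
    have hmem : tameRes K σ ∈ (Subgroup.zpowers a).topologicalClosure := by
      rw [h.generates_inertia, tameRes_mem_inertiaSubgroup]; exact hσ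
    rw [← SetLike.mem_coe, Subgroup.topologicalClosure_coe, mem_closure_iff] at hmem
    -- Some power `a ^ i` agrees on `r` with an inertia element acting by a primitive root of unity,
    -- so `(a r / r) ^ i` is primitive, and then so is `a r / r`.
    obtain ⟨_, hU, i, rfl⟩ := hmem _ (isOpen_setOf_tame_apply_mem ⟨r, hrt⟩ {tameRes K σ ⟨r, hrt⟩}) rfl
    have h1 : (a' ^ i) r = σ r := by
      have := congrArg Subtype.val (Set.mem_singleton_iff.1 hU)
      simp only at this
      rw [← ha, ← map_zpow, tameRes_apply, tameRes_apply] at this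
      exact this
    rw [hpow n hn r hr] at h1
    refine ⟨galois_div_pow_eq_one hr a', fun l hl => hσp.dvd_of_pow_eq_one l ?_⟩
    rw [← h1, mul_div_cancel_right₀ _ hr0, ← zpow_natCast, ← zpow_mul, mul_comm, zpow_mul, zpow_natCast, hl,
      one_zpow]
  refine ⟨hI, hprim, ?_⟩
  rintro ζ ⟨n, hn, hζ⟩
  obtain ⟨r, hr⟩ := exists_pow_eq_sep hn (sepUnif K)
  have hn0 := ne_zero_of_residueChar hn
  have : NeZero n := ⟨hn0⟩
  have hr0 := ne_zero_of_pow_eq_sepUnif hn0 hr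
  have hη := hprim n hn r hr
  have hbr : (b' r) ^ n = sepUnif K := by rw [← map_pow, hr, galois_sepUnif]
  have hbr0 := ne_zero_of_pow_eq_sepUnif hn0 hbr
  have hrel : tameRes K (b' * a' * b'⁻¹) = tameRes K (a' ^ residueCard K) := by
    rw [map_mul, map_mul, map_inv, map_pow, ha, hb, h.rel]
  have h1 : (b' * a' * b'⁻¹) (b' r) = (a' ^ residueCard K) (b' r) := by
    have := congrArg (fun f : tameClosure K ≃ₐ[K] tameClosure K =>
      (f ⟨b' r, mem_tameClosure_of_mem_levelSet hn (Or.inr hbr)⟩ : SeparableClosure K)) hrel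
    simpa only [tameRes_apply] using this
  -- Apply both sides of the relation to `b r`. As `η = a r / r` generates the `n`-th roots of
  -- unity, its image under `b` determines the action on all of them.
  have h2 : b' (a' r / r) = (a' r / r) ^ residueCard K := by
    rw [← zpow_natCast a', hpow n hn _ hbr, zpow_natCast,
      div_eq_of_mem_sepInertia hI hn hbr hr, ← AlgEquiv.mul_apply, inv_mul_cancel_right,
      AlgEquiv.mul_apply] at h1
    rw [map_div₀, div_eq_iff hbr0, h1]
  obtain ⟨i, -, rfl⟩ := hη.eq_pow_of_pow_eq_one hζ
  rw [map_pow, h2, pow_right_comm]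

end TameClosure

/-! ### Adapted bases of equivariant lattices -/

section AdaptedBasis

open scoped NNReal

variable {K : Type*} [Field K] [ValuativeRel K] [TopologicalSpace K]
  [IsNonarchimedeanLocalField K] {Γ : Type*} [Group Γ] [TopologicalSpace Γ] [DiscreteTopology Γ]

/-- The quotient `ϖ / r` is a unit, and inertia acts trivially on its residue. So the tame character
may be computed with either element. -/
theorem IsGoodPair.sepRed_div_eq {a b : SepGal K} (h : IsGoodPair a b) {n : ℕ} (hn : n ≠ 0)
    {ϖ r : SeparableClosure K} (hϖ : sepVal K ϖ ^ n = sepVal K (sepUnif K)) (hr : r ^ n = sepUnif K) :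
    sepRed (a ϖ / ϖ) = sepRed (a r / r) := by
  have hr0 := ne_zero_of_pow_eq_sepUnif hn hr
  have hv : sepVal K r = sepVal K ϖ := by
    refine (pow_left_inj₀ zero_le zero_le hn).1 ?_
    rw [← map_pow, hr, hϖ]
  have hrv : sepVal K r ≠ 0 := (sepVal K).ne_zero_iff.2 hr0
  have hϖ0 : ϖ ≠ 0 := (sepVal K).ne_zero_iff.1 (hv ▸ hrv)
  have hy : sepVal K (ϖ / r) = 1 := by rw [map_div₀, ← hv, div_self hrv]
  have hy0 : ϖ / r ≠ 0 := div_ne_zero hϖ0 hr0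
  have h1 : a ϖ / ϖ = a r / r * (a (ϖ / r) * (ϖ / r)⁻¹) := by
    have : a r ≠ 0 := by simpa using hr0
    rw [map_div₀]; field_simp
  have h2 : sepVal K (a (ϖ / r)) = 1 := by rw [sepVal_galois, hy]
  rw [h1, sepRed_mul (by rw [map_div₀, sepVal_galois, div_self hrv]) (by rw [map_mul, h2, map_inv₀, hy]; simp),
    sepRed_mul h2.le (by rw [map_inv₀, hy]; simp), sepRed_inv hy, mem_sepInertia_iff.1 h.inertia _ hy.le,
    mul_inv_cancel₀ (sepRed_ne_zero hy), mul_one]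

theorem IsGoodPair.isPrimitiveRoot_sepRed_div {a b : SepGal K} (h : IsGoodPair a b) {n : ℕ}
    (hn : ¬ residueChar K ∣ n)
    {ϖ : SeparableClosure K} (hϖ : sepVal K ϖ ^ n = sepVal K (sepUnif K)) :
    IsPrimitiveRoot (sepRed (a ϖ / ϖ)) n := by
  obtain ⟨r, hr⟩ := exists_pow_eq_sep hn (sepUnif K)
  rw [h.sepRed_div_eq (ne_zero_of_residueChar hn) hϖ hr]
  exact isPrimitiveRoot_sepRed hn (h.primitive n hn r hr)

/-- In one direction, `ρ` maps inertia into the powers of `ρ a`, so the order of `ρ a` kills its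
image. In the other, `a ^ e` fixes an `e`-th root of the uniformizer, hence the whole fixed field of
`ker ρ`. -/
theorem IsGoodPair.ramification_eq [Finite Γ] (hp : ¬ residueChar K ∣ Nat.card Γ) {a b : SepGal K}
    (h : IsGoodPair a b) (ρ : GalHom K Γ) {ϖ : SeparableClosure K} {e : ℕ}
    (hu : SubfieldUnif (galKer ρ) ϖ e) : e = orderOf (ρ a) := by
  have he := not_residueChar_dvd_ramification hp ρ hu
  refine Nat.dvd_antisymm ?_ ?_
  · refine hu.dvd_of_inertia (galKer_isOpen ρ)
      (not_residueChar_dvd_of_dvd (orderOf_dvd_natCard _) hp) fun σ hσ => ?_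
    obtain ⟨i, j, -, h1⟩ := h.exists_galHom_eq hp ρ σ
    rw [mem_galKer, map_pow, h1 hσ, pow_right_comm, pow_orderOf_eq_one, one_pow]
  · refine orderOf_dvd_of_pow_eq_one ?_
    rw [← map_pow, ← mem_galKer]
    refine mem_of_fixes (Subgroup.isClosed_of_isOpen _ (galKer_isOpen ρ)) fun x hx => ?_
    obtain ⟨r, hr⟩ := exists_pow_eq_sep he (sepUnif K)
    refine hu.fixes_of_tame he hr (pow_mem h.inertia e) ?_ hx
    rw [h.pow_apply_root he hr, galois_div_pow_eq_one hr, one_mul]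

variable {ι : Type*} [Fintype ι] [DecidableEq ι] (T : Γ →* Matrix ι ι 𝒪[K]) (ρ : GalHom K Γ)

/-- The matrix of a group element acting on the separable closure. -/
noncomputable def sepRep (δ : Γ) : Matrix ι ι (SeparableClosure K) :=
  (T δ).map (algebraMap 𝒪[K] (SeparableClosure K))

theorem sepRep_mul (δ ε : Γ) : sepRep T (δ * ε) = sepRep T δ * sepRep T ε := by
  rw [sepRep, map_mul, Matrix.map_mul]; rfl

theorem sepRep_one : sepRep T (1 : Γ) = 1 := by
  rw [sepRep, map_one, Matrix.map_one _ (map_zero _) (map_one _)]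

theorem galois_sepRep (σ : SepGal K) (δ : Γ) (i j : ι) : σ (sepRep T δ i j) = sepRep T δ i j :=
  (σ.restrictScalars 𝒪[K]).commutes _

theorem sepVal_sepRep (δ : Γ) (i j : ι) : sepVal K (sepRep T δ i j) ≤ 1 := sepVal_integer _

/-- The action of a group element on the reduction. -/
noncomputable def redRep (δ : Γ) : Matrix ι ι (SepRes K) := (T δ).map (integerRed K)

theorem redRep_one : redRep T (1 : Γ) = 1 := by
  rw [redRep, map_one, Matrix.map_one _ (map_zero _) (map_one _)]

theorem sepRed_sepRep (δ : Γ) (i j : ι) : sepRed (sepRep T δ i j) = redRep T δ i j := rfl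

theorem isUnit_det_sepRep (δ : Γ) : (sepRep T δ).det ≠ 0 := by
  have h : sepRep T δ * sepRep T δ⁻¹ = 1 := by rw [← sepRep_mul, mul_inv_cancel, sepRep_one]
  exact (Matrix.isUnit_det_of_right_inverse h).ne_zero

/-- The lattice of integral vectors on which the Galois group acts through `T ∘ ρ`. -/
noncomputable def equivariantLattice : Submodule 𝒪[K] (ι → SeparableClosure K) where
  carrier := {x | (∀ i, sepVal K (x i) ≤ 1) ∧
    ∀ (σ : SepGal K) i, σ (x i) = ∑ j, x j * sepRep T (ρ σ) j i}
  add_mem' := by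
    rintro x y ⟨hx, hx'⟩ ⟨hy, hy'⟩
    refine ⟨fun i => sepVal_add_le_one (hx i) (hy i), fun σ i => ?_⟩
    simp only [Pi.add_apply, map_add, hx', hy', add_mul, Finset.sum_add_distrib]
  zero_mem' := ⟨by simp, by simp⟩
  smul_mem' := by
    rintro c x ⟨hx, hx'⟩
    have hc : ∀ i, (c • x) i = algebraMap 𝒪[K] _ c * x i := fun i => by
      rw [Pi.smul_apply, Algebra.smul_def]
    refine ⟨fun i => ?_, fun σ i => ?_⟩
    · rw [hc]; exact sepVal_mul_le_one (sepVal_integer c) (hx i)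
    · have h1 : σ (algebraMap 𝒪[K] _ c) = algebraMap 𝒪[K] _ c := (σ.restrictScalars 𝒪[K]).commutes _
      simp only [hc, map_mul, hx', h1, Finset.mul_sum, mul_assoc]

/-- The vectors `ϖ ^ c j • Y j` form a basis of the equivariant lattice, with `Y` invertible over the
integers. -/
structure IsAdaptedBasis (ϖ : SeparableClosure K) (n : ℕ) (c : ι → ℕ)
    (Y : Matrix ι ι (SeparableClosure K)) : Prop where
  lt : ∀ j, c j < n
  val_le : ∀ j i, sepVal K (Y j i) ≤ 1
  det : (Y.map sepRed).det ≠ 0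
  mem : ∀ j, (fun i => ϖ ^ c j * Y j i) ∈ equivariantLattice T ρ

variable {T ρ}

/-- This is the trace of `z` twisted by the representation. Translating the cosets by `σ` pulls out
the factor `T (ρ σ)`. -/
theorem trace_mem_equivariantLattice [Fintype (SepGal K ⧸ galKer ρ)] {z : SeparableClosure K}
    (hz : sepVal K z ≤ 1) (hzN : ∀ ν ∈ galKer ρ, ν z = z) (m : ι) :
    (fun l => ∑ s : SepGal K ⧸ galKer ρ, sepRep T (ρ s.out)⁻¹ m l * s.out z) ∈ equivariantLattice T ρ := by
  refine ⟨fun l => sepVal_sum_le_one _ fun s _ => sepVal_mul_le_one (sepVal_sepRep T _ _ _) (by simpa),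
    fun σ l => ?_⟩
  have h1 := sum_mul_out (N := galKer ρ) (fun τ : SepGal K => sepRep T (ρ (σ⁻¹ * τ))⁻¹ m l * τ z)
    (fun τ ν hν => by
      simp only [map_mul, mem_galKer.1 hν, mul_one, AlgEquiv.mul_apply, hzN ν hν]) σ
  simp only [inv_mul_cancel_left] at h1
  rw [map_sum]
  simp only [map_mul, galois_sepRep]
  refine h1.trans ?_
  simp only [mul_inv_rev, map_mul, map_inv, inv_inv, sepRep_mul, Matrix.mul_apply, Finset.sum_mul]
  rw [Finset.sum_comm]
  refine Finset.sum_congr rfl fun j _ => Finset.sum_congr rfl fun s _ => ?_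
  ring

/-- Twisted traces of `ϖ ^ i c`, divided by `ϖ ^ i`, are integral vectors. Once their reductions are
known to span, a basis selected among them gives the exponents and the matrix. The span is
everything because a functional vanishing on it vanishes on each basis vector, by independence of
the reduced conjugates followed by Fourier inversion on the cyclic inertia image. -/
theorem IsGoodPair.exists_isAdaptedBasis [Finite Γ] (hp : ¬ residueChar K ∣ Nat.card Γ) {a b : SepGal K}
    (h : IsGoodPair a b) {ϖ : SeparableClosure K} {n : ℕ} (hu : SubfieldUnif (galKer ρ) ϖ n) :
    ∃ c Y, IsAdaptedBasis T ρ ϖ n c Y := by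
  classical
  have hNo := galKer_isOpen ρ
  have hn : n = orderOf (ρ a) := h.ramification_eq hp ρ hu
  have hpn := not_residueChar_dvd_ramification hp ρ hu
  have hη := h.isPrimitiveRoot_sepRed_div hpn hu.pow_eq
  have : Finite (SepGal K ⧸ galKer ρ) := Subgroup.quotient_finite_of_isOpen _ hNo
  have := Fintype.ofFinite (SepGal K ⧸ galKer ρ)
  have hϖ0 := hu.ne_zero
  have hϖv : sepVal K ϖ ≠ 0 := hu.val_pos.ne'
  have hwu : ∀ s : SepGal K, sepVal K (s ϖ / ϖ) = 1 := fun s => by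
    rw [map_div₀, sepVal_galois, div_self hϖv]
  let C := {z : SeparableClosure K // sepVal K z ≤ 1 ∧ ∀ ν ∈ galKer ρ, ν z = z}
  let y : Fin n × C × ι → ι → SeparableClosure K := fun t l =>
    ∑ s : SepGal K ⧸ galKer ρ, sepRep T (ρ s.out)⁻¹ t.2.2 l * ((s.out ϖ / ϖ) ^ (t.1 : ℕ) * s.out t.2.1.1)
  have hterm : ∀ (t : Fin n × C × ι) (l : ι) (s : SepGal K ⧸ galKer ρ),
      sepVal K (sepRep T (ρ s.out)⁻¹ t.2.2 l * ((s.out ϖ / ϖ) ^ (t.1 : ℕ) * s.out t.2.1.1)) ≤ 1 :=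
    fun t l s => sepVal_mul_le_one (sepVal_sepRep T _ _ _)
      (sepVal_mul_le_one (sepVal_pow_le_one (hwu _).le _) (by simpa using t.2.1.2.1))
  have hy1 : ∀ t l, sepVal K (y t l) ≤ 1 := fun t l => sepVal_sum_le_one _ fun s _ => hterm t l s
  have hymem : ∀ t, (fun l => ϖ ^ (t.1 : ℕ) * y t l) ∈ equivariantLattice T ρ := by
    intro t
    have h1 := trace_mem_equivariantLattice (T := T) (ρ := ρ) (z := ϖ ^ (t.1 : ℕ) * t.2.1.1)
      (sepVal_mul_le_one (sepVal_pow_le_one hu.lt_one.le _) t.2.1.2.1)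
      (fun ν hν => by rw [map_mul, map_pow, hu.fixed ν hν, t.2.1.2.2 ν hν]) t.2.2
    convert h1 using 2 with l
    rw [Finset.mul_sum]
    refine Finset.sum_congr rfl fun s _ => ?_
    rw [map_mul, map_pow, div_pow]
    field_simp
  let v : Fin n × C × ι → ι → SepRes K := fun t l => sepRed (y t l)
  have hspan : Submodule.span (SepRes K) (Set.range v) = ⊤ := by
    by_contra hcon
    obtain ⟨f, hf0, hf⟩ := Submodule.exists_le_ker_of_lt_top _ (lt_top_iff_ne_top.2 hcon)
    refine hf0 (LinearMap.pi_ext' fun m => LinearMap.ext_ring ?_)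
    let f' : ι → SepRes K := fun l => f (Pi.single l 1)
    have hf' : ∀ x, f x = ∑ l, x l * f' l := fun x => by
      rw [LinearMap.pi_apply_eq_sum_univ f x]
      refine Finset.sum_congr rfl fun i _ => ?_
      rw [smul_eq_mul]
      congr 2
      funext j
      simp [Pi.single_apply, eq_comm]
    have h0 : ∀ i : Fin n, ∑ s with s ∈ inertiaImage K (galKer ρ),
        (∑ l, redRep T (ρ s.out)⁻¹ m l * f' l) * sepRed (s.out ϖ / ϖ) ^ (i : ℕ) = 0 := by
      intro i
      refine sum_inertia_eq_zero (Subgroup.isClosed_of_isOpen _ hNo) _ fun c hc hcN => ?_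
      have h1 : f (v (i, ⟨c, hc, hcN⟩, m)) = 0 := hf (Submodule.subset_span ⟨_, rfl⟩)
      rw [hf'] at h1
      rw [← h1]
      simp only [v, y]
      have h2 : ∀ l, sepRed (∑ s : SepGal K ⧸ galKer ρ,
          sepRep T (ρ s.out)⁻¹ m l * ((s.out ϖ / ϖ) ^ (i : ℕ) * s.out c)) =
          ∑ s : SepGal K ⧸ galKer ρ, redRep T (ρ s.out)⁻¹ m l * (sepRed (s.out ϖ / ϖ) ^ (i : ℕ) * sepRed (s.out c)) := by
        intro l
        rw [sepRed_sum _ fun s _ => hterm (i, ⟨c, hc, hcN⟩, m) l s]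
        refine Finset.sum_congr rfl fun s _ => ?_
        rw [sepRed_mul (sepVal_sepRep T _ _ _) (sepVal_mul_le_one (sepVal_pow_le_one (hwu _).le _) (by simpa using hc)),
          sepRed_mul (sepVal_pow_le_one (hwu _).le _) (by simpa using hc), sepRed_pow (hwu _).le, sepRed_sepRep]
      simp only [h2, Finset.sum_mul]
      rw [Finset.sum_comm]
      refine Finset.sum_congr rfl fun l _ => Finset.sum_congr rfl fun s _ => ?_
      ring
    -- Sum the relations over all `i < n`. A nontrivial inertia coset contributes the full geometric
    -- sum of a nontrivial `n`-th root of unity, which is zero, so only the trivial coset survives,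
    -- with the factor `n`, invertible in the residue field.
    have h3 := Finset.sum_congr rfl fun (i : Fin n) (_ : i ∈ Finset.univ) => h0 i
    rw [Finset.sum_comm, Finset.sum_const_zero] at h3
    simp only [← Finset.mul_sum] at h3
    rw [Finset.sum_eq_single (1 : SepGal K ⧸ galKer ρ)] at h3
    · have h4 : (1 : SepGal K ⧸ galKer ρ).out ∈ galKer ρ := by
        rw [← QuotientGroup.eq_one_iff, QuotientGroup.out_eq']
      rw [hu.fixed _ h4, mem_galKer.1 h4, div_self hϖ0, inv_one, redRep_one] at h3
      simp only [sepRed_one, one_pow, Finset.sum_const, Finset.card_univ, Fintype.card_fin, nsmul_eq_mul, mul_one] at h3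
      rw [mul_eq_zero, or_iff_left (sepRes_natCast_ne_zero hpn)] at h3
      simpa [Matrix.one_apply, f'] using h3
    · intro s hs hs1
      obtain ⟨σ, hσ, hσs⟩ := (Finset.mem_filter.1 hs).2
      obtain ⟨k, j, -, hk⟩ := h.exists_galHom_eq hp ρ σ
      have h5 : ρ s.out = ρ (a ^ k) := by
        rw [map_pow, ← hk hσ]
        have : σ⁻¹ * s.out ∈ galKer ρ := by
          rw [← QuotientGroup.eq, QuotientGroup.out_eq']; exact hσs
        rw [mem_galKer, map_mul, map_inv, inv_mul_eq_one] at this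
        exact this.symm
      have h6 : s.out ϖ = (a ^ k) ϖ := by
        have : (a ^ k)⁻¹ * s.out ∈ galKer ρ := by
          rw [mem_galKer, map_mul, map_inv, h5, inv_mul_cancel]
        have := congrArg (a ^ k) (hu.fixed _ this)
        rwa [← AlgEquiv.mul_apply, mul_inv_cancel_left] at this
      have h7 : sepRed (s.out ϖ / ϖ) = sepRed (a ϖ / ϖ) ^ k := by
        rw [h6, sepRed_div_pow_of_mem_sepInertia h.inertia hϖ0]
      have h8 : sepRed (a ϖ / ϖ) ^ k ≠ 1 := by
        intro h9
        have h10 := hη.dvd_of_pow_eq_one k h9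
        rw [hn, orderOf_dvd_iff_pow_eq_one] at h10
        refine hs1 ?_
        rw [← QuotientGroup.out_eq' s, QuotientGroup.eq_one_iff, mem_galKer, h5, map_pow, h10]
      rw [h7, Fin.sum_univ_eq_sum_range (fun i => (sepRed (a ϖ / ϖ) ^ k) ^ i) n]
      rw [show ∑ i ∈ Finset.range n, (sepRed (a ϖ / ϖ) ^ k) ^ i = 0 from ?_]
      · exact mul_zero _
      have h11 := geom_sum_mul (sepRed (a ϖ / ϖ) ^ k) n
      rw [pow_right_comm, hη.pow_eq_one, one_pow, sub_self, mul_eq_zero, or_iff_left (sub_ne_zero.2 h8)] at h11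
      exact h11
    · intro h1
      exact absurd (Finset.mem_filter.2 ⟨Finset.mem_univ _, one_mem _⟩) h1
  obtain ⟨κ, f, -, hsp, hli⟩ := exists_linearIndependent' (SepRes K) v
  rw [hspan] at hsp
  let B := Module.Basis.mk hli hsp.ge
  let e := (Pi.basisFun (SepRes K) ι).indexEquiv B
  refine ⟨fun j => (f (e j)).1, fun j i => y (f (e j)) i, fun j => (f (e j)).1.2, fun j i => hy1 _ _, ?_,
    fun j => hymem _⟩
  have h1 : LinearIndependent (SepRes K) (Matrix.row (Matrix.map (fun j i => y (f (e j)) i) sepRed : Matrix ι ι (SepRes K))) :=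
    hli.comp e e.injective
  rw [Matrix.linearIndependent_rows_iff_isUnit, Matrix.isUnit_iff_isUnit_det] at h1
  exact h1.ne_zero

end AdaptedBasis

/-! ### The basis and the eigenvalues attached to an adapted basis -/

section AdaptedBasisFacts

open scoped NNReal

variable {K : Type*} [Field K] [ValuativeRel K] [TopologicalSpace K]
  [IsNonarchimedeanLocalField K] {Γ : Type*} [Group Γ] [TopologicalSpace Γ] [DiscreteTopology Γ]
  {ι : Type*} [Fintype ι] [DecidableEq ι] {T : Γ →* Matrix ι ι 𝒪[K]} {ρ : GalHom K Γ}
  {ϖ : SeparableClosure K} {n : ℕ} {c : ι → ℕ} {Y : Matrix ι ι (SeparableClosure K)}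

theorem exists_integral_inv {Y : Matrix ι ι (SeparableClosure K)} (hY : ∀ i j, sepVal K (Y i j) ≤ 1)
    (hdet : (Y.map sepRed).det ≠ 0) :
    ∃ Z : Matrix ι ι (SeparableClosure K), (∀ i j, sepVal K (Z i j) ≤ 1) ∧ Y * Z = 1 ∧ Z * Y = 1 ∧
      sepVal K Y.det = 1 := by
  let V := (sepVal K).valuationSubring
  let Y' : Matrix ι ι V := fun i j => ⟨Y i j, hY i j⟩
  have h1 : Y.map sepRed = (IsLocalRing.residue V).mapMatrix Y' := by
    ext i j
    exact sepRed_of_le (hY i j)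
  have h2 : Y = V.subtype.mapMatrix Y' := rfl
  have h3 : IsUnit Y'.det := by
    rw [h1, ← RingHom.map_det, Ne, IsLocalRing.residue_eq_zero_iff, IsLocalRing.mem_maximalIdeal,
      mem_nonunits_iff, not_not] at hdet
    exact hdet
  refine ⟨V.subtype.mapMatrix Y'⁻¹, fun i j => (Y'⁻¹ i j).2, ?_, ?_, ?_⟩
  · rw [h2, ← map_mul, Matrix.mul_nonsing_inv _ h3, map_one]
  · rw [h2, ← map_mul, Matrix.nonsing_inv_mul _ h3, map_one]
  · rw [h2, ← RingHom.map_det]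
    exact ((sepVal K).isEquiv_valuation_valuationSubring.eq_one_iff_eq_one).2
      ((ValuationSubring.valuation_eq_one_iff V _).1 h3)

namespace IsAdaptedBasis

variable (h : IsAdaptedBasis T ρ ϖ n c Y) (hu : SubfieldUnif (galKer ρ) ϖ n)

include h

theorem galois_apply (σ : SepGal K) (j i : ι) :
    σ (ϖ ^ c j) * σ (Y j i) = ∑ l, ϖ ^ c j * Y j l * sepRep T (ρ σ) l i := by
  rw [← map_mul]; exact (h.mem j).2 σ i

include hu

/-- Coordinates in this basis of vectors over `K^sep` are unique, hence Galois-invariant, hence in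
`K`. -/
theorem exists_coeff {x : ι → SeparableClosure K} (hx : x ∈ equivariantLattice T ρ) :
    ∃ r : ι → 𝒪[K], x = fun i => ∑ j, algebraMap 𝒪[K] _ (r j) * (ϖ ^ c j * Y j i) := by
  obtain ⟨Z, hZ, hYZ, hZY, -⟩ := exists_integral_inv h.val_le h.det
  have hϖ0 := hu.ne_zero
  let X : Matrix ι ι (SeparableClosure K) := fun j i => ϖ ^ c j * Y j i
  let w : ι → SeparableClosure K := fun j => (∑ i, x i * Z i j) / ϖ ^ c j
  have hw : ∀ i, x i = ∑ j, w j * X j i := by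
    intro i
    have h1 : ∀ j, w j * X j i = ∑ l, x l * (Z l j * Y j i) := by
      intro j
      simp only [w, X]
      rw [← mul_assoc, div_mul_cancel₀ _ (pow_ne_zero _ hϖ0), Finset.sum_mul]
      exact Finset.sum_congr rfl fun l _ => mul_assoc _ _ _
    simp only [h1]
    rw [Finset.sum_comm]
    simp only [← Finset.mul_sum]
    have h2 : ∀ l, ∑ j, Z l j * Y j i = (1 : Matrix ι ι (SeparableClosure K)) l i := fun l => by
      rw [← hZY, Matrix.mul_apply]
    simp only [h2, Matrix.one_apply, mul_ite, mul_one, mul_zero]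
    rw [Finset.sum_ite_eq' Finset.univ i, if_pos (Finset.mem_univ _)]
  have hinj : ∀ z : ι → SeparableClosure K, (∀ i, ∑ j, z j * X j i = 0) → z = 0 := by
    intro z hz
    funext l
    have h1 : ∀ i, (∑ j, z j * X j i) * Z i l = 0 := fun i => by rw [hz, zero_mul]
    have h2 := Finset.sum_congr rfl fun (i : ι) (_ : i ∈ Finset.univ) => h1 i
    simp only [Finset.sum_const_zero, Finset.sum_mul, X] at h2
    rw [Finset.sum_comm] at h2
    have h3 : ∀ j, ∑ i, z j * (ϖ ^ c j * Y j i) * Z i l =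
        z j * ϖ ^ c j * (1 : Matrix ι ι (SeparableClosure K)) j l := fun j => by
      rw [← hYZ, Matrix.mul_apply, Finset.mul_sum]
      exact Finset.sum_congr rfl fun i _ => by ring
    simp only [h3, Matrix.one_apply, mul_ite, mul_one, mul_zero] at h2
    rw [Finset.sum_ite_eq' Finset.univ l, if_pos (Finset.mem_univ _), mul_eq_zero] at h2
    exact h2.resolve_right (pow_ne_zero _ hϖ0)
  have hfix : ∀ σ : SepGal K, ∀ j, σ (w j) = w j := by
    intro σ j
    have hX : ∀ j i, σ (X j i) = ∑ l, X j l * sepRep T (ρ σ) l i := fun j i => (h.mem j).2 σ i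
    have h1 : ∀ i, ∑ l, (∑ j, (σ (w j) - w j) * X j l) * sepRep T (ρ σ) l i = 0 := by
      intro i
      have h2 := hx.2 σ i
      rw [hw i, map_sum] at h2
      simp only [map_mul, hX] at h2
      have h3 : ∀ l, ∑ j, (σ (w j) - w j) * X j l = ∑ j, σ (w j) * X j l - x l := fun l => by
        rw [hw l, ← Finset.sum_sub_distrib]; exact Finset.sum_congr rfl fun j _ => sub_mul _ _ _
      refine (Finset.sum_congr rfl fun l _ => by rw [h3 l, sub_mul]).trans ?_
      rw [Finset.sum_sub_distrib, ← h2, sub_eq_zero]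
      simp only [Finset.sum_mul, Finset.mul_sum]
      rw [Finset.sum_comm]
      exact Finset.sum_congr rfl fun j _ => Finset.sum_congr rfl fun l _ => mul_assoc _ _ _
    have h4 : (fun l => ∑ j, (σ (w j) - w j) * X j l) = 0 :=
      Matrix.eq_zero_of_vecMul_eq_zero (isUnit_det_sepRep T (ρ σ)) (funext h1)
    have h5 := hinj (fun j => σ (w j) - w j) fun i => congrFun h4 i
    exact sub_eq_zero.1 (congrFun h5 j)
  have hint : ∀ j, ∃ r : 𝒪[K], algebraMap 𝒪[K] _ r = w j := by
    intro j
    obtain ⟨y, hy⟩ := mem_range_of_fixed fun σ => hfix σ j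
    by_cases hy0 : y = 0
    · exact ⟨0, by rw [← hy, hy0, map_zero, map_zero]⟩
    obtain ⟨k, hk⟩ := exists_sepVal_algebraMap_eq_zpow hy0
    have h1 : sepVal K (w j) * sepVal K ϖ ^ c j ≤ 1 := by
      rw [← map_pow, ← map_mul, div_mul_cancel₀ _ (pow_ne_zero _ hϖ0)]
      exact sepVal_sum_le_one _ fun i _ => sepVal_mul_le_one (hx.1 i) (hZ i j)
    rw [← hy, hk, ← hu.pow_eq, ← zpow_natCast, ← zpow_natCast, ← zpow_mul, ← zpow_add₀ hu.val_pos.ne',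
      zpow_le_one_iff_right_of_lt_one₀ hu.val_pos hu.lt_one] at h1
    -- Integrality of `w j * ϖ ^ c j` gives only `n k + c j ≥ 0`; the bound `c j < n` then forces `k
    -- ≥ 0`.
    have h2 : 0 ≤ k := by
      by_contra! hk0
      have h3 : (n : ℤ) * k ≤ n * (-1) := mul_le_mul_of_nonneg_left (by omega) (by positivity)
      have := h.lt j
      omega
    have h3 : y ∈ 𝒪[K] := by
      rw [← sepVal_algebraMap_le_one_iff, hk]
      lift k to ℕ using h2
      rw [zpow_natCast]
      exact pow_le_one₀ zero_le sepVal_unif_lt_one.le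
    exact ⟨⟨y, h3⟩, hy⟩
  choose r hr using hint
  refine ⟨r, funext fun i => ?_⟩
  simp only [hr]
  exact hw i

theorem linearIndependent :
    LinearIndependent (SeparableClosure K) (fun j i => ϖ ^ c j * Y j i : ι → ι → SeparableClosure K) := by
  obtain ⟨Z, -, hYZ, -, -⟩ := exists_integral_inv h.val_le h.det
  have h1 : LinearIndependent (SeparableClosure K)
      (Matrix.row (Matrix.diagonal (fun j => ϖ ^ c j) * Y)) := by
    rw [Matrix.linearIndependent_rows_iff_isUnit, Matrix.isUnit_iff_isUnit_det, Matrix.det_mul,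
      Matrix.det_diagonal, IsUnit.mul_iff]
    refine ⟨(Finset.prod_ne_zero_iff.2 fun j _ => pow_ne_zero _ hu.ne_zero).isUnit,
      Matrix.isUnit_det_of_right_inverse hYZ⟩
  convert h1 using 1
  funext j i
  exact (Matrix.diagonal_mul (fun j => ϖ ^ c j) Y j i).symm

/-- The basis of the equivariant lattice given by an adapted basis. -/
noncomputable def basis : Module.Basis ι 𝒪[K] (equivariantLattice T ρ) :=
  Module.Basis.mk (v := fun j => (⟨fun i => ϖ ^ c j * Y j i, h.mem j⟩ : equivariantLattice T ρ))
    (by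
      refine Fintype.linearIndependent_iff.2 fun r hr j => algebraMap_integer_injective ?_
      rw [map_zero]
      refine Fintype.linearIndependent_iff.1 (h.linearIndependent hu) (fun j => algebraMap 𝒪[K] _ (r j)) ?_ j
      have h1 := congrArg Subtype.val hr
      rw [AddSubmonoidClass.coe_finsetSum] at h1
      refine Eq.trans (Finset.sum_congr rfl fun j _ => funext fun i => ?_) h1
      exact (Algebra.smul_def _ _).symm)
    (by
      rintro ⟨x, hx⟩ -
      obtain ⟨r, hr⟩ := h.exists_coeff hu hx
      have : (⟨x, hx⟩ : equivariantLattice T ρ) =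
          ∑ j, r j • (⟨fun i => ϖ ^ c j * Y j i, h.mem j⟩ : equivariantLattice T ρ) := by
        refine Subtype.ext ?_
        rw [AddSubmonoidClass.coe_finsetSum]
        refine hr.trans (funext fun i => ?_)
        rw [Finset.sum_apply]
        exact Finset.sum_congr rfl fun j _ => (Algebra.smul_def _ _).symm
      rw [this]
      exact Submodule.sum_mem _ fun j _ => Submodule.smul_mem _ _ (Submodule.subset_span ⟨j, rfl⟩))

theorem basis_apply (j i : ι) : (h.basis hu j : ι → SeparableClosure K) i = ϖ ^ c j * Y j i := by
  rw [basis, Module.Basis.mk_apply]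

/-- Divide the equivariance relation for `a` by `ϖ ^ c j` and reduce. Inertia acts trivially on the
residues of `Y`, so the invertible reduction of `Y` conjugates the representing matrix to a diagonal
one. -/
theorem charpoly_eq {a : SepGal K} (ha : a ∈ sepInertia K) :
    (redRep T (ρ a)).charpoly = ∏ j, (Polynomial.X - Polynomial.C (sepRed (a ϖ / ϖ) ^ c j)) := by
  have hϖ0 := hu.ne_zero
  have hw : sepVal K (a ϖ / ϖ) = 1 := by
    rw [map_div₀, sepVal_galois, div_self hu.val_pos.ne']
  set D : Matrix ι ι (SepRes K) := Matrix.diagonal fun j => sepRed (a ϖ / ϖ) ^ c j with hD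
  set Yb := Y.map sepRed with hYb
  have h1 : D * Yb = Yb * redRep T (ρ a) := by
    ext j i
    rw [Matrix.diagonal_mul, Matrix.mul_apply]
    have h2 : (a ϖ / ϖ) ^ c j * a (Y j i) = ∑ l, Y j l * sepRep T (ρ a) l i := by
      have h3 := h.galois_apply a j i
      simp only [mul_assoc] at h3
      rw [← Finset.mul_sum] at h3
      rw [div_pow, div_mul_eq_mul_div, ← map_pow, h3, mul_div_cancel_left₀ _ (pow_ne_zero _ hϖ0)]
    have h4 := congrArg sepRed h2
    rw [sepRed_mul (sepVal_pow_le_one hw.le _) (by simpa using h.val_le j i), sepRed_pow hw.le,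
      mem_sepInertia_iff.1 ha _ (h.val_le j i),
      sepRed_sum _ fun l _ => sepVal_mul_le_one (h.val_le j l) (sepVal_sepRep T _ _ _)] at h4
    rw [hYb, Matrix.map_apply, h4]
    exact Finset.sum_congr rfl fun l _ => sepRed_mul (h.val_le j l) (sepVal_sepRep T _ _ _)
  have hdet : IsUnit Yb.det := h.det.isUnit
  have h2 : redRep T (ρ a) = Yb⁻¹ * (D * Yb) := by
    rw [h1, ← mul_assoc, Matrix.nonsing_inv_mul _ hdet, one_mul]
  rw [h2, Matrix.charpoly_mul_comm, mul_assoc, Matrix.mul_nonsing_inv _ hdet, mul_one, hD]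
  exact Matrix.charpoly_diagonal _

end IsAdaptedBasis

end AdaptedBasisFacts

/-! ### Colength and fibre dimension for matrices with prescribed elementary divisors -/

section ElementaryDivisors

variable {B : Type*} [CommRing B] {ι : Type*} [Fintype ι] [DecidableEq ι]

/-- In the coordinates given by the invertible matrix `Z`, the submodule is the product of the
ideals `(t ^ c j)`, so the quotient is a product of rings `B / (t ^ c j)`. -/
theorem length_quotient_span_rows (A : Type*) [CommRing A] [Algebra A B] {t : B}
    (ht : t ∈ nonZeroDivisors B) (c : ι → ℕ) {Y Z : Matrix ι ι B} (hYZ : Y * Z = 1)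
    {φ : ι → ι → B} (hφ : ∀ j i, φ j i = t ^ c j * Y j i) :
    Module.length A ((ι → B) ⧸ Submodule.span B (Set.range φ)) =
      (∑ j, c j : ℕ) * Module.length A (B ⧸ Ideal.span {t}) := by
  have hZY : Z * Y = 1 := _root_.mul_eq_one_comm.1 hYZ
  let f : (ι → B) →ₗ[B] (∀ j, B ⧸ Ideal.span {t ^ c j}) :=
    LinearMap.pi fun j => (Submodule.mkQ (Ideal.span {t ^ c j})).comp
      ((LinearMap.proj j).comp (Matrix.vecMulLinear Z))
  have hfa : ∀ v j, f v j = Submodule.Quotient.mk (Matrix.vecMul v Z j) := fun v j => rfl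
  have hsurj : Function.Surjective f := by
    intro w
    choose v hv using fun j => Submodule.Quotient.mk_surjective _ (w j)
    refine ⟨Matrix.vecMul v Y, funext fun j => ?_⟩
    rw [hfa, Matrix.vecMul_vecMul, hYZ, Matrix.vecMul_one, hv]
  have hker : LinearMap.ker f = Submodule.span B (Set.range φ) := by
    refine le_antisymm ?_ ?_
    · intro v hv
      have h1 : ∀ j, ∃ s, s * t ^ c j = Matrix.vecMul v Z j := fun j => by
        have h2 : f v j = 0 := by rw [LinearMap.mem_ker.1 hv]; rfl
        rw [hfa, Submodule.Quotient.mk_eq_zero] at h2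
        exact Ideal.mem_span_singleton'.1 h2
      choose s hs using h1
      have h3 : v = ∑ j, s j • φ j := by
        have h4 : v = Matrix.vecMul (Matrix.vecMul v Z) Y := by
          rw [Matrix.vecMul_vecMul, hZY, Matrix.vecMul_one]
        rw [h4]
        funext i
        rw [Finset.sum_apply]
        refine Finset.sum_congr rfl fun j _ => ?_
        rw [← hs, Pi.smul_apply, hφ, smul_eq_mul]
        exact mul_assoc _ _ _
      rw [h3]
      exact Submodule.sum_mem _ fun j _ => Submodule.smul_mem _ _ (Submodule.subset_span ⟨j, rfl⟩)
    · rw [Submodule.span_le]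
      rintro _ ⟨j, rfl⟩
      rw [SetLike.mem_coe, LinearMap.mem_ker]
      funext k
      rw [hfa]
      refine (Submodule.Quotient.mk_eq_zero _).2 ?_
      have h1 : φ j = t ^ c j • Y j := funext fun i => hφ j i
      have h2 : Matrix.vecMul (Y j) Z k = (1 : Matrix ι ι B) j k := by rw [← hYZ]; rfl
      rw [h1, Matrix.smul_vecMul, Pi.smul_apply, h2, Matrix.one_apply, smul_eq_mul]
      split_ifs with hjk
      · rw [hjk]; exact Ideal.mul_mem_right _ _ (Ideal.mem_span_singleton_self _)
      · rw [mul_zero]; exact Submodule.zero_mem _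
  rw [← hker, ((f.quotKerEquivOfSurjective hsurj).restrictScalars A).length_eq,
    Module.length_pi_of_fintype]
  simp only [length_quotient_span_pow A ht]
  rw [← Finset.sum_mul]
  push_cast
  rfl

end ElementaryDivisors

/-! ### The dimension of the fibre over the origin -/

section FibreDimension

variable {R B : Type*} [CommRing R] [IsLocalRing R] [CommRing B] [Algebra R B] {d : ℕ}

open MvPolynomial

theorem map_originIdeal_uStar {p : R} (hp : IsLocalRing.maximalIdeal R = Ideal.span {p})
    (φ : Fin d → Fin d → B) :
    (originIdeal R d).map (uStar (R := R) φ) =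
      Ideal.span (insert (C (algebraMap R B p)) (Set.range fun i => ∑ j, C (φ j i) * X j)) := by
  set I := Ideal.span (insert (C (algebraMap R B p)) (Set.range fun i => ∑ j, C (φ j i) * X (R := B) j))
    with hI
  refine le_antisymm ?_ ?_
  · rw [Ideal.map_le_iff_le_comap]
    intro f hf
    have h1 : (Ideal.Quotient.mkₐ R I).comp (uStar (R := R) φ) =
        (Algebra.ofId R (MvPolynomial (Fin d) B ⧸ I)).comp (aeval (R := R) (fun _ => (0 : R))) := by
      refine algHom_ext fun i => ?_
      rw [AlgHom.comp_apply, AlgHom.comp_apply, aeval_X, map_zero, uStar, aeval_X]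
      exact Ideal.Quotient.eq_zero_iff_mem.2 (Ideal.subset_span (Or.inr ⟨i, rfl⟩))
    have h2 := DFunLike.congr_fun h1 f
    have h3 : aeval (R := R) (fun _ : Fin d => (0 : R)) f = constantCoeff f := by
      rw [aeval_zero']; rfl
    rw [AlgHom.comp_apply, AlgHom.comp_apply, h3] at h2
    have h4 : constantCoeff f ∈ Ideal.span {p} := by
      rw [← hp, ← IsLocalRing.residue_eq_zero_iff]; exact hf
    obtain ⟨s, hs⟩ := Ideal.mem_span_singleton'.1 h4
    rw [Ideal.mem_comap, ← Ideal.Quotient.eq_zero_iff_mem]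
    refine h2.trans ?_
    rw [← hs, map_mul]
    have h5 : Algebra.ofId R (MvPolynomial (Fin d) B ⧸ I) p = 0 :=
      Ideal.Quotient.eq_zero_iff_mem.2 (Ideal.subset_span (Or.inl rfl))
    rw [h5, mul_zero]
  · rw [hI, Ideal.span_le]
    rintro _ (rfl | ⟨i, rfl⟩)
    · have h1 : uStar (R := R) φ (C p) = C (algebraMap R B p) := algHom_C _ _
      rw [← h1]
      refine Ideal.mem_map_of_mem _ ?_
      rw [originIdeal, RingHom.mem_ker, RingHom.comp_apply, constantCoeff_C, IsLocalRing.residue_eq_zero_iff, hp]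
      exact Ideal.mem_span_singleton_self p
    · have h1 : uStar (R := R) φ (X i) = ∑ j, C (φ j i) * X j := aeval_X _ _
      simp only
      rw [← h1]
      refine Ideal.mem_map_of_mem _ ?_
      rw [originIdeal, RingHom.mem_ker, RingHom.comp_apply, constantCoeff_X, map_zero]

/-- In the new variables `l k = ∑ j, U j k X j` the linear forms generate the same ideal as the
elements `t ^ c k * l k`, because `Y` is invertible. Modulo the ideal `t` is nilpotent, so up to
radical the ideal is generated by `t` and the `l k` with `c k = 0`. The quotient is a polynomial
ring over `B / (t)` in the other variables. Basis changes of the lattice enter only through `U`. -/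
theorem fibreDim_eq_card {p : R} (hp : IsLocalRing.maximalIdeal R = Ideal.span {p}) {t : B} {n : ℕ}
    (hn : n ≠ 0) {u : B} (hu : IsUnit u) (htn : algebraMap R B p = t ^ n * u)
    [IsNoetherianRing (B ⧸ Ideal.span {t})] (hdim : ringKrullDim (B ⧸ Ideal.span {t}) = 0)
    {c : Fin d → ℕ} {Y Z U V : Matrix (Fin d) (Fin d) B} (hYZ : Y * Z = 1) (hUV : U * V = 1)
    {φ : Fin d → Fin d → B} (hφ : ∀ j i, φ j i = ∑ k, U j k * (t ^ c k * Y k i)) :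
    fibreDim R φ = (Fintype.card {k // c k ≠ 0} : ℕ) := by
  have hVU : V * U = 1 := _root_.mul_eq_one_comm.1 hUV
  rw [fibreDim, map_originIdeal_uStar hp]
  set I := Ideal.span (insert (C (algebraMap R B p)) (Set.range fun i => ∑ j, C (φ j i) * X (R := B) j))
    with hI
  let S := {k // c k ≠ 0}
  let mkB : B →+* B ⧸ Ideal.span {t} := Ideal.Quotient.mk _
  let x : Fin d → MvPolynomial S (B ⧸ Ideal.span {t}) := fun k => if hk : c k ≠ 0 then X ⟨k, hk⟩ else 0
  let g : MvPolynomial (Fin d) B →+* MvPolynomial S (B ⧸ Ideal.span {t}) :=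
    eval₂Hom (C.comp mkB) fun j => ∑ k, C (mkB (V k j)) * x k
  have hgC : ∀ s, g (C s) = C (mkB s) := fun s => eval₂Hom_C _ _ _
  have hgX : ∀ j, g (X j) = ∑ k, C (mkB (V k j)) * x k := fun j => eval₂Hom_X' _ _ _
  obtain ⟨l, hl⟩ : ∃ l : Fin d → MvPolynomial (Fin d) B, ∀ k, l k = ∑ j, C (U j k) * X j :=
    ⟨_, fun _ => rfl⟩
  have hgl : ∀ k, g (l k) = x k := by
    intro k
    simp only [hl, map_sum, map_mul, hgC, hgX, Finset.mul_sum]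
    rw [Finset.sum_comm]
    have h1 : ∀ m, ∑ j, C (mkB (U j k)) * (C (mkB (V m j)) * x m) =
        C (mkB ((1 : Matrix _ _ B) m k)) * x m := by
      intro m
      rw [← hVU, Matrix.mul_apply, map_sum, map_sum, Finset.sum_mul]
      refine Finset.sum_congr rfl fun j _ => ?_
      rw [map_mul, map_mul]; ring
    simp only [h1]
    rw [Finset.sum_eq_single k]
    · simp
    · intro m _ hm; rw [Matrix.one_apply_ne hm]; simp
    · simp
  have hform : ∀ i, ∑ j, C (φ j i) * X j = ∑ k, C (t ^ c k * Y k i) * l k := by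
    intro i
    simp only [hφ, hl, map_sum, map_mul, Finset.sum_mul, Finset.mul_sum]
    rw [Finset.sum_comm]
    exact Finset.sum_congr rfl fun k _ => Finset.sum_congr rfl fun j _ => by ring
  have hmt : mkB t = 0 := Ideal.Quotient.eq_zero_iff_mem.2 (Ideal.mem_span_singleton_self t)
  have hsurj : Function.Surjective g := by
    intro f
    induction f using MvPolynomial.induction_on with
    | C s =>
      obtain ⟨s, rfl⟩ := Ideal.Quotient.mk_surjective s
      exact ⟨C s, hgC s⟩
    | add f f' h h' =>
      obtain ⟨y, rfl⟩ := h
      obtain ⟨y', rfl⟩ := h'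
      exact ⟨y + y', map_add _ _ _⟩
    | mul_X f k h =>
      obtain ⟨y, rfl⟩ := h
      refine ⟨y * l k, ?_⟩
      rw [map_mul, hgl]
      simp only [x]
      rw [dif_pos k.2]
  have hle : I ≤ RingHom.ker g := by
    rw [hI, Ideal.span_le]
    rintro _ (rfl | ⟨i, rfl⟩)
    · rw [SetLike.mem_coe, RingHom.mem_ker, hgC, htn, map_mul, map_pow, hmt, zero_pow hn, zero_mul, map_zero]
    · simp only
      rw [SetLike.mem_coe, RingHom.mem_ker, hform, map_sum]
      refine Finset.sum_eq_zero fun k _ => ?_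
      rw [map_mul, hgC, hgl]
      by_cases hk : c k = 0
      · simp only [x, dif_neg (not_not.2 hk), mul_zero]
      · rw [map_mul, map_pow, hmt, zero_pow hk, zero_mul, map_zero, zero_mul]
  have htI : C t ∈ I.radical := by
    refine ⟨n, ?_⟩
    obtain ⟨u', hu'⟩ := hu.exists_right_inv
    have h1 : (C t : MvPolynomial (Fin d) B) ^ n = C (algebraMap R B p) * C u' := by
      rw [← map_pow, ← map_mul, htn, mul_assoc, hu', mul_one]
    rw [h1]
    exact Ideal.mul_mem_right _ _ (Ideal.subset_span (Or.inl rfl))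
  have hlI : ∀ k, c k = 0 → l k ∈ I := by
    intro k hk
    have h1 : l k = ∑ i, C (Z i k) * ∑ j, C (φ j i) * X j := by
      simp only [hform, Finset.mul_sum]
      rw [Finset.sum_comm]
      have h2 : ∀ m, ∑ i, C (Z i k) * (C (t ^ c m * Y m i) * l m) =
          C (t ^ c m * (1 : Matrix _ _ B) m k) * l m := by
        intro m
        rw [← hYZ, Matrix.mul_apply, Finset.mul_sum, map_sum, Finset.sum_mul]
        refine Finset.sum_congr rfl fun i _ => ?_
        simp only [map_mul]; ring
      simp only [h2]
      rw [Finset.sum_eq_single k]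
      · simp [hk]
      · intro m _ hm; rw [Matrix.one_apply_ne hm]; simp
      · simp
    rw [h1]
    exact Ideal.sum_mem _ fun i _ => Ideal.mul_mem_left _ _ (Ideal.subset_span (Or.inr ⟨i, rfl⟩))
  -- The quotient map modulo the radical factors through `g`: it kills `t`, and it kills `l k` when
  -- `c k = 0`.
  have hge : RingHom.ker g ≤ I.radical := by
    let J := I.radical
    let e : MvPolynomial S (B ⧸ Ideal.span {t}) →+* MvPolynomial (Fin d) B ⧸ J :=
      eval₂Hom (Ideal.Quotient.lift (Ideal.span {t}) ((Ideal.Quotient.mk J).comp C) (by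
        intro s hs
        obtain ⟨s', rfl⟩ := Ideal.mem_span_singleton'.1 hs
        rw [RingHom.comp_apply, Ideal.Quotient.eq_zero_iff_mem, map_mul]
        exact Ideal.mul_mem_left _ _ htI)) fun k => Ideal.Quotient.mk J (l k)
    have hex : ∀ k, e (x k) = Ideal.Quotient.mk J (l k) := by
      intro k
      by_cases hk : c k ≠ 0
      · simp only [x, dif_pos hk]
        exact eval₂Hom_X' _ _ _
      · simp only [x, dif_neg hk, map_zero]
        exact (Ideal.Quotient.eq_zero_iff_mem.2 (Ideal.le_radical (hlI k (not_not.1 hk)))).symm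
    have heC : ∀ s, e (C (mkB s)) = Ideal.Quotient.mk J (C s) := fun s => eval₂Hom_C _ _ _
    have heg : e.comp g = Ideal.Quotient.mk J := by
      refine MvPolynomial.ringHom_ext (fun s => ?_) fun j => ?_
      · rw [RingHom.comp_apply, hgC, heC]
      · rw [RingHom.comp_apply, hgX, map_sum]
        simp only [map_mul, hex, heC]
        simp only [← map_mul, ← map_sum]
        congr 1
        simp only [hl, Finset.mul_sum]
        rw [Finset.sum_comm]
        have h1 : ∀ m, ∑ k, C (V k j) * (C (U m k) * X m) =
            C ((1 : Matrix _ _ B) m j) * X m := by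
          intro m
          rw [← hUV, Matrix.mul_apply, map_sum, Finset.sum_mul]
          refine Finset.sum_congr rfl fun k _ => ?_
          rw [map_mul]; ring
        simp only [h1]
        rw [Finset.sum_eq_single j]
        · simp
        · intro m _ hm; rw [Matrix.one_apply_ne hm]; simp
        · simp
    intro f hf
    rw [← Ideal.Quotient.eq_zero_iff_mem]
    have := RingHom.congr_fun heg f
    rw [RingHom.comp_apply, RingHom.mem_ker.1 hf, map_zero] at this
    exact this.symm
  have hrad : I.radical = (RingHom.ker g).radical :=
    le_antisymm (Ideal.radical_mono hle) (Ideal.radical_le_radical_iff.2 hge)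
  have h1 : ringKrullDim (MvPolynomial (Fin d) B ⧸ I) =
      ringKrullDim (MvPolynomial (Fin d) B ⧸ RingHom.ker g) := by
    rw [ringKrullDim_quotient, ringKrullDim_quotient, ← PrimeSpectrum.zeroLocus_radical I, hrad,
      PrimeSpectrum.zeroLocus_radical]
  rw [h1, ringKrullDim_eq_of_ringEquiv (RingHom.quotientKerEquivOfSurjective hsurj),
    MvPolynomial.ringKrullDim_of_isNoetherianRing, hdim, zero_add, Nat.card_eq_fintype_card]

end FibreDimension

/-! ### The integers of the torsor algebra -/

section TorsorIntegers

open scoped NNReal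

variable {K : Type*} [Field K] [ValuativeRel K] [TopologicalSpace K]
  [IsNonarchimedeanLocalField K] {Γ : Type*} [Group Γ] [TopologicalSpace Γ] [DiscreteTopology Γ]
  {ρ : GalHom K Γ}

variable (ρ) in
/-- The value of an element of the torsor integers at a group element. -/
noncomputable def torsorEval (γ : Γ) : TorsorIntegers ρ →ₐ[𝒪[K]] SeparableClosure K :=
  (((Pi.evalAlgHom K (fun _ : Γ => SeparableClosure K) γ).comp (torsorAlgebra ρ).val).restrictScalars 𝒪[K]).comp
    (integralClosure 𝒪[K] (torsorAlgebra ρ)).val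

theorem torsorIntegers_ext {f f' : TorsorIntegers ρ} (h : ∀ γ, torsorEval ρ γ f = torsorEval ρ γ f') :
    f = f' :=
  Subtype.ext (Subtype.ext (funext h))

theorem torsorEval_mul_left (f : TorsorIntegers ρ) (σ : SepGal K) (γ : Γ) :
    torsorEval ρ (ρ σ * γ) f = σ (torsorEval ρ γ f) :=
  f.1.2 σ γ

theorem torsorEval_smul (f : TorsorIntegers ρ) (δ γ : Γ) :
    torsorEval ρ γ (δ • f) = torsorEval ρ (γ * δ) f := rfl

theorem sepVal_torsorEval (f : TorsorIntegers ρ) (γ : Γ) : sepVal K (torsorEval ρ γ f) ≤ 1 :=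
  sepVal_le_one_iff.2 (f.2.map (((Pi.evalAlgHom K (fun _ : Γ => SeparableClosure K) γ).comp
    (torsorAlgebra ρ).val).restrictScalars 𝒪[K]))

theorem exists_torsorEval_eq [Finite Γ] {f : Γ → SeparableClosure K} (h1 : ∀ γ, sepVal K (f γ) ≤ 1)
    (h2 : ∀ (σ : SepGal K) γ, f (ρ σ * γ) = σ (f γ)) :
    ∃ F : TorsorIntegers ρ, ∀ γ, torsorEval ρ γ F = f γ := by
  have := Fintype.ofFinite Γ
  choose p hp using fun γ => sepVal_le_one_iff.1 (h1 γ)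
  have hint : IsIntegral 𝒪[K] (⟨f, h2⟩ : torsorAlgebra ρ) := by
    -- The product of the monic equations of the finitely many values annihilates all of them at
    -- once.
    refine ⟨∏ γ, p γ, Polynomial.monic_prod_of_monic _ _ fun γ _ => (hp γ).1, ?_⟩
    rw [← Polynomial.aeval_def]
    refine Subtype.ext (funext fun γ => ?_)
    have h3 := Polynomial.aeval_algHom_apply (((Pi.evalAlgHom K (fun _ : Γ => SeparableClosure K) γ).comp
      (torsorAlgebra ρ).val).restrictScalars 𝒪[K]) (⟨f, h2⟩ : torsorAlgebra ρ) (∏ γ, p γ)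
    refine h3.symm.trans ?_
    change Polynomial.aeval (f γ) (∏ γ, p γ) = 0
    rw [map_prod]
    exact Finset.prod_eq_zero (Finset.mem_univ γ) (hp γ).2
  exact ⟨⟨⟨f, h2⟩, hint⟩, fun γ => rfl⟩

theorem isUnit_torsorIntegers [Finite Γ] {f : TorsorIntegers ρ} (h : ∀ γ, sepVal K (torsorEval ρ γ f) = 1) :
    IsUnit f := by
  obtain ⟨f', hf'⟩ := exists_torsorEval_eq (ρ := ρ) (f := fun γ => (torsorEval ρ γ f)⁻¹)
    (fun γ => by rw [map_inv₀, h, inv_one]) (fun σ γ => by rw [torsorEval_mul_left, map_inv₀])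
  refine IsUnit.of_mul_eq_one f' (torsorIntegers_ext fun γ => ?_)
  rw [map_mul, hf', map_one]
  exact mul_inv_cancel₀ ((sepVal K).ne_zero_iff.1 (by rw [h]; exact one_ne_zero))

/-- The element of the torsor algebra that is a uniformizer at every point. -/
theorem exists_torsorUnif [Finite Γ] {ϖ : SeparableClosure K} (hϖ : sepVal K ϖ ≤ 1)
    (hfix : ∀ ν ∈ galKer ρ, ν ϖ = ϖ) :
    ∃ t : TorsorIntegers ρ, ∀ γ, ∃ σ : SepGal K, torsorEval ρ γ t = σ ϖ := by
  -- The function is `ϖ` at one representative of each coset of the image of `ρ`, spread by Galois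
  -- over the coset. It is well defined because `ker ρ` fixes `ϖ`.
  let H := ρ.toMonoidHom.range
  let r : Γ → Γ := fun γ => (Quotient.mk (QuotientGroup.rightRel H) γ).out
  have hr : ∀ γ, ∃ σ : SepGal K, ρ σ * r γ = γ := by
    intro γ
    have h1 : QuotientGroup.rightRel H (r γ) γ := Quotient.exact (Quotient.out_eq _)
    rw [QuotientGroup.rightRel_apply] at h1
    obtain ⟨σ, hσ⟩ := h1
    exact ⟨σ, by rw [show ρ σ = γ * (r γ)⁻¹ from hσ, inv_mul_cancel_right]⟩
  choose σ hσ using hr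
  have hr2 : ∀ τ γ, r (ρ τ * γ) = r γ := by
    intro τ γ
    refine congrArg Quotient.out (Quotient.sound ?_)
    change QuotientGroup.rightRel H _ _
    rw [QuotientGroup.rightRel_apply, mul_inv_rev, mul_inv_cancel_left, ← map_inv]
    exact ⟨τ⁻¹, rfl⟩
  obtain ⟨t, ht⟩ := exists_torsorEval_eq (ρ := ρ) (f := fun γ => σ γ ϖ) (fun γ => by simpa using hϖ)
    (fun τ γ => by
      have h1 : (τ * σ γ)⁻¹ * σ (ρ τ * γ) ∈ galKer ρ := by
        have h2 : ρ (σ (ρ τ * γ)) = ρ τ * ρ (σ γ) := by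
          refine mul_right_cancel (b := r γ) ?_
          rw [mul_assoc, hσ γ, ← hr2 τ γ, hσ]
        rw [mem_galKer, map_mul, map_inv, map_mul, inv_mul_eq_one, h2]
      have h3 := congrArg (τ * σ γ) (hfix _ h1)
      rwa [← AlgEquiv.mul_apply, mul_inv_cancel_left, AlgEquiv.mul_apply] at h3)
  exact ⟨t, fun γ => ⟨σ γ, ht γ⟩⟩

section Regular

variable (K Γ) in
open Classical in
/-- The regular representation by permutation matrices. -/
noncomputable def regularRep [Fintype Γ] : Γ →* Matrix Γ Γ 𝒪[K] where
  toFun δ := Matrix.of fun j i => if j = δ * i then 1 else 0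
  map_one' := by
    ext j i
    simp [Matrix.one_apply]
  map_mul' δ ε := by
    ext j i
    simp [Matrix.mul_apply, mul_assoc]

open Classical in
theorem sum_mul_sepRep_regularRep [Fintype Γ] (x : Γ → SeparableClosure K) (δ γ : Γ) :
    ∑ j, x j * sepRep (regularRep K Γ) δ j γ = x (δ * γ) := by
  simp only [sepRep, regularRep, MonoidHom.coe_mk, OneHom.coe_mk, Matrix.map_apply, Matrix.of_apply]
  rw [Finset.sum_eq_single (δ * γ)]
  · simp
  · intro j _ hj; simp [hj]
  · simp

variable (ρ) in
open Classical in
/-- The torsor integers as the equivariant lattice of the regular representation. -/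
noncomputable def torsorEquivLattice [Fintype Γ] :
    TorsorIntegers ρ ≃ₗ[𝒪[K]] equivariantLattice (regularRep K Γ) ρ :=
  LinearEquiv.ofBijective
    (LinearMap.codRestrict (equivariantLattice (regularRep K Γ) ρ)
      (LinearMap.pi fun γ => (torsorEval ρ γ).toLinearMap) fun f =>
        ⟨fun γ => sepVal_torsorEval f γ, fun σ γ => by
          rw [sum_mul_sepRep_regularRep]; exact (torsorEval_mul_left f σ γ).symm⟩)
    ⟨fun f f' h => torsorIntegers_ext fun γ => congrFun (congrArg Subtype.val h) γ, fun x => by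
      obtain ⟨f, hf⟩ := exists_torsorEval_eq (ρ := ρ) x.2.1 (fun σ γ => by
        rw [x.2.2 σ γ, sum_mul_sepRep_regularRep])
      exact ⟨f, Subtype.ext (funext hf)⟩⟩

/-- The integers of the torsor algebra are the equivariant lattice of the regular representation, so
the adapted basis theorem applies to them too and gives freeness of rank `#Γ`. -/
theorem exists_torsorBasis [Fintype Γ] (hp : ¬ residueChar K ∣ Nat.card Γ) (ρ : GalHom K Γ) :
    Nonempty (Module.Basis Γ 𝒪[K] (TorsorIntegers ρ)) := by
  classical
  obtain ⟨a, b, h⟩ := exists_isGoodPair (K := K)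
  obtain ⟨ϖ, e, hu⟩ := exists_subfieldUnif (galKer ρ) (galKer_isOpen ρ)
  obtain ⟨c, Y, hY⟩ := h.exists_isAdaptedBasis (T := regularRep K Γ) hp hu
  exact ⟨(hY.basis hu).map (torsorEquivLattice ρ).symm⟩

end Regular

theorem exists_quotient_span_equiv {A S ι : Type*} [CommRing A] [CommRing S] [Algebra A S]
    [Fintype ι] (b : Module.Basis ι A S) (p : A) :
    Nonempty ((S ⧸ Ideal.span {algebraMap A S p}) ≃ₗ[A] (ι → A ⧸ Ideal.span {p})) := by
  let f : S →ₗ[A] (ι → A ⧸ Ideal.span {p}) :=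
    LinearMap.pi fun i => (Submodule.mkQ (Ideal.span {p})).comp (b.coord i)
  have hf : ∀ s i, f s i = Submodule.Quotient.mk (b.repr s i) := fun s i => rfl
  have hsurj : Function.Surjective f := by
    intro w
    choose v hv using fun i => Submodule.Quotient.mk_surjective _ (w i)
    refine ⟨b.equivFun.symm v, funext fun i => ?_⟩
    rw [hf, ← b.equivFun_apply, LinearEquiv.apply_symm_apply, hv]
  have hker : LinearMap.ker f = (Ideal.span {algebraMap A S p}).restrictScalars A := by
    ext s
    rw [LinearMap.mem_ker, Submodule.restrictScalars_mem, Ideal.mem_span_singleton']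
    constructor
    · intro h
      have h1 : ∀ i, ∃ x, x * p = b.repr s i := fun i => by
        have h2 := congrFun h i
        rw [hf] at h2
        exact Ideal.mem_span_singleton'.1 ((Submodule.Quotient.mk_eq_zero _).1 h2)
      choose x hx using h1
      refine ⟨∑ i, x i • b i, ?_⟩
      rw [mul_comm, ← Algebra.smul_def, Finset.smul_sum]
      conv_rhs => rw [← b.sum_repr s]
      refine Finset.sum_congr rfl fun i _ => ?_
      rw [smul_smul, mul_comm, hx]
    · rintro ⟨x, rfl⟩
      funext i
      rw [hf, mul_comm, ← Algebra.smul_def, map_smul]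
      exact (Submodule.Quotient.mk_eq_zero _).2
        (Ideal.mem_span_singleton'.2 ⟨b.repr x i, by rw [mul_comm]; rfl⟩)
  exact ⟨(Submodule.Quotient.restrictScalarsEquiv A (Ideal.span {algebraMap A S p})).symm.trans
    ((Submodule.quotEquivOfEq _ _ hker.symm).trans (f.quotKerEquivOfSurjective hsurj))⟩

/-- The length of a free algebra modulo a generator of the maximal ideal is its rank. -/
theorem length_quotient_span_algebraMap {A S ι : Type*} [CommRing A] [IsLocalRing A] [CommRing S] [Algebra A S]
    [Fintype ι] (b : Module.Basis ι A S) {p : A} (hp : IsLocalRing.maximalIdeal A = Ideal.span {p}) :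
    Module.length A (S ⧸ Ideal.span {algebraMap A S p}) = Fintype.card ι := by
  have hsimple : Module.length A (A ⧸ Ideal.span {p}) = 1 := by
    rw [Module.length_eq_one_iff, isSimpleModule_iff_isCoatom, ← hp, ← Ideal.isMaximal_def]
    infer_instance
  obtain ⟨e⟩ := exists_quotient_span_equiv b p
  rw [e.length_eq, Module.length_pi, hsimple, mul_one, ENat.card_eq_coe_fintype_card]

end TorsorIntegers

/-! ### Weights and exponents -/

section Exponents

open scoped NNReal

variable {K : Type*} [Field K] [ValuativeRel K] [TopologicalSpace K]
  [IsNonarchimedeanLocalField K] {Γ : Type*} [Group Γ] [TopologicalSpace Γ] [DiscreteTopology Γ]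
  {ρ : GalHom K Γ} {d : ℕ}

/-- The matrices of a representation. -/
noncomputable def matRep {R : Type*} [CommRing R] (τ : Γ →* GL (Fin d) R) : Γ →* Matrix (Fin d) (Fin d) R :=
  (Units.coeHom _).comp τ

/-- Equivariance recovers all values of `φ` from those at `1`. Thus `Ξ` becomes a lattice of vectors
over `K^sep` rather than of functions on `Γ`. -/
theorem torsorEval_eq_sum {τ : Γ →* GL (Fin d) 𝒪[K]} {φ : Fin d → TorsorIntegers ρ}
    (hφ : φ ∈ tuningModule τ (TorsorIntegers ρ)) (γ : Γ) (i : Fin d) :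
    torsorEval ρ γ (φ i) = ∑ j, torsorEval ρ 1 (φ j) * sepRep (matRep τ) γ j i := by
  have h1 : torsorEval ρ γ (φ i) = torsorEval ρ 1 (γ • φ i) := by rw [torsorEval_smul, one_mul]
  rw [h1, hφ γ i, map_sum]
  refine Finset.sum_congr rfl fun j _ => ?_
  rw [map_smul, Algebra.smul_def, mul_comm]
  rfl

variable (ρ) in
/-- The tuning module as an equivariant lattice. -/
noncomputable def tuningEquivLattice [Finite Γ] (τ : Γ →* GL (Fin d) 𝒪[K]) :
    tuningModule τ (TorsorIntegers ρ) ≃ₗ[𝒪[K]] equivariantLattice (matRep τ) ρ :=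
  LinearEquiv.ofBijective
    (LinearMap.codRestrict (equivariantLattice (matRep τ) ρ)
      ((LinearMap.pi fun i => (torsorEval ρ 1).toLinearMap.comp (LinearMap.proj i)).comp
        (tuningModule τ (TorsorIntegers ρ)).subtype) fun φ =>
        ⟨fun i => sepVal_torsorEval _ 1, fun σ i => by
          have h1 := torsorEval_mul_left (φ.1 i) σ 1
          rw [mul_one, torsorEval_eq_sum φ.2] at h1
          exact h1.symm⟩)
    ⟨fun φ φ' h => by
      refine Subtype.ext (funext fun i => torsorIntegers_ext fun γ => ?_)
      rw [torsorEval_eq_sum φ.2, torsorEval_eq_sum φ'.2]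
      refine Finset.sum_congr rfl fun j _ => ?_
      have h1 : torsorEval ρ 1 (φ.1 j) = torsorEval ρ 1 (φ'.1 j) := congrFun (congrArg Subtype.val h) j
      rw [h1], fun x => by
      have hex : ∀ i, ∃ F : TorsorIntegers ρ, ∀ γ, torsorEval ρ γ F =
          ∑ j, x.1 j * sepRep (matRep τ) γ j i := fun i =>
        exists_torsorEval_eq (fun γ => sepVal_sum_le_one _ fun j _ =>
          sepVal_mul_le_one (x.2.1 j) (sepVal_sepRep _ _ _ _)) (fun σ γ => by
          simp only [sepRep_mul, Matrix.mul_apply, map_sum, map_mul, galois_sepRep, x.2.2 σ,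
            Finset.mul_sum, Finset.sum_mul]
          rw [Finset.sum_comm]
          exact Finset.sum_congr rfl fun j _ => Finset.sum_congr rfl fun k _ => (mul_assoc _ _ _).symm)
      choose F hF using hex
      have hF1 : ∀ i, torsorEval ρ 1 (F i) = x.1 i := fun i => by
        rw [hF, sepRep_one]
        simp [Matrix.one_apply]
      refine ⟨⟨F, fun δ i => torsorIntegers_ext fun γ => ?_⟩, Subtype.ext (funext hF1)⟩
      rw [torsorEval_smul, hF, map_sum]
      simp only [sepRep_mul, Matrix.mul_apply, Finset.mul_sum]
      rw [Finset.sum_comm]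
      refine Finset.sum_congr rfl fun j _ => ?_
      rw [map_smul, hF, Algebra.smul_def, Finset.mul_sum]
      refine Finset.sum_congr rfl fun k _ => ?_
      change _ = sepRep (matRep τ) δ j i * _
      ring⟩

theorem tuningEquivLattice_apply [Finite Γ] (τ : Γ →* GL (Fin d) 𝒪[K])
    (φ : tuningModule τ (TorsorIntegers ρ)) (i : Fin d) :
    (tuningEquivLattice ρ τ φ : Fin d → SeparableClosure K) i = torsorEval ρ 1 (φ.1 i) := rfl

theorem sepVal_eq_one_of_mul_eq_one {x y : SeparableClosure K} (hx : sepVal K x ≤ 1) (hy : sepVal K y ≤ 1)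
    (h : x * y = 1) : sepVal K x = 1 := by
  refine le_antisymm hx ?_
  have h1 := congrArg (sepVal K) h
  rw [map_mul, map_one] at h1
  rw [← h1]
  exact mul_le_of_le_one_right zero_le hy

theorem sepVal_det_sepRep {ι : Type*} [Fintype ι] [DecidableEq ι] (T : Γ →* Matrix ι ι 𝒪[K]) (δ : Γ) :
    sepVal K (sepRep T δ).det = 1 := by
  have h1 : ∀ δ, (sepRep T δ).det = algebraMap 𝒪[K] _ (T δ).det := fun δ =>
    ((algebraMap 𝒪[K] (SeparableClosure K)).map_det _).symm
  refine sepVal_eq_one_of_mul_eq_one (y := (sepRep T δ⁻¹).det) ?_ ?_ ?_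
  · rw [h1]; exact sepVal_integer _
  · rw [h1]; exact sepVal_integer _
  · rw [← Matrix.det_mul, ← sepRep_mul, mul_inv_cancel, sepRep_one, Matrix.det_one]

theorem maximalIdeal_eq_span_unif : 𝓂[K] = Ideal.span {unif K} :=
  unif_irreducible.maximalIdeal_eq

theorem exists_torsorUnif_pow [Finite Γ] {ϖ : SeparableClosure K} {n : ℕ}
    (hu : SubfieldUnif (galKer ρ) ϖ n) : ∃ t : TorsorIntegers ρ, t ∈ nonZeroDivisors (TorsorIntegers ρ) ∧
      (∀ γ, sepVal K (torsorEval ρ γ t) = sepVal K ϖ) ∧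
      ∃ u, IsUnit u ∧ algebraMap 𝒪[K] (TorsorIntegers ρ) (unif K) = t ^ n * u := by
  obtain ⟨t, ht⟩ := exists_torsorUnif (ρ := ρ) hu.lt_one.le hu.fixed
  have hv : ∀ γ, sepVal K (torsorEval ρ γ t) = sepVal K ϖ := fun γ => by
    obtain ⟨σ, hσ⟩ := ht γ
    rw [hσ, sepVal_galois]
  have h0 : ∀ γ, torsorEval ρ γ t ≠ 0 := fun γ =>
    (sepVal K).ne_zero_iff.1 (by rw [hv]; exact hu.val_pos.ne')
  have hval : ∀ γ, sepVal K (sepUnif K / torsorEval ρ γ t ^ n) = 1 := fun γ => by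
    rw [map_div₀, map_pow, hv, hu.pow_eq, div_self sepVal_unif_pos.ne']
  obtain ⟨u, hu'⟩ := exists_torsorEval_eq (ρ := ρ) (f := fun γ => sepUnif K / torsorEval ρ γ t ^ n)
    (fun γ => (hval γ).le) (fun σ γ => by
      rw [torsorEval_mul_left, map_div₀, map_pow, galois_sepUnif])
  refine ⟨t, ?_, hv, u, isUnit_torsorIntegers fun γ => by rw [hu', hval], torsorIntegers_ext fun γ => ?_⟩
  · rw [mem_nonZeroDivisors_iff_right]
    intro x hx
    refine torsorIntegers_ext fun γ => ?_
    have h1 := congrArg (torsorEval ρ γ) hx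
    rw [map_mul, map_zero] at h1
    rw [map_zero]
    exact (mul_eq_zero.1 h1).resolve_right (h0 γ)
  · rw [map_mul, map_pow, hu', AlgHom.commutes, mul_div_cancel₀ _ (pow_ne_zero _ (h0 γ))]
    rfl

/-- Both sides are the length of the torsor integers modulo the uniformizer of `K`, computed once
through powers of `t` and once through freeness. -/
theorem length_quotient_torsorUnif [Finite Γ] (hp : ¬ residueChar K ∣ Nat.card Γ) {t u : TorsorIntegers ρ}
    {n : ℕ} (ht : t ∈ nonZeroDivisors (TorsorIntegers ρ)) (hu : IsUnit u)
    (htu : algebraMap 𝒪[K] (TorsorIntegers ρ) (unif K) = t ^ n * u) :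
    n * Module.length 𝒪[K] (TorsorIntegers ρ ⧸ Ideal.span {t}) = Nat.card Γ := by
  have := Fintype.ofFinite Γ
  obtain ⟨B⟩ := exists_torsorBasis hp ρ
  rw [← length_quotient_span_pow 𝒪[K] ht, Nat.card_eq_fintype_card,
    ← length_quotient_span_algebraMap B maximalIdeal_eq_span_unif, htu,
    Ideal.span_singleton_mul_right_unit hu]

/-- At each `γ` the matrix `W` is `diag(ϖ ^ c j / t(γ) ^ c j) * Y * T(γ)`. Each factor has
determinant of value `1`, so `det W` is a unit of the torsor integers. -/
theorem IsAdaptedBasis.exists_factorization [Finite Γ] {τ : Γ →* GL (Fin d) 𝒪[K]} {ϖ : SeparableClosure K}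
    {n : ℕ} {c : Fin d → ℕ} {Y : Matrix (Fin d) (Fin d) (SeparableClosure K)}
    (h : IsAdaptedBasis (matRep τ) ρ ϖ n c Y) (hu : SubfieldUnif (galKer ρ) ϖ n) {t : TorsorIntegers ρ}
    (htv : ∀ γ, sepVal K (torsorEval ρ γ t) = sepVal K ϖ) :
    ∃ (φ : Module.Basis (Fin d) 𝒪[K] (tuningModule τ (TorsorIntegers ρ)))
      (W Z : Matrix (Fin d) (Fin d) (TorsorIntegers ρ)), W * Z = 1 ∧
      ∀ j i, (φ j : Fin d → TorsorIntegers ρ) i = t ^ c j * W j i := by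
  have h0 : ∀ γ, torsorEval ρ γ t ≠ 0 := fun γ =>
    (sepVal K).ne_zero_iff.1 (by rw [htv]; exact hu.val_pos.ne')
  have hϖ0 := hu.ne_zero
  let φ := (h.basis hu).map (tuningEquivLattice ρ τ).symm
  have hφ : ∀ j i γ, torsorEval ρ γ ((φ j : Fin d → TorsorIntegers ρ) i) =
      ∑ l, ϖ ^ c j * Y j l * sepRep (matRep τ) γ l i := by
    intro j i γ
    rw [torsorEval_eq_sum (φ j).2]
    refine Finset.sum_congr rfl fun l _ => ?_
    rw [← tuningEquivLattice_apply, Module.Basis.map_apply, LinearEquiv.apply_symm_apply, h.basis_apply]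
  have hrat : ∀ j γ, sepVal K (ϖ ^ c j / torsorEval ρ γ t ^ c j) = 1 := fun j γ => by
    rw [map_div₀, map_pow, map_pow, htv, div_self (pow_ne_zero _ hu.val_pos.ne')]
  have hW : ∀ j i, ∃ F : TorsorIntegers ρ, ∀ γ, torsorEval ρ γ F =
      torsorEval ρ γ ((φ j : Fin d → TorsorIntegers ρ) i) / torsorEval ρ γ t ^ c j := by
    intro j i
    refine exists_torsorEval_eq (fun γ => ?_) fun σ γ => by
      rw [torsorEval_mul_left, torsorEval_mul_left, map_div₀, map_pow]
    rw [hφ, Finset.sum_div]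
    refine sepVal_sum_le_one _ fun l _ => ?_
    rw [mul_div_right_comm, mul_div_right_comm]
    exact sepVal_mul_le_one (sepVal_mul_le_one (hrat j γ).le (h.val_le j l)) (sepVal_sepRep _ _ _ _)
  choose W hW using hW
  have hdet : IsUnit (Matrix.of W).det := by
    refine isUnit_torsorIntegers fun γ => ?_
    have h1 : torsorEval ρ γ (Matrix.of W).det =
        (Matrix.diagonal (fun j => ϖ ^ c j / torsorEval ρ γ t ^ c j) * Y * sepRep (matRep τ) γ).det := by
      rw [AlgHom.map_det]
      refine congrArg Matrix.det (Matrix.ext fun j i => ?_)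
      rw [mul_assoc, Matrix.diagonal_mul, Matrix.mul_apply]
      refine (hW j i γ).trans ?_
      rw [hφ, Finset.sum_div, Finset.mul_sum]
      refine Finset.sum_congr rfl fun l _ => ?_
      ring
    obtain ⟨-, -, -, -, hY⟩ := exists_integral_inv h.val_le h.det
    rw [h1, Matrix.det_mul, Matrix.det_mul, map_mul, map_mul, sepVal_det_sepRep, hY, Matrix.det_diagonal,
      map_prod, Finset.prod_congr rfl fun j _ => hrat j γ]
    simp
  refine ⟨φ, Matrix.of W, (Matrix.of W)⁻¹, Matrix.mul_nonsing_inv _ hdet, fun j i => torsorIntegers_ext fun γ => ?_⟩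
  rw [map_mul, map_pow]
  exact ((congrArg _ (hW j i γ)).trans (mul_div_cancel₀ _ (pow_ne_zero _ (h0 γ)))).symm

variable {a b : SepGal K}

/-- One family of exponents controls everything: eigenvalues, colength and fibre dimension. In the
formula for `v`, the length of the torsor integers modulo `t` is `#Γ / n`, which cancels the
normalization and leaves the denominator `n`. -/
theorem IsGoodPair.exists_exponents [Finite Γ] (hp : ¬ residueChar K ∣ Nat.card Γ) (h : IsGoodPair a b)
    (τ : Γ →* GL (Fin d) 𝒪[K]) (ρ : GalHom K Γ) {r : SeparableClosure K}
    (hr : r ^ orderOf (ρ a) = sepUnif K) :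
    ∃ c : Fin d → ℕ, (∀ j, c j < orderOf (ρ a)) ∧
      (∀ s : ℕ, (redRep (matRep τ) (ρ a ^ s)).charpoly =
        ∏ j, (Polynomial.X - Polynomial.C (sepRed (a r / r) ^ (s * c j)))) ∧
      tuningColength τ (TorsorIntegers ρ) ≠ ⊤ ∧
      vFun τ ρ = (∑ j, (c j : ℝ)) / orderOf (ρ a) ∧
      Nonempty (Module.Basis (Fin d) 𝒪[K] (tuningModule τ (TorsorIntegers ρ))) ∧
      ∀ φ : Module.Basis (Fin d) 𝒪[K] (tuningModule τ (TorsorIntegers ρ)),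
        fibreDim 𝒪[K] (fun j => (φ j : Fin d → TorsorIntegers ρ)) =
          (Fintype.card {j // c j ≠ 0} : ℕ) := by
  obtain ⟨ϖ, n, hu⟩ := exists_subfieldUnif (galKer ρ) (galKer_isOpen ρ)
  obtain ⟨c, Y, hY⟩ := h.exists_isAdaptedBasis (T := matRep τ) hp hu
  have hn : n = orderOf (ρ a) := h.ramification_eq hp ρ hu
  obtain ⟨t, ht, htv, u, huu, htu⟩ := exists_torsorUnif_pow hu
  obtain ⟨φ, W, Z, hWZ, hφ⟩ := hY.exists_factorization hu htv
  have hL := length_quotient_torsorUnif hp ht huu htu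
  set L := Module.length 𝒪[K] (TorsorIntegers ρ ⧸ Ideal.span {t}) with hLdef
  have hcard : Nat.card Γ ≠ 0 := Nat.card_pos.ne'
  have hLtop : L ≠ ⊤ := by
    intro h1
    rw [h1, ENat.mul_top (by exact_mod_cast hu.pos.ne')] at hL
    exact ENat.natCast_ne_top _ hL.symm
  have hL0 : L ≠ 0 := by
    intro h1
    rw [h1, mul_zero] at hL
    exact hcard (by exact_mod_cast hL.symm)
  have hspan : Submodule.span (TorsorIntegers ρ)
      (tuningModule τ (TorsorIntegers ρ) : Set (Fin d → TorsorIntegers ρ)) =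
      Submodule.span (TorsorIntegers ρ) (Set.range fun j => (φ j : Fin d → TorsorIntegers ρ)) := by
    refine le_antisymm (Submodule.span_le.2 fun x hx => ?_) (Submodule.span_mono ?_)
    · have h1 := congrArg Subtype.val (φ.sum_repr ⟨x, hx⟩)
      rw [AddSubmonoidClass.coe_finsetSum] at h1
      rw [SetLike.mem_coe, ← show _ = x from h1]
      refine Submodule.sum_mem _ fun j _ => ?_
      have h2 : ((φ.repr ⟨x, hx⟩ j • φ j : tuningModule τ (TorsorIntegers ρ)) : Fin d → TorsorIntegers ρ) =
          algebraMap 𝒪[K] (TorsorIntegers ρ) (φ.repr ⟨x, hx⟩ j) • (φ j : Fin d → TorsorIntegers ρ) :=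
        funext fun i => Algebra.smul_def (φ.repr ⟨x, hx⟩ j) ((φ j : Fin d → TorsorIntegers ρ) i)
      rw [h2]
      exact Submodule.smul_mem _ _ (Submodule.subset_span ⟨j, rfl⟩)
    · rintro _ ⟨j, rfl⟩
      exact (φ j).2
  have hcol : tuningColength τ (TorsorIntegers ρ) = (∑ j, c j : ℕ) * L := by
    rw [tuningColength, hspan]
    exact length_quotient_span_rows 𝒪[K] ht c hWZ hφ
  refine ⟨c, fun j => (hY.lt j).trans_eq hn, ?_, ?_, ?_, ⟨φ⟩, fun ψ => ?_⟩
  · intro s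
    rw [← map_pow, hY.charpoly_eq hu (pow_mem h.inertia s), sepRed_div_pow_of_mem_sepInertia h.inertia hu.ne_zero,
      h.sepRed_div_eq hu.pos.ne' hu.pow_eq (hn ▸ hr)]
    simp only [pow_mul]
  · rw [hcol]
    exact WithTop.mul_ne_top (ENat.natCast_ne_top _) hLtop
  · rw [vFun, hcol]
    lift L to ℕ using hLtop with l hl
    have hL' : n * l = Nat.card Γ := by exact_mod_cast hL
    have hl0 : (l : ℝ) ≠ 0 := by exact_mod_cast hL0
    have hn0 : (n : ℝ) ≠ 0 := by exact_mod_cast hu.pos.ne'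
    have h1 : (((∑ j, c j : ℕ) : ℕ∞) * (l : ℕ∞)).toNat = (∑ j, c j) * l := by
      rw [← Nat.cast_mul, ENat.toNat_natCast]
    rw [h1, ← hL', ← hn]
    push_cast
    field_simp
  · have hfl := Module.length_ne_top_iff.1 hLtop
    have hAN := isFiniteLength_iff_isNoetherian_isArtinian.1 hfl
    have : IsArtinianRing (TorsorIntegers ρ ⧸ Ideal.span {t}) := isArtinian_of_tower 𝒪[K] hAN.2
    have : Nontrivial (TorsorIntegers ρ ⧸ Ideal.span {t}) := by
      by_contra h1
      rw [not_nontrivial_iff_subsingleton] at h1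
      exact hL0 (Module.length_eq_zero)
    have hdim : ringKrullDim (TorsorIntegers ρ ⧸ Ideal.span {t}) = 0 :=
      ringKrullDimZero_iff_ringKrullDim_eq_zero.1 inferInstance
    let f := (algebraMap 𝒪[K] (TorsorIntegers ρ)).mapMatrix (m := Fin d)
    -- An arbitrary basis `ψ` differs from the adapted one by an invertible matrix, so the dimension
    -- does not depend on `ψ`.
    refine fibreDim_eq_card (c := c) (Y := W) (Z := Z) (U := f (φ.toMatrix ψ).transpose)
      (V := f (ψ.toMatrix φ).transpose) maximalIdeal_eq_span_unif hu.pos.ne' huu htu hdim hWZ ?_ ?_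
    · rw [← map_mul, ← Matrix.transpose_mul, Module.Basis.toMatrix_mul_toMatrix_flip, Matrix.transpose_one,
        map_one]
    · intro j i
      have h1 := congrArg Subtype.val (φ.sum_toMatrix_smul_self ψ j)
      rw [AddSubmonoidClass.coe_finsetSum] at h1
      rw [← h1, Finset.sum_apply]
      refine Finset.sum_congr rfl fun k _ => ?_
      rw [← hφ]
      exact Algebra.smul_def (φ.toMatrix ψ k j) ((φ k : Fin d → TorsorIntegers ρ) i)

end Exponents

/-! ### Weights of polynomials with roots of unity as roots -/

section RootWeights

variable {F : Type*} [Field F]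

open Classical in
/-- The number `k / m` with `x = ζ ^ k` and `0 ≤ k < m`, for `ζ` a primitive `m`-th root of unity. -/
noncomputable def fracExp (ζ : F) (m : ℕ) (x : F) : ℝ :=
  if h : ∃ k : ℕ, ζ ^ k = x then (Nat.find h : ℝ) / m else 0

theorem fracExp_pow {ζ : F} {m : ℕ} (hζ : IsPrimitiveRoot ζ m) (hm : m ≠ 0) (k : ℕ) :
    fracExp ζ m (ζ ^ k) = ((k % m : ℕ) : ℝ) / m := by
  classical
  have h : ∃ l : ℕ, ζ ^ l = ζ ^ k := ⟨k, rfl⟩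
  have h1 : ζ ^ (k % m) = ζ ^ k := by
    conv_rhs => rw [← Nat.mod_add_div k m, pow_add, pow_mul, hζ.pow_eq_one, one_pow, mul_one]
  have h2 : Nat.find h = k % m := by
    have hle : Nat.find h ≤ k % m := Nat.find_min' h h1
    have hlt := Nat.mod_lt k (Nat.pos_of_ne_zero hm)
    exact hζ.pow_inj (hle.trans_lt hlt) hlt ((Nat.find_spec h).trans h1.symm)
  rw [fracExp, dif_pos h, h2]

/-- The sum of the exponents of the roots of a polynomial. -/
noncomputable def rootWeight (ζ : F) (m : ℕ) (P : Polynomial F) : ℝ :=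
  (P.roots.map (fracExp ζ m)).sum

theorem rootWeight_prod {ζ : F} {m : ℕ} (hζ : IsPrimitiveRoot ζ m) (hm : m ≠ 0) {ι : Type*} [Fintype ι]
    (e : ι → ℕ) : rootWeight ζ m (∏ j, (Polynomial.X - Polynomial.C (ζ ^ e j))) =
      ∑ j, ((e j % m : ℕ) : ℝ) / m := by
  rw [rootWeight, Polynomial.roots_prod _ _ (Polynomial.monic_prod_X_sub_C _ _).ne_zero]
  simp only [Polynomial.roots_X_sub_C, Multiset.bind_singleton, Multiset.map_map, Function.comp_def,
    fracExp_pow hζ hm]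
  rfl

end RootWeights

/-! ### Weights as sums of exponents of eigenvalues -/

section WeightFormulas

variable {K : Type*} [Field K] [ValuativeRel K] [TopologicalSpace K]
  [IsNonarchimedeanLocalField K] {Γ : Type*} [Group Γ] [TopologicalSpace Γ] [DiscreteTopology Γ]
  [Finite Γ] (hp : ¬ residueChar K ∣ Nat.card Γ) {a b : SepGal K} (h : IsGoodPair a b) {d : ℕ}
  (τ : Γ →* GL (Fin d) 𝒪[K]) (ρ : GalHom K Γ)

include hp in
theorem tuning_wellDefined :
    tuningColength τ (TorsorIntegers ρ) ≠ ⊤ ∧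
      Nonempty (Module.Basis (Fin d) 𝒪[K] (tuningModule τ (TorsorIntegers ρ))) ∧
      ∀ φ : Module.Basis (Fin d) 𝒪[K] (tuningModule τ (TorsorIntegers ρ)), ∃ n : ℕ,
        fibreDim 𝒪[K] (fun j => (φ j : Fin d → TorsorIntegers ρ)) = n ∧
        wFun τ ρ = n - vFun τ ρ := by
  obtain ⟨a, b, h⟩ := exists_isGoodPair (K := K)
  obtain ⟨r, hr⟩ := exists_pow_eq_sep (not_residueChar_dvd_of_dvd (orderOf_dvd_natCard (ρ a)) hp) (sepUnif K)
  obtain ⟨c, -, -, h3, -, h5, h6⟩ := h.exists_exponents hp τ ρ hr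
  refine ⟨h3, h5, fun φ => ⟨_, h6 φ, ?_⟩⟩
  rw [wFun, dif_pos h5, h6]
  rfl

include hp h

/-- The two weights in terms of the eigenvalues of the image of the generator of tame inertia. -/
theorem IsGoodPair.weights_eq {r : SeparableClosure K} (hr : r ^ orderOf (ρ a) = sepUnif K) :
    vFun τ ρ = rootWeight (sepRed (a r / r)) (orderOf (ρ a)) (redRep (matRep τ) (ρ a)).charpoly ∧
      wFun τ ρ = rootWeight (sepRed (a r / r)) (orderOf (ρ a)) (redRep (matRep τ) (ρ a)⁻¹).charpoly := by
  have hn := not_residueChar_dvd_of_dvd (orderOf_dvd_natCard (ρ a)) hp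
  have hη := isPrimitiveRoot_sepRed hn (h.primitive _ hn r hr)
  have hn0 : orderOf (ρ a) ≠ 0 := (orderOf_pos _).ne'
  have hnR : (orderOf (ρ a) : ℝ) ≠ 0 := by exact_mod_cast hn0
  obtain ⟨c, hc, hch, h3, hv, h5, h6⟩ := h.exists_exponents hp τ ρ hr
  have hv' : vFun τ ρ = ∑ j, (c j : ℝ) / orderOf (ρ a) := by rw [hv, Finset.sum_div]
  constructor
  · have h1 := hch 1
    rw [pow_one] at h1
    rw [h1, rootWeight_prod hη hn0, hv']
    refine Finset.sum_congr rfl fun j _ => ?_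
    rw [one_mul, Nat.mod_eq_of_lt (hc j)]
  · have h1 := hch (orderOf (ρ a) - 1)
    have h2 : (ρ a)⁻¹ = ρ a ^ (orderOf (ρ a) - 1) := by
      rw [inv_eq_iff_mul_eq_one, ← pow_succ', Nat.sub_add_cancel (orderOf_pos _), pow_orderOf_eq_one]
    rw [h2, h1, rootWeight_prod hη hn0]
    have hw : wFun τ ρ = ((Fintype.card {j // c j ≠ 0} : ℕ) : ℝ) - vFun τ ρ := by
      rw [wFun, dif_pos h5, h6]; rfl
    rw [hw, hv', Fintype.card_subtype, Finset.card_filter]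
    push_cast
    rw [← Finset.sum_sub_distrib]
    refine Finset.sum_congr rfl fun j _ => ?_
    by_cases hj : c j = 0
    · simp [hj]
    · have h4 : (orderOf (ρ a) - 1) * c j % orderOf (ρ a) = orderOf (ρ a) - c j := by
        have h5 : (orderOf (ρ a) - 1) * c j = (orderOf (ρ a) - c j) + orderOf (ρ a) * (c j - 1) := by
          obtain ⟨n, hn⟩ := Nat.exists_eq_add_of_lt (hc j)
          obtain ⟨k, hk⟩ := Nat.exists_eq_succ_of_ne_zero hj
          rw [hn, hk]
          simp only [Nat.succ_eq_add_one, Nat.add_sub_cancel]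
          have : k + 1 + n + 1 - (k + 1) = n + 1 := by omega
          rw [this]; ring
        rw [h5, Nat.add_mul_mod_self_left, Nat.mod_eq_of_lt]
        have := hc j
        omega
      rw [h4, Nat.cast_sub (hc j).le, if_pos hj, sub_div, div_self hnR]

/-- Inverting the image of the generator of tame inertia exchanges the two weights. -/
theorem IsGoodPair.vFun_eq_wFun {ρ' : GalHom K Γ} (hρ : ρ' a = (ρ a)⁻¹) : vFun τ ρ' = wFun τ ρ := by
  obtain ⟨r, hr⟩ := exists_pow_eq_sep (not_residueChar_dvd_of_dvd (orderOf_dvd_natCard (ρ a)) hp) (sepUnif K)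
  have ho : orderOf (ρ' a) = orderOf (ρ a) := by rw [hρ, orderOf_inv]
  rw [(h.weights_eq hp τ ρ' (ho ▸ hr)).1, (h.weights_eq hp τ ρ hr).2, ho, hρ]

/-- The weight in terms of any primitive root of unity in an extension of the residue field. -/
theorem IsGoodPair.exists_vFun_eq {F : Type*} [Field F] (j : SepRes K →+* F) {ζ : F}
    (hζ : IsPrimitiveRoot ζ (Nat.card Γ)) : ∃ s : ℕ, s.Coprime (Nat.card Γ) ∧ ∀ ρ : GalHom K Γ,
      vFun τ ρ = rootWeight ζ (Nat.card Γ) ((redRep (matRep τ) (ρ a ^ s)).map j).charpoly := by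
  have hm0 : Nat.card Γ ≠ 0 := Nat.card_pos.ne'
  have : NeZero (Nat.card Γ) := ⟨hm0⟩
  obtain ⟨r, hr⟩ := exists_pow_eq_sep hp (sepUnif K)
  have hr0 := ne_zero_of_pow_eq_sepUnif hm0 hr
  have hη := (isPrimitiveRoot_sepRed hp (h.primitive _ hp r hr)).map_of_injective j.injective
  have hw : sepVal K (a r / r) ≤ 1 := by
    rw [map_div₀, sepVal_galois, div_self ((sepVal K).ne_zero_iff.2 hr0)]
  -- The given `ζ` need not be the root of unity attached to `a`, only its `s`-th power with `s`
  -- prime to `#Γ`. The discrepancy is moved to the group element, as `ρ a ^ s`.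
  obtain ⟨s, -, hs, hsζ⟩ := hη.isPrimitiveRoot_iff.1 hζ
  refine ⟨s, hs, fun ρ => ?_⟩
  obtain ⟨l, hl⟩ := orderOf_dvd_natCard (ρ a)
  have hn0 : orderOf (ρ a) ≠ 0 := (orderOf_pos _).ne'
  have hl0 : l ≠ 0 := by rintro rfl; exact hm0 (by rw [hl, mul_zero])
  -- With `#Γ = n l`, the `l`-th power of one root serves every `ρ`; exponents over `n` become
  -- exponents over `#Γ` after multiplication by `l`.
  have hrl : (r ^ l) ^ orderOf (ρ a) = sepUnif K := by rw [← pow_mul, mul_comm, ← hl, hr]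
  obtain ⟨c, hc, hch, -, hv, -, -⟩ := h.exists_exponents hp τ ρ hrl
  have h1 := hch s
  rw [Matrix.charpoly_map, h1, Polynomial.map_prod, hv, Finset.sum_div]
  have h2 : ∀ i, Polynomial.map j (Polynomial.X - Polynomial.C (sepRed (a (r ^ l) / r ^ l) ^ (s * c i))) =
      Polynomial.X - Polynomial.C (ζ ^ (l * c i)) := by
    intro i
    have h4 : sepRed (a (r ^ l) / r ^ l) = sepRed (a r / r) ^ l := by
      rw [map_pow a, ← div_pow, sepRed_pow hw]
    rw [Polynomial.map_sub, Polynomial.map_X, Polynomial.map_C, h4, ← pow_mul, map_pow j, ← hsζ, ← pow_mul,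
      ← mul_assoc, mul_comm l s, mul_assoc, mul_left_comm]
  simp only [h2]
  rw [rootWeight_prod hζ hm0]
  refine Finset.sum_congr rfl fun i _ => ?_
  have h3 : l * c i < Nat.card Γ := by
    rw [hl, mul_comm]
    exact Nat.mul_lt_mul_of_pos_right (hc i) (Nat.pos_of_ne_zero hl0)
  rw [Nat.mod_eq_of_lt h3, hl]
  have : (l : ℝ) ≠ 0 := by exact_mod_cast hl0
  push_cast
  field_simp

end WeightFormulas

/-! ### The parametrization by pairs and the involution -/

section Involution

variable {K : Type*} [Field K] [ValuativeRel K] [TopologicalSpace K]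
  [IsNonarchimedeanLocalField K] {Γ : Type*} [Group Γ] [TopologicalSpace Γ] [DiscreteTopology Γ]
  [Finite Γ] (hp : ¬ residueChar K ∣ Nat.card Γ) {a b : SepGal K} (h : IsGoodPair a b)

include hp h

theorem IsGoodPair.exists_involution : ∃ ι : GalHom K Γ → GalHom K Γ, Function.Involutive ι ∧
    ∀ ρ, ι ρ a = (ρ a)⁻¹ ∧ ι ρ b = ρ b := by
  have hex : ∀ ρ : GalHom K Γ, ∃ ρ' : GalHom K Γ, ρ' a = (ρ a)⁻¹ ∧ ρ' b = ρ b := fun ρ =>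
    h.exists_galHom hp (by rw [inv_pow, ← h.galHom_rel hp ρ, conj_inv])
  choose ι hι using hex
  refine ⟨ι, fun ρ => h.galHom_ext hp ?_ ?_, hι⟩
  · rw [(hι _).1, (hι ρ).1, inv_inv]
  · rw [(hι _).2, (hι ρ).2]

theorem IsGoodPair.bijOn_eval : Set.BijOn (fun ρ : GalHom K Γ => (ρ a, ρ b)) Set.univ
    {gh | gh.2 * gh.1 * gh.2⁻¹ = gh.1 ^ residueCard K} := by
  refine ⟨fun ρ _ => h.galHom_rel hp ρ, fun ρ _ ρ' _ he => ?_, fun gh hgh => ?_⟩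
  · exact h.galHom_ext hp (congrArg Prod.fst he) (congrArg Prod.snd he)
  · obtain ⟨ρ, h1, h2⟩ := h.exists_galHom hp hgh
    exact ⟨ρ, trivial, Prod.ext h1 h2⟩

end Involution

/-! ### Sums of powers are admissible -/

section AdmissibleSums

/-- Numerator and denominator are multiplied by `q ^ r - 1`, so `c = 1` and the numerator is `∑ ((q
α_i) ^ r - α_i ^ r)`. -/
theorem exists_admissibleExpr_sum {q : ℕ} (hq : 1 < q) {I : Type*} [Fintype I] {α : I → ℂ}
    (hα : ∀ i, α i ≠ 0) : ∃ e : AdmissibleExpr, e.eval q = (fun r : ℕ+ => ∑ i, α i ^ (r : ℤ)) ∧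
      e.dualEval q = fun r : ℕ+ => ∑ i, α i ^ (-(r : ℤ)) := by
  have hq0 : (0 : ℝ) < q := by positivity
  have hqC : (q : ℂ) ≠ 0 := by exact_mod_cast hq0.ne'
  let f := Fintype.equivFin (I ⊕ I)
  let n : I ⊕ I → ℤ := Sum.elim (fun _ => 1) fun _ => -1
  let β : I ⊕ I → ℂ := Sum.elim (fun i => q * α i) α
  have hβ : ∀ i, β i ≠ 0 := by
    rintro (i | i)
    · exact mul_ne_zero hqC (hα i)
    · exact hα i
  have hsum : ∀ k : ℤ, ∑ i, (n i : ℂ) * β i ^ k = ((q : ℂ) ^ k - 1) * ∑ i, α i ^ k := by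
    intro k
    simp only [Fintype.sum_sum_type, n, β, Sum.elim_inl, Sum.elim_inr, mul_zpow, ← Finset.mul_sum]
    push_cast
    ring
  have hsum' : ∀ k : ℤ, ∑ i, (n (f.symm i) : ℂ) * β (f.symm i) ^ k = ((q : ℂ) ^ k - 1) * ∑ i, α i ^ k :=
    fun k => (f.symm.sum_comp fun i => (n i : ℂ) * β i ^ k).trans (hsum k)
  have hne : ∀ k : ℤ, k ≠ 0 → (q : ℂ) ^ k - 1 ≠ 0 := by
    intro k hk h
    have h1 : (q : ℝ) ^ k = 1 := by
      refine Complex.ofReal_eq_one.1 ?_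
      push_cast
      exact sub_eq_zero.1 h
    rw [zpow_eq_one_iff_right₀ hq0.le (by exact_mod_cast hq.ne')] at h1
    exact hk h1
  refine ⟨⟨_, fun i => n (f.symm i), fun i => β (f.symm i), fun i => hβ _, 1, one_ne_zero⟩,
    funext fun r => ?_, funext fun r => ?_⟩
  · have h1 := hsum' r
    simp only [zpow_natCast] at h1
    simp only [AdmissibleExpr.eval]
    rw [h1, Rat.cast_one, one_mul, Real.rpow_natCast]
    have h2 := hne r (by exact_mod_cast r.ne_zero)
    rw [zpow_natCast] at h2
    push_cast
    simp only [zpow_natCast]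
    rw [mul_div_cancel_left₀ _ h2]
  · simp only [AdmissibleExpr.dualEval]
    rw [hsum', Rat.cast_one, one_mul, Real.rpow_neg hq0.le, Real.rpow_natCast]
    have h2 := hne (-(r : ℤ)) (neg_ne_zero.2 (by exact_mod_cast r.ne_zero))
    rw [zpow_neg, zpow_natCast] at h2
    rw [zpow_neg, zpow_natCast]
    push_cast
    rw [mul_div_cancel_left₀ _ h2]

theorem isAdmissible_sum {q : ℕ} (hq : 1 < q) {I : Type*} [Fintype I] {α : I → ℂ}
    (hα : ∀ i, α i ≠ 0) : IsAdmissible q (fun r : ℕ+ => ∑ i, α i ^ (r : ℤ)) ∧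
      dualFun q (fun r : ℕ+ => ∑ i, α i ^ (r : ℤ)) = fun r : ℕ+ => ∑ i, α i ^ (-(r : ℤ)) := by
  obtain ⟨e, he, hd⟩ := exists_admissibleExpr_sum hq hα
  exact ⟨⟨e, he.symm⟩, by rw [← he, dualFun_eval hq, hd]⟩

theorem sum_zpow_primitiveRoot {l : ℕ} {ω : ℂ} (hω : IsPrimitiveRoot ω l) (k : ℤ) :
    ∑ i : Fin l, (ω ^ (i : ℕ)) ^ k = if (l : ℤ) ∣ k then (l : ℂ) else 0 := by
  have h1 : ∀ i : Fin l, (ω ^ (i : ℕ)) ^ k = (ω ^ k) ^ (i : ℕ) := fun i => by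
    rw [← zpow_natCast, ← zpow_natCast, zpow_comm]
  simp only [h1]
  rw [Fin.sum_univ_eq_sum_range (fun i => (ω ^ k) ^ i) l]
  split_ifs with h
  · rw [(hω.zpow_eq_one_iff_dvd k).2 h]; simp
  · have h2 : ω ^ k - 1 ≠ 0 := sub_ne_zero.2 fun h3 => h ((hω.zpow_eq_one_iff_dvd k).1 h3)
    have h3 := geom_sum_mul (ω ^ k) l
    rw [← zpow_natCast, ← zpow_mul, mul_comm k, zpow_mul, zpow_natCast, hω.pow_eq_one, one_zpow, sub_self,
      mul_eq_zero, or_iff_left h2] at h3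
    exact h3

open Classical in
/-- Sums over the fixed points of the powers of a permutation are power sums. -/
theorem exists_powerSum_of_perm {X : Type*} [Fintype X] (σ : Equiv.Perm X) {t : X → ℂ}
    (ht0 : ∀ x, t x ≠ 0) (ht : ∀ x, t (σ x) = t x) :
    ∃ (m : ℕ) (α : Fin m → ℂ), (∀ i, α i ≠ 0) ∧
      ∀ k : ℤ, ∑ x, (if (σ ^ k) x = x then t x ^ k else 0) = ∑ i, α i ^ k := by
  let O := MulAction.orbitRel.Quotient (Subgroup.zpowers σ) X
  let l : O → ℕ := fun o => Function.minimalPeriod (σ • ·) o.out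
  have hl0 : ∀ o, l o ≠ 0 := fun o => by
    simp only [l, MulAction.minimalPeriod_eq_card]
    have := (MulAction.nonempty_orbit (M := Subgroup.zpowers σ) (Quotient.out o)).to_subtype
    exact Fintype.card_ne_zero
  let ω : O → ℂ := fun o => Complex.exp (2 * Real.pi * Complex.I / l o)
  have hω : ∀ o, IsPrimitiveRoot (ω o) (l o) := fun o => Complex.isPrimitiveRoot_exp _ (hl0 o)
  -- The numbers `ω ^ i t`, with `ω` a primitive `l`-th root of unity, have `k`-th power sum `l t ^
  -- k` if `l ∣ k` and `0` otherwise. That is the contribution of an orbit of length `l`, for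
  -- negative `k` as well.
  let β : (Σ o : O, Fin (l o)) → ℂ := fun z => ω z.1 ^ (z.2 : ℕ) * t z.1.out
  have htz : ∀ (k : ℤ) x, t ((σ ^ k) x) = t x := by
    intro k
    induction k with
    | zero => simp
    | succ k ih => intro x; rw [add_comm, zpow_add, zpow_one, Equiv.Perm.mul_apply, ht, ih]
    | pred k ih =>
      intro x
      rw [← ht, ← Equiv.Perm.mul_apply, ← zpow_one_add]
      convert ih x using 4
      ring
  have hrep : ∀ x : X, ∃ k : ℤ, x = (σ ^ k) (Quotient.mk (MulAction.orbitRel (Subgroup.zpowers σ) X) x).out := by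
    intro x
    have h1 : MulAction.orbitRel (Subgroup.zpowers σ) X x
        (Quotient.mk (MulAction.orbitRel (Subgroup.zpowers σ) X) x).out :=
      Setoid.symm' _ (Quotient.exact (Quotient.out_eq _))
    obtain ⟨⟨_, k, rfl⟩, h2⟩ := MulAction.orbitRel_apply.1 h1
    exact ⟨k, h2.symm⟩
  have hfib : ∀ (k : ℤ) (o : O),
      ∑ x with (Quotient.mk (MulAction.orbitRel (Subgroup.zpowers σ) X) x : O) = o,
        (if (σ ^ k) x = x then t x ^ k else 0) = ∑ i : Fin (l o), β ⟨o, i⟩ ^ k := by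
    intro k o
    have h1 : ∑ x with (Quotient.mk (MulAction.orbitRel (Subgroup.zpowers σ) X) x : O) = o,
        (if (σ ^ k) x = x then t x ^ k else 0) =
        ∑ x with (Quotient.mk (MulAction.orbitRel (Subgroup.zpowers σ) X) x : O) = o,
          (if (l o : ℤ) ∣ k then t o.out ^ k else 0) := by
      refine Finset.sum_congr rfl fun x hx => ?_
      obtain ⟨j, hj⟩ := hrep x
      rw [(Finset.mem_filter.1 hx).2] at hj
      have h2 : (σ ^ k) x = x ↔ (l o : ℤ) ∣ k := by
        rw [← MulAction.zpow_smul_eq_iff_minimalPeriod_dvd, hj, ← Equiv.Perm.mul_apply, ← zpow_add,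
          add_comm, zpow_add, Equiv.Perm.mul_apply, (σ ^ j).injective.eq_iff]
        rfl
      have h3 : t x = t o.out := by rw [hj, htz]
      simp only [h2, h3]
    have h4 : (Finset.univ.filter fun x =>
        (Quotient.mk (MulAction.orbitRel (Subgroup.zpowers σ) X) x : O) = o).card = l o := by
      simp only [l]
      rw [MulAction.minimalPeriod_eq_card, ← Set.toFinset_card]
      congr 1
      ext x
      rw [Finset.mem_filter, Set.mem_toFinset, ← MulAction.orbitRel_apply]
      simp only [Finset.mem_univ, true_and]
      rw [← Quotient.out_eq o, Quotient.eq, Quotient.out_eq]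
    rw [h1, Finset.sum_const, h4, nsmul_eq_mul]
    simp only [β, mul_zpow]
    rw [← Finset.sum_mul, sum_zpow_primitiveRoot (hω o)]
    split_ifs <;> simp
  let f := Fintype.equivFin (Σ o : O, Fin (l o))
  refine ⟨_, fun i => β (f.symm i), fun i => mul_ne_zero (pow_ne_zero _ ((hω _).ne_zero (hl0 _))) (ht0 _),
    fun k => ?_⟩
  rw [f.symm.sum_comp fun z => β z ^ k, Fintype.sum_sigma]
  rw [← Finset.sum_fiberwise (s := Finset.univ)
    (g := fun x => (Quotient.mk (MulAction.orbitRel (Subgroup.zpowers σ) X) x : O))]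
  exact Finset.sum_congr rfl fun o _ => hfib k o

end AdmissibleSums

/-! ### Counting pairs by conjugacy classes -/

section Counting

variable {Γ : Type*} [Group Γ]

/-- The power map on conjugacy classes. -/
def conjPow (Q : ℕ) : ConjClasses Γ → ConjClasses Γ :=
  Quotient.map (fun g => g ^ Q) fun _ _ h => IsConj.pow Q h

theorem conjPow_mk (Q : ℕ) (g : Γ) : conjPow Q (ConjClasses.mk g) = ConjClasses.mk (g ^ Q) := rfl

theorem conjPow_conjPow (Q Q' : ℕ) (x : ConjClasses Γ) : conjPow Q (conjPow Q' x) = conjPow (Q' * Q) x := by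
  obtain ⟨g, rfl⟩ := ConjClasses.exists_rep x
  simp only [conjPow_mk, pow_mul]

variable [Finite Γ]

theorem exists_pow_pow_eq {Q : ℕ} (hQ : Q.Coprime (Nat.card Γ)) : ∃ Q' : ℕ, ∀ g : Γ, g ^ (Q * Q') = g := by
  rcases (Nat.one_le_iff_ne_zero.2 Nat.card_pos.ne' : 1 ≤ Nat.card Γ).eq_or_lt with h1 | h1
  · have := (Nat.card_eq_one_iff_unique.1 h1.symm).1
    exact ⟨1, fun g => Subsingleton.elim _ _⟩
  · obtain ⟨Q', -, h2⟩ := Nat.exists_mul_mod_eq_one_of_coprime hQ h1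
    exact ⟨Q', fun g => by rw [← pow_mod_natCard, h2, pow_one]⟩

theorem exists_conjPerm {q : ℕ} (hq : q.Coprime (Nat.card Γ)) :
    ∃ σ : Equiv.Perm (ConjClasses Γ), ∀ (r : ℕ) x, (σ ^ r) x = conjPow (q ^ r) x := by
  obtain ⟨q', hq'⟩ := exists_pow_pow_eq hq
  have hid : ∀ x : ConjClasses Γ, conjPow (q * q') x = x := fun x => by
    obtain ⟨g, rfl⟩ := ConjClasses.exists_rep x
    rw [conjPow_mk, hq']
  refine ⟨⟨conjPow q, conjPow q', fun x => by rw [conjPow_conjPow, hid],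
    fun x => by rw [conjPow_conjPow, mul_comm, hid]⟩, fun r => ?_⟩
  induction r with
  | zero =>
    intro x
    obtain ⟨g, rfl⟩ := ConjClasses.exists_rep x
    rw [pow_zero, pow_zero, conjPow_mk, pow_one]; rfl
  | succ r ih =>
    intro x
    rw [pow_succ', Equiv.Perm.mul_apply, ih, pow_succ, ← conjPow_conjPow]; rfl

open Classical in
-- For fixed `g` the solutions `h` number `A g (g ^ Q)`, which depends on `g ^ Q` only through its
-- class. If the class of `g₀` is its own `Q`-th power, the sum over its members is `∑ g, A g g₀ =
-- #Γ`, since each `h` conjugates exactly one `g` to `g₀`.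
theorem sum_pairs_eq [Fintype Γ] [Fintype (ConjClasses Γ)] (Q : ℕ) {t : Γ → ℝ} {t' : ConjClasses Γ → ℝ}
    (ht : ∀ g, t' (ConjClasses.mk g) = t g) :
    ∑ p : Γ × Γ, (if p.2 * p.1 * p.2⁻¹ = p.1 ^ Q then t p.1 else 0) =
      Nat.card Γ * ∑ x : ConjClasses Γ, if conjPow Q x = x then t' x else 0 := by
  let A : Γ → Γ → ℕ := fun g g' => (Finset.univ.filter fun h => h * g * h⁻¹ = g').card
  have hA : ∀ g g' k, A g g' = A g (k * g' * k⁻¹) := by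
    intro g g' k
    refine Finset.card_bij (fun h _ => k * h) (fun h hh => ?_) (fun h _ h' _ he => mul_left_cancel he)
      fun h hh => ⟨k⁻¹ * h, ?_, by simp⟩
    · rw [Finset.mem_filter] at hh ⊢
      refine ⟨Finset.mem_univ _, ?_⟩
      rw [← hh.2]; group
    · rw [Finset.mem_filter] at hh ⊢
      refine ⟨Finset.mem_univ _, ?_⟩
      have h1 : g' = k⁻¹ * (h * g * h⁻¹) * k := by rw [hh.2]; group
      rw [h1]; group
  have hsum : ∀ g', ∑ g, A g g' = Nat.card Γ := by
    intro g'
    simp only [A, Finset.card_filter]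
    rw [Finset.sum_comm]
    have h1 : ∀ h : Γ, ∑ g, (if h * g * h⁻¹ = g' then 1 else 0) = 1 := by
      intro h
      rw [Finset.sum_eq_single (h⁻¹ * g' * h)]
      · rw [if_pos (by group)]
      · intro g _ hg
        rw [if_neg]
        rintro rfl
        exact hg (by group)
      · simp
    simp only [h1]
    simp [Nat.card_eq_fintype_card]
  have h0 : ∀ g g', ConjClasses.mk g ≠ ConjClasses.mk g' → A g g' = 0 := by
    intro g g' hne
    refine Finset.card_eq_zero.2 (Finset.filter_eq_empty_iff.2 fun h _ hh => hne ?_)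
    exact ConjClasses.mk_eq_mk_iff_isConj.2 (isConj_iff.2 ⟨h, hh⟩)
  rw [Fintype.sum_prod_type]
  have h1 : ∀ g, ∑ h, (if h * g * h⁻¹ = g ^ Q then t g else 0) = (A g (g ^ Q) : ℝ) * t g := by
    intro g
    rw [← Finset.sum_filter, Finset.sum_const, nsmul_eq_mul]
  simp only [h1]
  rw [← Finset.sum_fiberwise (s := Finset.univ) (g := fun g : Γ => ConjClasses.mk g), Finset.mul_sum]
  refine Finset.sum_congr rfl fun x _ => ?_
  obtain ⟨g₀, rfl⟩ := ConjClasses.exists_rep x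
  have h2 : ∀ g ∈ Finset.univ.filter (fun g : Γ => ConjClasses.mk g = ConjClasses.mk g₀),
      (A g (g ^ Q) : ℝ) * t g =
        (if conjPow Q (ConjClasses.mk g₀) = ConjClasses.mk g₀ then t' (ConjClasses.mk g₀) else 0) * A g g₀ := by
    intro g hg
    have hg' := (Finset.mem_filter.1 hg).2
    rw [← ht, hg']
    split_ifs with hc
    · rw [conjPow_mk, ← conjPow_mk, ← hg', conjPow_mk, hg'] at hc
      obtain ⟨k, hk⟩ := isConj_iff.1 (ConjClasses.mk_eq_mk_iff_isConj.1 hc)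
      rw [hA g (g ^ Q) k, hk, mul_comm]
    · rw [h0 g (g ^ Q), Nat.cast_zero, zero_mul, zero_mul]
      intro he
      refine hc ?_
      rw [← hg', conjPow_mk, ← he]
  rw [Finset.sum_congr rfl h2, ← Finset.mul_sum, mul_comm]
  have h3 : ∑ g with ConjClasses.mk g = ConjClasses.mk g₀, A g g₀ = Nat.card Γ := by
    rw [← hsum g₀]
    refine Finset.sum_filter_of_ne fun g _ hg => ?_
    by_contra hne
    exact hg (h0 g g₀ hne)
  rw [← h3]
  push_cast
  rfl

end Counting

/-! ### Unramified extensions -/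

section Unramified

theorem isPrecomplete_pi {R ι : Type*} [CommRing R] [Finite ι] (I : Ideal R) [IsPrecomplete I R] :
    IsPrecomplete I (ι → R) where
  prec' f hf := by
    have := Fintype.ofFinite ι
    classical
    have hcoord : ∀ (n : ℕ) (v : ι → R), v ∈ (I ^ n • ⊤ : Submodule R (ι → R)) ↔ ∀ i, v i ∈ I ^ n := by
      intro n v
      constructor
      · intro hv i
        have h1 := Submodule.mem_map_of_mem (f := LinearMap.proj (R := R) (φ := fun _ : ι => R) i) hv
        rw [Submodule.map_smul''] at h1
        simpa using Submodule.smul_mono le_rfl le_top h1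
      · intro hv
        have h1 : v = ∑ i, v i • (Pi.single i 1 : ι → R) := by
          funext j
          simp [Finset.sum_apply, Pi.single_apply]
        rw [h1]
        exact Submodule.sum_mem _ fun i _ => Submodule.smul_mem_smul (hv i) Submodule.mem_top
    have hi : ∀ i, ∃ l, ∀ n, f n i ≡ l [SMOD (I ^ n • ⊤ : Submodule R R)] := fun i =>
      IsPrecomplete.prec' (fun n => f n i) fun {m n} hmn => by
        have h1 := hf hmn
        rw [SModEq.sub_mem, hcoord] at h1
        rw [SModEq.sub_mem]
        simpa using h1 i
    choose l hl using hi
    refine ⟨l, fun n => ?_⟩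
    rw [SModEq.sub_mem, hcoord]
    intro i
    have h1 := hl i n
    rw [SModEq.sub_mem] at h1
    simpa using h1

theorem isAdicComplete_integer (K : Type*) [Field K] [ValuativeRel K] [TopologicalSpace K]
    [IsNonarchimedeanLocalField K] : IsAdicComplete 𝓂[K] 𝒪[K] := by
  let := IsTopologicalAddGroup.rightUniformSpace K
  have := isUniformAddGroup_of_addCommGroup (G := K)
  infer_instance

variable {K L : Type*} [Field K] [ValuativeRel K] [TopologicalSpace K] [IsNonarchimedeanLocalField K]
  [Field L] [ValuativeRel L] [TopologicalSpace L] [IsNonarchimedeanLocalField L]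
  [Algebra K L] [ValuativeExtension K L]

theorem integerMap_injective : Function.Injective (integerMap K L) := fun _ _ h =>
  Subtype.ext ((algebraMap K L).injective (congrArg Subtype.val h))

variable (h : Ideal.map (integerMap K L) 𝓂[K] = 𝓂[L])

include h

theorem isLocalHom_integerMap : IsLocalHom (integerMap K L) where
  map_nonunit x hx := by
    by_contra hx'
    have h1 : integerMap K L x ∈ 𝓂[L] := h ▸ Ideal.mem_map_of_mem _ ((IsLocalRing.mem_maximalIdeal x).2 hx')
    exact (IsLocalRing.mem_maximalIdeal _).1 h1 hx

theorem residueChar_eq_of_unramified : residueChar L = residueChar K := by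
  have := isLocalHom_integerMap h
  have : CharP 𝓀[K] (residueChar K) := ringChar.charP _
  exact (ringChar.eq_iff.2 (charP_of_injective_ringHom
    (IsLocalRing.ResidueField.map (integerMap K L)).injective (residueChar K)))

/-- The integer ring of `L` is free over that of `K`, of rank the degree; reduce modulo the common
uniformizer and count. -/
theorem residueCard_eq_of_unramified [FiniteDimensional K L] :
    residueCard L = residueCard K ^ Module.finrank K L := by
  let : Algebra 𝒪[K] 𝒪[L] := (integerMap K L).toAlgebra
  -- Lifts of the finitely many residues of `L` span modulo the maximal ideal, which is extended
  -- from `K`. Completeness below and separatedness above then make them generators.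
  have hfin : Module.Finite 𝒪[K] 𝒪[L] := by
    have := isAdicComplete_integer K
    have := isAdicComplete_integer L
    have := isPrecomplete_pi (ι := 𝓀[L]) 𝓂[K]
    have : IsHausdorff (𝓂[K].map (algebraMap 𝒪[K] 𝒪[L])) 𝒪[L] := by
      change IsHausdorff (𝓂[K].map (integerMap K L)) 𝒪[L]
      rw [h]; infer_instance
    have := IsHausdorff.map_algebraMap_iff.mp this
    choose s hs using fun y : 𝓀[L] => IsLocalRing.residue_surjective y
    have := Fintype.ofFinite 𝓀[L]
    refine Module.Finite.of_surjective (Fintype.linearCombination 𝒪[K] s)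
      (surjective_of_mkQ_comp_surjective (I := 𝓂[K]) fun y => ?_)
    obtain ⟨y, rfl⟩ := Submodule.mkQ_surjective _ y
    classical
    refine ⟨Pi.single (IsLocalRing.residue _ y) 1, ?_⟩
    rw [LinearMap.comp_apply, Fintype.linearCombination_apply_single, one_smul, Submodule.mkQ_apply,
      Submodule.mkQ_apply, Submodule.Quotient.eq, Ideal.smul_top_eq_map, Submodule.restrictScalars_mem]
    change _ ∈ 𝓂[K].map (integerMap K L)
    rw [h, ← IsLocalRing.residue_eq_zero_iff, map_sub, hs, sub_self]
  have hfree : Module.Free 𝒪[K] 𝒪[L] := by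
    have : FaithfulSMul 𝒪[K] 𝒪[L] := (faithfulSMul_iff_algebraMap_injective _ _).2 integerMap_injective
    infer_instance
  have hrank : Module.finrank K L = Module.finrank 𝒪[K] 𝒪[L] := by
    let : Algebra 𝒪[K] L := ((algebraMap K L).comp (algebraMap 𝒪[K] K)).toAlgebra
    have : IsScalarTower 𝒪[K] K L := IsScalarTower.of_algebraMap_eq fun _ => rfl
    have : IsScalarTower 𝒪[K] 𝒪[L] L := IsScalarTower.of_algebraMap_eq fun _ => rfl
    exact IsFractionRing.finrank_eq 𝒪[K] K 𝒪[L] L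
  let b := Module.finBasis 𝒪[K] 𝒪[L]
  obtain ⟨e⟩ := exists_quotient_span_equiv b (unif K)
  have h1 : Ideal.span {algebraMap 𝒪[K] 𝒪[L] (unif K)} = 𝓂[L] := by
    rw [← h, maximalIdeal_eq_span_unif, Ideal.map_span, Set.image_singleton]; rfl
  rw [h1, ← maximalIdeal_eq_span_unif] at e
  have h2 := Nat.card_congr e.toEquiv
  rw [Nat.card_fun, Nat.card_fin, ← hrank] at h2
  exact h2

/-- A map from the residue field of `L^sep` to an algebraic closure of the residue field of `K`. -/
theorem exists_sepRes_hom : ∃ j : SepRes L →+* AlgebraicClosure 𝓀[K], ∀ x : 𝒪[K],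
    j (integerRed L (integerMap K L x)) = algebraMap 𝓀[K] _ (IsLocalRing.residue 𝒪[K] x) := by
  have := isLocalHom_integerMap h
  let f : 𝒪[K] →+* SepRes L := (integerRed L).comp (integerMap K L)
  have : IsLocalHom f := inferInstanceAs (IsLocalHom ((integerRed L).comp (integerMap K L)))
  let : Algebra 𝓀[K] (SepRes L) := (IsLocalRing.ResidueField.lift f).toAlgebra
  have : Algebra.IsAlgebraic 𝓀[K] (SepRes L) := ⟨fun y => by
    by_cases hy : y = 0
    · rw [hy]; exact isAlgebraic_zero
    · obtain ⟨n, hn, hyn⟩ := exists_pow_eq_one_sepRes hy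
      refine IsIntegral.isAlgebraic (IsIntegral.of_pow (Nat.pos_of_ne_zero (ne_zero_of_residueChar hn)) ?_)
      rw [hyn]; exact isIntegral_one⟩
  let j : SepRes L →ₐ[𝓀[K]] AlgebraicClosure 𝓀[K] := IsAlgClosed.lift
  exact ⟨j, fun x => j.commutes (IsLocalRing.residue 𝒪[K] x)⟩

end Unramified

/-! ### Total masses -/

section ClassWeights

variable {F : Type*} [Field F] {Γ : Type*} [Group Γ] {d : ℕ}

theorem charpoly_conj (T : Γ →* Matrix (Fin d) (Fin d) F) {g g' : Γ} (hg : IsConj g g') :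
    (T g).charpoly = (T g').charpoly := by
  obtain ⟨k, rfl⟩ := isConj_iff.1 hg
  rw [map_mul, Matrix.charpoly_mul_comm, ← map_mul, inv_mul_cancel_left]

/-- The sum of the exponents of the eigenvalues, as a function of conjugacy classes. -/
noncomputable def classWeight (ζ : F) (T : Γ →* Matrix (Fin d) (Fin d) F) : ConjClasses Γ → ℝ :=
  Quotient.lift (fun g => rootWeight ζ (Nat.card Γ) (T g).charpoly) fun g g' hg => by
    rw [charpoly_conj T (show IsConj g g' from hg)]

theorem classWeight_mk (ζ : F) (T : Γ →* Matrix (Fin d) (Fin d) F) (g : Γ) :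
    classWeight ζ T (ConjClasses.mk g) = rootWeight ζ (Nat.card Γ) (T g).charpoly := rfl

/-- A representation defined over a field with `q` elements has weights invariant under `q`-th powers. -/
theorem classWeight_conjPow {k : Type*} [Field k] [Finite k] [Algebra k F] (ζ : F)
    (T : Γ →* Matrix (Fin d) (Fin d) k) (x : ConjClasses Γ) :
    classWeight ζ ((algebraMap k F).mapMatrix.toMonoidHom.comp T) (conjPow (Nat.card k) x) =
      classWeight ζ ((algebraMap k F).mapMatrix.toMonoidHom.comp T) x := by
  have := Fintype.ofFinite k
  obtain ⟨g, rfl⟩ := ConjClasses.exists_rep x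
  rw [conjPow_mk, classWeight_mk, classWeight_mk]
  change rootWeight ζ _ ((T (g ^ Nat.card k)).map (algebraMap k F)).charpoly =
    rootWeight ζ _ ((T g).map (algebraMap k F)).charpoly
  rw [Matrix.charpoly_map, Matrix.charpoly_map, map_pow, Nat.card_eq_fintype_card (α := k),
    FiniteField.Matrix.charpoly_pow_card]

end ClassWeights

/-! ### Total masses as sums over conjugacy classes -/

section Masses

variable {K : Type*} [Field K] [ValuativeRel K] [TopologicalSpace K]
  [IsNonarchimedeanLocalField K] {Γ : Type*} [Group Γ] [TopologicalSpace Γ] [DiscreteTopology Γ]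
  [Finite Γ] (hp : ¬ residueChar K ∣ Nat.card Γ) {d : ℕ}
  (τ : Γ →* GL (Fin d) 𝒪[K])

include hp

open Classical in
-- The sum over `ρ` becomes a sum over pairs, and `sum_pairs_eq` cancels the factor `1 / #Γ`. The
-- scalar `ε` allows the weights `v` and `-v` to be treated together.
theorem totalMass_const_mul_vFun [Fintype (ConjClasses Γ)] {F : Type*} [Field F] (j : SepRes K →+* F) {ζ : F}
    (hζ : IsPrimitiveRoot ζ (Nat.card Γ)) {T : Γ →* Matrix (Fin d) (Fin d) F}
    (hT : ∀ g, T g = (redRep (matRep τ) g).map j) (ε : ℝ) :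
    totalMass K Γ (fun ρ => ε * vFun τ ρ) = ENNReal.ofReal (∑ x : ConjClasses Γ,
      if conjPow (residueCard K) x = x then (residueCard K : ℝ) ^ (-(ε * classWeight ζ T x)) else 0) := by
  have := finite_galHom (K := K) hp
  have := Fintype.ofFinite (GalHom K Γ)
  have := Fintype.ofFinite Γ
  obtain ⟨a, b, h⟩ := exists_isGoodPair K
  obtain ⟨s, hs, hv⟩ := h.exists_vFun_eq hp τ j hζ
  obtain ⟨s', hs'⟩ := exists_pow_pow_eq hs
  let t' : ConjClasses Γ → ℝ := fun x => (residueCard K : ℝ) ^ (-(ε * classWeight ζ T x))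
  let t : Γ → ℝ := fun g => t' (ConjClasses.mk g)
  -- Weights are computed at `ρ a ^ s`. As `s` is prime to `#Γ`, raising the first entry to the
  -- power `s` is a bijection that preserves the relation.
  let e : Γ × Γ ≃ Γ × Γ := Equiv.prodCongr ⟨fun g => g ^ s, fun g => g ^ s',
    fun g => by simp only [← pow_mul, hs'], fun g => by simp only [← pow_mul, mul_comm s' s, hs']⟩ (Equiv.refl Γ)
  have hrel : ∀ g k : Γ, k * g * k⁻¹ = g ^ residueCard K ↔ k * g ^ s * k⁻¹ = (g ^ s) ^ residueCard K := by
    intro g k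
    rw [← conj_pow, ← pow_mul, mul_comm s, pow_mul]
    refine ⟨fun h => by rw [h], fun h => ?_⟩
    have h1 : ((k * g * k⁻¹) ^ s) ^ s' = ((g ^ residueCard K) ^ s) ^ s' := by rw [h]
    rwa [← pow_mul, hs', ← pow_mul (g ^ _), hs'] at h1
  have hsum : ∑ ρ : GalHom K Γ, (residueCard K : ℝ) ^ (-(ε * vFun τ ρ)) =
      Nat.card Γ * ∑ x : ConjClasses Γ, if conjPow (residueCard K) x = x then t' x else 0 := by
    rw [← sum_pairs_eq (residueCard K) (t := t) (t' := t') (fun g => rfl), ← e.sum_comp, ← Finset.sum_filter]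
    refine Finset.sum_bij (fun ρ _ => (ρ a, ρ b)) (fun ρ _ => ?_) (fun ρ _ ρ' _ he => ?_)
      (fun p hp' => ?_) fun ρ _ => ?_
    · exact Finset.mem_filter.2 ⟨Finset.mem_univ _, (hrel _ _).1 ((h.bijOn_eval hp).mapsTo (Set.mem_univ ρ))⟩
    · exact (h.bijOn_eval hp).injOn (Set.mem_univ _) (Set.mem_univ _) he
    · obtain ⟨ρ, -, h1⟩ := (h.bijOn_eval hp).surjOn ((hrel p.1 p.2).2 (Finset.mem_filter.1 hp').2)
      exact ⟨ρ, Finset.mem_univ _, h1⟩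
    · rw [hv ρ, ← hT]; rfl
  rw [totalMass, tsum_fintype, ← ENNReal.ofReal_sum_of_nonneg fun ρ _ => by positivity, hsum,
    ENNReal.ofReal_mul (by positivity), ENNReal.ofReal_natCast, ← mul_assoc,
    ENNReal.inv_mul_cancel (by exact_mod_cast Nat.card_pos.ne') (ENNReal.natCast_ne_top _), one_mul]
  exact congrArg ENNReal.ofReal (Finset.sum_congr rfl fun x _ => by split_ifs <;> rfl)

theorem totalMass_neg_wFun : totalMass K Γ (-wFun τ) = totalMass K Γ (-vFun τ) := by
  obtain ⟨a, b, h⟩ := exists_isGoodPair K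
  obtain ⟨ι, hι, hab⟩ := h.exists_involution hp
  have hw : ∀ ρ : GalHom K Γ, vFun τ (ι ρ) = wFun τ ρ := fun ρ => h.vFun_eq_wFun hp τ ρ (hab ρ).1
  rw [totalMass, totalMass, ← (hι.toPerm ι).tsum_eq]
  simp only [Pi.neg_apply, Function.Involutive.coe_toPerm, ← hw, hι _]

end Masses

/-! ### Masses over unramified extensions as power sums -/

section UnramifiedMasses

open Classical in
/-- The masses over all unramified extensions of weights of representations of `Γ` are power sums. -/
theorem exists_powerSum_totalMass {K : Type*} [Field K] [ValuativeRel K] [TopologicalSpace K]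
    [IsNonarchimedeanLocalField K] {Γ : Type*} [Group Γ] [TopologicalSpace Γ] [DiscreteTopology Γ]
    [Finite Γ] (hp : ¬ residueChar K ∣ Nat.card Γ) {d : ℕ} (τ : Γ →* GL (Fin d) 𝒪[K]) :
    ∃ (m : ℕ) (α : Fin m → ℂ), (∀ i, α i ≠ 0) ∧
      ∀ (L : Type*) [Field L] [ValuativeRel L] [TopologicalSpace L] [IsNonarchimedeanLocalField L]
        [Algebra K L] [ValuativeExtension K L] (r : ℕ+), IsUnramifiedOfDegree K L r →
        totalMass L Γ (vFun (baseChangeRep L τ)) ≠ ⊤ ∧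
        totalMass L Γ (-wFun (baseChangeRep L τ)) ≠ ⊤ ∧
        ((totalMass L Γ (vFun (baseChangeRep L τ))).toReal : ℂ) = ∑ i, α i ^ (r : ℤ) ∧
        ((totalMass L Γ (-wFun (baseChangeRep L τ))).toReal : ℂ) = ∑ i, α i ^ (-(r : ℤ)) := by
  have hq1 := residueCard_two_le (K := K)
  have hq0 : (0 : ℝ) < residueCard K := by exact_mod_cast (by omega : 0 < residueCard K)
  -- A single root of unity in an algebraic closure of the residue field of `K` is used for all `L`,
  -- so that the weight of a conjugacy class does not depend on `r`.
  let F := AlgebraicClosure 𝓀[K]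
  have hchar : CharP F (residueChar K) :=
    have : CharP 𝓀[K] (residueChar K) := ringChar.charP _
    charP_of_injective_algebraMap (algebraMap 𝓀[K] F).injective _
  have : NeZero (Nat.card Γ : F) := ⟨fun h => hp ((CharP.cast_eq_zero_iff F _ _).1 h)⟩
  obtain ⟨ζ, hζ⟩ := HasEnoughRootsOfUnity.exists_primitiveRoot F (Nat.card Γ)
  have := Fintype.ofFinite (ConjClasses Γ)
  let T₀ : Γ →* Matrix (Fin d) (Fin d) 𝓀[K] :=
    (IsLocalRing.residue 𝒪[K]).mapMatrix.toMonoidHom.comp (matRep τ)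
  let T : Γ →* Matrix (Fin d) (Fin d) F := (algebraMap 𝓀[K] F).mapMatrix.toMonoidHom.comp T₀
  obtain ⟨σ, hσ⟩ := exists_conjPerm (coprime_residueCard hp).symm
  let t : ConjClasses Γ → ℂ := fun x => (((residueCard K : ℝ) ^ (-classWeight ζ T x) : ℝ) : ℂ)
  have ht0 : ∀ x, t x ≠ 0 := fun x => Complex.ofReal_ne_zero.2 (Real.rpow_pos_of_pos hq0 _).ne'
  have ht : ∀ x, t (σ x) = t x := fun x => by
    have h1 := hσ 1 x
    rw [pow_one, pow_one] at h1
    simp only [t, h1]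
    rw [show classWeight ζ T (conjPow (residueCard K) x) = classWeight ζ T x from classWeight_conjPow ζ T₀ x]
  obtain ⟨m, α, hα, hsum⟩ := exists_powerSum_of_perm σ ht0 ht
  refine ⟨m, α, hα, fun L _ _ _ _ _ _ r hr => ?_⟩
  have : FiniteDimensional K L := Module.finite_of_finrank_pos (by rw [hr.1]; exact r.pos)
  have hpL : ¬ residueChar L ∣ Nat.card Γ := by rwa [residueChar_eq_of_unramified hr.2]
  have hqL : residueCard L = residueCard K ^ (r : ℕ) := by rw [residueCard_eq_of_unramified hr.2, hr.1]
  obtain ⟨j, hj⟩ := exists_sepRes_hom hr.2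
  have hT : ∀ g, T g = (redRep (matRep (baseChangeRep L τ)) g).map j := fun g => by
    ext i l
    exact (hj _).symm
  have hmass := totalMass_const_mul_vFun hpL (baseChangeRep L τ) j hζ hT
  have hnonneg : ∀ ε : ℝ, 0 ≤ ∑ x : ConjClasses Γ, if conjPow (residueCard L) x = x then
      (residueCard L : ℝ) ^ (-(ε * classWeight ζ T x)) else 0 := fun ε =>
    Finset.sum_nonneg fun x _ => by split_ifs <;> positivity
  have hpos : ∀ x, t x ^ (r : ℤ) = (((residueCard L : ℝ) ^ (-(1 * classWeight ζ T x)) : ℝ) : ℂ) := fun x => by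
    simp only [t]
    rw [hqL, zpow_natCast, ← Complex.ofReal_pow, ← Real.rpow_natCast, ← Real.rpow_mul hq0.le, Nat.cast_pow,
      ← Real.rpow_natCast, ← Real.rpow_mul hq0.le, one_mul, mul_comm]
  have hneg : ∀ x, t x ^ (-(r : ℤ)) = (((residueCard L : ℝ) ^ (-(-1 * classWeight ζ T x)) : ℝ) : ℂ) := fun x => by
    rw [zpow_neg, hpos, ← Complex.ofReal_inv, ← Real.rpow_neg (Nat.cast_nonneg _)]
    ring_nf
  have hfix : ∀ x, (σ ^ (r : ℤ)) x = x ↔ conjPow (residueCard L) x = x := fun x => by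
    rw [zpow_natCast, hσ, hqL]
  -- A permutation and its inverse have the same fixed points, so the power sum with exponent `-r`
  -- runs over the same classes and is the mass for `-v`.
  have hfix' : ∀ x, (σ ^ (-(r : ℤ))) x = x ↔ conjPow (residueCard L) x = x := fun x => by
    rw [← hfix, zpow_neg, Equiv.Perm.inv_eq_iff_eq, eq_comm]
  have h1 := (congrArg (totalMass L Γ) (funext fun ρ => (one_mul (vFun (baseChangeRep L τ) ρ)).symm)).trans (hmass 1)
  have h2 := (totalMass_neg_wFun hpL (baseChangeRep L τ)).trans ((congrArg (totalMass L Γ)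
    (funext fun ρ => (neg_one_mul (vFun (baseChangeRep L τ) ρ)).symm)).trans (hmass (-1)))
  rw [h1, h2, ← hsum, ← hsum, ENNReal.toReal_ofReal (hnonneg _), ENNReal.toReal_ofReal (hnonneg _)]
  refine ⟨ENNReal.ofReal_ne_top, ENNReal.ofReal_ne_top, ?_, ?_⟩
  · rw [Complex.ofReal_sum]
    refine Finset.sum_congr rfl fun x _ => ?_
    simp only [hfix, hpos]
    split_ifs <;> simp
  · rw [Complex.ofReal_sum]
    refine Finset.sum_congr rfl fun x _ => ?_
    simp only [hfix', hneg]
    split_ifs <;> simp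

end UnramifiedMasses

/-! ### The main theorem -/

theorem mainTheorem3 {K : Type*} [Field K] [ValuativeRel K] [TopologicalSpace K]
    [IsNonarchimedeanLocalField K]
    {Γ : Type*} [Group Γ] [Finite Γ] [TopologicalSpace Γ] [DiscreteTopology Γ]
    (hp : ¬ residueChar K ∣ Nat.card Γ)
    {d : ℕ} (τ : Γ →* GL (Fin d) 𝒪[K]) :
    -- `S_{K,Γ}` is finite, and each of its elements factors through `Gal(K^tame/K)`
    Finite (GalHom K Γ) ∧
    (∀ (ρ : GalHom K Γ) (σ : SeparableClosure K ≃ₐ[K] SeparableClosure K),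
      (∀ x ∈ tameClosure K, σ x = x) → ρ σ = 1) ∧
    -- `v` and `w` are well defined: finite length, `Ξ` free of rank `d`, and `w` is given by the
    -- dimension of the fibre for every choice of a basis of `Ξ`
    (∀ ρ : GalHom K Γ,
      tuningColength τ (TorsorIntegers ρ) ≠ ⊤ ∧
      Nonempty (Module.Basis (Fin d) 𝒪[K] (tuningModule τ (TorsorIntegers ρ))) ∧
      ∀ φ : Module.Basis (Fin d) 𝒪[K] (tuningModule τ (TorsorIntegers ρ)), ∃ n : ℕ,
        fibreDim 𝒪[K] (fun j => (φ j : Fin d → TorsorIntegers ρ)) = n ∧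
        wFun τ ρ = n - vFun τ ρ) ∧
    -- generators `a, b` of the tame Galois group exist; for all of them, `S_{K,Γ}` is parametrized
    -- by the pairs `(g, h)`, and the involution `(g, h) ↦ (g⁻¹, h)` exchanges `w` and `v`
    (∃ a b : tameClosure K ≃ₐ[K] tameClosure K, IsTamePair K a b) ∧
    (∀ a b : tameClosure K ≃ₐ[K] tameClosure K, IsTamePair K a b →
      Set.BijOn (tameParam (Γ := Γ) a b) Set.univ
        {gh | gh.2 * gh.1 * gh.2⁻¹ = gh.1 ^ residueCard K} ∧
      ∃ ι : GalHom K Γ → GalHom K Γ, Function.Involutive ι ∧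
        (∀ ρ, tameParam a b (ι ρ) = ((tameParam a b ρ).1⁻¹, (tameParam a b ρ).2)) ∧
        (∀ ρ, vFun τ (ι ρ) = wFun τ ρ) ∧
        -- termwise duality
        ∀ ρ, IsAdmissible (residueCard K)
            (fun r : ℕ+ => (((residueCard K : ℝ) ^ (-vFun τ (ι ρ) * (r : ℝ)) : ℝ) : ℂ)) ∧
          dualFun (residueCard K)
            (fun r : ℕ+ => (((residueCard K : ℝ) ^ (-vFun τ (ι ρ) * (r : ℝ)) : ℝ) : ℂ)) =
            fun r : ℕ+ => (((residueCard K : ℝ) ^ (wFun τ ρ * (r : ℝ)) : ℝ) : ℂ)) ∧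
    -- the total mass for `-w` is the total mass for `-v`
    totalMass K Γ (-wFun τ) = totalMass K Γ (-vFun τ) ∧
    -- strong duality, for the unramified extensions `Kr r` of `K` of degree `r = 1, 2, 3, …`
    (∀ (Kr : ℕ+ → Type*) [∀ r, Field (Kr r)] [∀ r, ValuativeRel (Kr r)]
      [∀ r, TopologicalSpace (Kr r)] [∀ r, IsNonarchimedeanLocalField (Kr r)]
      [∀ r, Algebra K (Kr r)] [∀ r, ValuativeExtension K (Kr r)],
      (∀ r, IsUnramifiedOfDegree K (Kr r) r) →
      (∀ r, totalMass (Kr r) Γ (vFun (baseChangeRep (Kr r) τ)) ≠ ⊤) ∧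
      (∀ r, totalMass (Kr r) Γ (-wFun (baseChangeRep (Kr r) τ)) ≠ ⊤) ∧
      IsAdmissible (residueCard K)
        (fun r => ((totalMass (Kr r) Γ (vFun (baseChangeRep (Kr r) τ))).toReal : ℂ)) ∧
      IsAdmissible (residueCard K)
        (fun r => ((totalMass (Kr r) Γ (-wFun (baseChangeRep (Kr r) τ))).toReal : ℂ)) ∧
      (fun r => ((totalMass (Kr r) Γ (-wFun (baseChangeRep (Kr r) τ))).toReal : ℂ)) =
        dualFun (residueCard K)
          (fun r => ((totalMass (Kr r) Γ (vFun (baseChangeRep (Kr r) τ))).toReal : ℂ)) ∧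
      dualFun (residueCard K)
          (fun r => ((totalMass (Kr r) Γ (-wFun (baseChangeRep (Kr r) τ))).toReal : ℂ)) =
        fun r => ((totalMass (Kr r) Γ (vFun (baseChangeRep (Kr r) τ))).toReal : ℂ)) := by
  have hq1 : 1 < residueCard K := residueCard_two_le (K := K)
  have hq0 : (0 : ℝ) < residueCard K := by exact_mod_cast hq1.le
  refine ⟨finite_galHom hp, fun ρ σ hσ => ?_, tuning_wellDefined hp τ, ?_, fun a b hab => ?_,
    totalMass_neg_wFun hp τ, ?_⟩
  · exact galHom_eq_one_of_levels hp ρ (fixes_tameClosure_iff.1 fun x => hσ x x.2)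
  · obtain ⟨a, b, h⟩ := exists_isGoodPair K
    exact ⟨_, _, h.isTamePair⟩
  · have h := hab.isGoodPair
    obtain ⟨ι, hι, hιab⟩ := h.exists_involution hp
    have hvw : ∀ ρ : GalHom K Γ, vFun τ (ι ρ) = wFun τ ρ := fun ρ => h.vFun_eq_wFun hp τ ρ (hιab ρ).1
    refine ⟨h.bijOn_eval hp, ι, hι, fun ρ => Prod.ext (hιab ρ).1 (hιab ρ).2, hvw, fun ρ => ?_⟩
    -- A single exponential is a power sum with one term.
    have h1 := isAdmissible_sum hq1 (I := Unit)
      (α := fun _ => (((residueCard K : ℝ) ^ (-vFun τ (ι ρ)) : ℝ) : ℂ))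
      fun _ => Complex.ofReal_ne_zero.2 (Real.rpow_pos_of_pos hq0 _).ne'
    have h2 : ∀ (x : ℝ) (r : ℕ+), (((residueCard K : ℝ) ^ x : ℝ) : ℂ) ^ (r : ℤ) =
        (((residueCard K : ℝ) ^ (x * (r : ℝ)) : ℝ) : ℂ) := fun x r => by
      rw [zpow_natCast, ← Complex.ofReal_pow, ← Real.rpow_natCast, ← Real.rpow_mul hq0.le]
    simp only [Fintype.sum_unique, zpow_neg, h2, ← Complex.ofReal_inv, ← Real.rpow_neg hq0.le,
      neg_mul, neg_neg] at h1
    simp only [neg_mul, ← hvw]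
    exact h1
  · intro Kr _ _ _ _ _ _ hr
    obtain ⟨m, α, hα, hmass⟩ := exists_powerSum_totalMass hp τ
    have h := fun r => hmass (Kr r) r (hr r)
    have h1 := isAdmissible_sum hq1 hα
    -- The mass for `-w` is the power sum of the inverses `α_i⁻¹`, whose dual is the original power
    -- sum.
    have h2 := isAdmissible_sum hq1 fun i => inv_ne_zero (hα i)
    simp only [inv_zpow', neg_neg] at h2
    simp only [(h _).2.2.1, (h _).2.2.2]
    exact ⟨fun r => (h r).1, fun r => (h r).2.1, h1.1, h2.1, h1.2.symm, h2.2⟩
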